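/- For a finite simple graph $G$, a NAC-colouring of $G$ is a surjective map $E(G)\to\{\text{red},\text{blue}\}$ such that no cycle of $G$ contains exactly one red edge or exactly one blue edge. Let $\mathcal N$ be the property of a graph of being connected and having no NAC-colouring, and let $\mathcal T$ be the property that every vertex lies in a triangle. For each $n$, let $(G_t(n))_{t=0}^{\binom n2}$ be the random graph process on $n$ labelled vertices: $G_0(n)$ is the graph with no edges and, for each $t\ge 1$, $G_t(n)$ is obtained from $G_{t-1}(n)$ by adding an edge chosen uniformly at random, independently of previous choices, among the pairs of vertices not adjacent in $G_{t-1}(n)$. For a graph property $\mathcal P$ let $\tau_{\mathcal P}$ be the smallest $t$ with $G_t(n)\in\mathcal P$ (and $\tau_{\mathcal P}=\infty$ if there is no such $t$). Then asymptotically almost surely $\tau_{\mathcal N}=\tau_{\mathcal T}$, that is, $$\lim_{n\to\infty}\mathbb P\bigl(\tau_{\mathcal N}=\tau_{\mathcal T}\bigr)=1 .$$ -/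

import Mathlib

open Filter Topology

/-- A NAC-colouring of `G`: a surjective colouring of the edges of `G` with two colours
(`true` is red, `false` is blue) such that no cycle of `G` contains exactly one edge of one of
the colours. -/
def IsNACColouring {V : Type*} (G : SimpleGraph V) (c : G.edgeSet → Bool) : Prop :=
  Function.Surjective c ∧
    ∀ (v : V) (w : G.Walk v v), w.IsCycle →
      ∀ b : Bool, ¬ ∃! e : G.edgeSet, (e : Sym2 V) ∈ w.edges ∧ c e = b

/-- The property of being connected and having no NAC-colouring. -/
def ConnectedNoNAC {V : Type*} (G : SimpleGraph V) : Prop :=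
  G.Connected ∧ ¬ ∃ c : G.edgeSet → Bool, IsNACColouring G c

/-- The property that every vertex lies in a triangle. -/
def EveryVertexInTriangle {V : Type*} (G : SimpleGraph V) : Prop :=
  ∀ v : V, ∃ u w : V, G.Adj v u ∧ G.Adj v w ∧ G.Adj u w

open Classical in
/-- One step of the random graph process: a uniformly random non-edge of `G` is added to `G`
(the complete graph, which has no non-edge, is left unchanged). -/
noncomputable def randomGraphStep {V : Type*} [Finite V] (G : SimpleGraph V) :
    PMF (SimpleGraph V) :=
  if h : (Set.toFinite Gᶜ.edgeSet).toFinset.Nonempty then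
    (PMF.uniformOfFinset (Set.toFinite Gᶜ.edgeSet).toFinset h).map
      fun e => G ⊔ SimpleGraph.fromEdgeSet {e}
  else PMF.pure G

/-- The joint law of `(G_0, …, G_m)`: `G_0` is the empty graph, and given `(G_0, …, G_m)`, the
graph `G_{m+1}` is obtained from `G_m` by one random step. -/
noncomputable def randomGraphHistory (V : Type*) [Finite V] :
    (m : ℕ) → PMF (Fin (m + 1) → SimpleGraph V)
  | 0 => PMF.pure fun _ => ⊥
  | m + 1 => (randomGraphHistory V m).bind fun g =>
      (randomGraphStep (g (Fin.last m))).map fun G =>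
        (Fin.snoc g G : Fin (m + 1 + 1) → SimpleGraph V)

/-- The law of the random graph process `(G_t(n))` on `n` vertices, `t = 0, …, n.choose 2`. -/
noncomputable def randomGraphProcess (n : ℕ) :
    PMF (Fin (n.choose 2 + 1) → SimpleGraph (Fin n)) :=
  randomGraphHistory (Fin n) (n.choose 2)

/-- The hitting time of the property `P` along the sequence `g`: the smallest `t` such that
`g t` has `P`, and `⊤` if there is none. -/
noncomputable def hittingTime {V : Type*} {m : ℕ} (P : SimpleGraph V → Prop)
    (g : Fin (m + 1) → SimpleGraph V) : ℕ∞ :=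
  ⨅ (t : Fin (m + 1)) (_ : P (g t)), ((t : ℕ) : ℕ∞)

/-!
Mapping each vertex to its red and to its blue component turns a NAC-colouring into two maps
`row`, `col` on the vertices, neither of them constant, such that the ends of every edge agree in
exactly one of the two. Such a pair is called a grid (`IsGrid`). A disconnected graph has one as
well, so a graph that is not in `ConnectedNoNAC` has a grid
(`exists_isGrid_of_not_connectedNoNAC`). Conversely a vertex `v` in no triangle gives a connected
graph with at least three vertices a NAC-colouring: the edges at `v` against the others, or, if
there are no others, a single edge against the rest. So `ConnectedNoNAC` implies
`EveryVertexInTriangle` (`ConnectedNoNAC.everyVertexInTriangle`), and what is left is to show that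
at the time when the triangle cover is completed the graph has no grid.

Let `G₁ ≤ G₂` be nested binomial random graphs of densities `p`, with `n² p³ = 37/20 log n`, and
`p' = n ^ (-1/2)`. With high probability some vertex of `G₁` lies in no triangle (second moment,
`labelProb_everyVertexInTriangle_le`), and every vertex of `G₂` lies in one. So the cover is
completed between them, and it suffices to exclude grids in every graph `G₁ ≤ G ≤ G₂` whose
vertices all lie in triangles. This is done by deterministic properties of the pair that hold with
high probability (`GoodPair`, `labelProb_not_goodPair_le`). As large sets are joined by edges,
some row, say, holds almost all vertices. The set `S` of the other vertices then meets every
column in a moderate set, as an edge never lies within both a row and a column, and since moderate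
sets have common neighbours `S` itself is moderate. A triangle lies in one row or one column, so
all triangles at a vertex of `S` use another vertex of `S`, and, codegrees being bounded, a vertex
of `S` with many triangles in `G₁` has many neighbours in `S`; but small sets do not induce large
minimum degree. A vertex with few triangles in `G₁` is poor, and poor vertices are so rare that no
two are adjacent in `G₂` or have a common neighbour in `G₁`. This makes `S` empty, so `row` is
constant (`GoodPair.not_isGrid`).

The random variable behind poor and uncovered vertices is the number of edges between the
neighbours of a vertex. Exposing the neighbourhoods of two vertices first leaves independent
labels, so that joint probabilities reduce to powers of `binomPairExp`, the expectation of
`y ^ (d.choose 2)` for a binomial degree `d`; at the chosen density it is `n ^ (-37/40 + o(1))`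
for `y = 1 - p`, which leaves `n ^ (3/40 + o(1))` uncovered vertices on average, while the
expected number of adjacent pairs of poor vertices still tends to zero.

Nested binomial random graphs are compared with the process as follows. Given their numbers of
edges they are a uniformly random nested pair, and so are the graphs of the process at two given
times. Hence the failure probability in the binomial model is an average over pairs of times
`s ≤ t` of that for the process, and for some `s ≤ t` the latter is no larger
(`exists_times_le_labelProb`). As the process is monotone, the cover is completed between these
two times (`GoodPair.hittingTime_eq`).
-/

universe u

/-! ### Colourings and grids -/

/-- The spanning subgraph of `G` formed by the edges of colour `b`. -/
def colourClass {V : Type*} (G : SimpleGraph V) (c : G.edgeSet → Bool) (b : Bool) :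
    SimpleGraph V where
  Adj x y := ∃ h : G.Adj x y, c ⟨s(x, y), h⟩ = b
  symm := ⟨fun x y ⟨h, hc⟩ => ⟨h.symm, by
    rw [← hc]; congr 1; exact Subtype.ext Sym2.eq_swap⟩⟩
  loopless := ⟨fun x ⟨h, _⟩ => G.loopless.irrefl x h⟩

theorem colourClass_le {V : Type*} (G : SimpleGraph V) (c : G.edgeSet → Bool) (b : Bool) :
    colourClass G c b ≤ G := fun _ _ h => h.1

/-- The cycle condition for the colour `b` says that no edge of colour `b` joins two vertices of
one component of the other colour. -/
theorem forall_isCycle_not_existsUnique_iff {V : Type*} (G : SimpleGraph V)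
    (c : G.edgeSet → Bool) (b : Bool) :
    (∀ (v : V) (w : G.Walk v v), w.IsCycle →
      ¬ ∃! e : G.edgeSet, (e : Sym2 V) ∈ w.edges ∧ c e = b) ↔
    ∀ (x y : V) (h : G.Adj x y), c ⟨s(x, y), h⟩ = b →
      ¬ (colourClass G c (!b)).Reachable x y := by
  constructor
  · intro H x y h hc hr
    obtain ⟨p, hp⟩ := hr.symm.exists_isPath
    have hcol : ∀ e ∈ p.edges, ∃ he : e ∈ G.edgeSet, c ⟨e, he⟩ = !b := by
      intro e he
      have := p.edges_subset_edgeSet he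
      induction e with
      | h x y => exact this
    have hnot : s(x, y) ∉ p.edges := by
      intro he
      obtain ⟨h1, h2⟩ := hcol _ he
      rw [hc] at h2
      cases b <;> simp at h2
    have hle := colourClass_le G c (!b)
    refine H x (SimpleGraph.Walk.cons h (p.mapLe hle)) ?_ ⟨⟨s(x, y), h⟩, ?_, ?_⟩
    · rw [SimpleGraph.Walk.cons_isCycle_iff]
      refine ⟨(SimpleGraph.Walk.isPath_mapLe hle).2 hp, ?_⟩
      simpa using hnot
    · exact ⟨by simp, hc⟩
    · rintro ⟨e, he⟩ ⟨h1, h2⟩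
      simp only [SimpleGraph.Walk.edges_cons, List.mem_cons, SimpleGraph.Walk.edges_mapLe_eq_edges]
        at h1
      rcases h1 with h1 | h1
      · exact Subtype.ext h1
      · obtain ⟨h3, h4⟩ := hcol _ h1
        rw [h2] at h4
        cases b <;> simp at h4
  · rintro H v w hw ⟨⟨e, he⟩, ⟨hew, hce⟩, huniq⟩
    induction e with
    | h x y =>
    refine H x y he hce ?_
    let K : SimpleGraph V := colourClass G c (!b) ⊔ SimpleGraph.fromEdgeSet {s(x, y)}
    have hK : ∀ e ∈ w.edges, e ∈ K.edgeSet := by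
      intro f hf
      by_cases hfe : f = s(x, y)
      · subst hfe
        simp only [K, SimpleGraph.mem_edgeSet, SimpleGraph.sup_adj]
        right
        simpa using SimpleGraph.Adj.ne he
      · have hfG := w.edges_subset_edgeSet hf
        have hcf : c ⟨f, hfG⟩ ≠ b := fun hcf =>
          hfe (congrArg Subtype.val (huniq ⟨f, hfG⟩ ⟨hf, hcf⟩))
        induction f with
        | h a d =>
        simp only [K, SimpleGraph.mem_edgeSet, SimpleGraph.sup_adj]
        left
        exact ⟨hfG, by cases b <;> simpa using hcf⟩
    have hcyc : ∃ (u : V) (p : K.Walk u u), p.IsCycle ∧ s(x, y) ∈ p.edges :=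
      ⟨v, w.transfer K hK, hw.transfer hK, by simpa using hew⟩
    rw [← SimpleGraph.adj_and_reachable_delete_edges_iff_exists_cycle] at hcyc
    refine hcyc.2.mono ?_
    intro a d had
    simp only [K, SimpleGraph.deleteEdges_adj, SimpleGraph.sup_adj,
      SimpleGraph.fromEdgeSet_adj] at had
    tauto

/-- A grid structure on `G`: the vertices are placed in a grid with at least two rows and at
least two columns so that every edge runs along a row or along a column, between different
cells. -/
def IsGrid {V α β : Type*} (G : SimpleGraph V) (row : V → α) (col : V → β) : Prop :=
  (∀ x y, G.Adj x y → Xor (row x = row y) (col x = col y)) ∧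
    (∃ x y, row x ≠ row y) ∧ ∃ x y, col x ≠ col y

theorem IsGrid.swap {V α β : Type*} {G : SimpleGraph V} {row : V → α} {col : V → β}
    (hg : IsGrid G row col) :
    IsGrid G col row :=
  ⟨fun x y h => (hg.1 x y h).symm, hg.2.2, hg.2.1⟩

/-- The edges along the rows and the edges along the columns of a grid form a NAC-colouring,
when both kinds occur. -/
theorem IsGrid.exists_isNACColouring {V α β : Type*} {G : SimpleGraph V} {row : V → α}
    {col : V → β} (hg : IsGrid G row col) (hr : ∃ x y, G.Adj x y ∧ row x = row y)
    (hc : ∃ x y, G.Adj x y ∧ col x = col y) : ∃ c : G.edgeSet → Bool, IsNACColouring G c := by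
  classical
  let f : Sym2 V → Bool := fun e => decide (∀ x ∈ e, ∀ y ∈ e, row x = row y)
  have hf : ∀ x y, f s(x, y) = true ↔ row x = row y := by
    intro x y
    simp only [f, decide_eq_true_eq, Sym2.mem_iff]
    constructor
    · intro h; exact h x (Or.inl rfl) y (Or.inr rfl)
    · rintro h a (rfl | rfl) b (rfl | rfl) <;> simp [h]
  refine ⟨fun e => f e, ?_, ?_⟩
  · rintro (_ | _)
    · obtain ⟨x, y, h, hxy⟩ := hc
      refine ⟨⟨s(x, y), h⟩, ?_⟩
      have := (hg.1 x y h)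
      rw [← Bool.not_eq_true, hf]
      rcases this with h | h
      · exact absurd hxy h.2
      · exact h.2
    · obtain ⟨x, y, h, hxy⟩ := hr
      exact ⟨⟨s(x, y), h⟩, (hf x y).2 hxy⟩
  · intro v w hw b
    refine (forall_isCycle_not_existsUnique_iff G _ b).2 ?_ v w hw
    intro x y h hcol hreach
    have hx := hg.1 x y h
    obtain ⟨p⟩ := hreach
    cases b
    · have : row x = row y := by
        clear hcol hx h hw w
        induction p with
        | nil => rfl
        | cons h p ih => exact ((hf _ _).1 h.2).trans ih
      exact absurd ((hf x y).2 this) (by simpa using hcol)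
    · have h1 : col x = col y := by
        clear hcol hx h hw w
        induction p with
        | nil => rfl
        | @cons a d _ h p ih =>
          have h2 := hg.1 _ _ h.1
          have h3 : ¬ f s(a, d) = true := by simpa using h.2
          rw [hf] at h3
          exact (h2.resolve_left (fun h4 => h3 h4.1)).1.trans ih
      have h2 := (hf x y).1 hcol
      rcases hx with h | h
      · exact h.2 h1
      · exact h.2 h2

/-- A vertex in no triangle is separated by a NAC-colouring: the edges at that vertex get one
colour, all others the other one. -/
theorem exists_isNACColouring_of_not_triangle {V : Type*} {G : SimpleGraph V} {v u x y : V}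
    (hv : ∀ a b, G.Adj v a → G.Adj v b → ¬ G.Adj a b) (hu : G.Adj v u) (hxy : G.Adj x y)
    (hx : x ≠ v) (hy : y ≠ v) : ∃ c : G.edgeSet → Bool, IsNACColouring G c := by
  classical
  have hadj : ∀ a b, G.Adj a b → a ≠ v → b ≠ v → ¬ (G.Adj v a ∧ G.Adj v b) :=
    fun a b hab _ _ h => hv a b h.1 h.2 hab
  let row : V → Prop := fun a => a = v
  let col : V → V := fun a => if G.Adj v a then v else a
  have hcv : col v = v := by simp [col]
  have key : ∀ a b, G.Adj a b → Xor (row a = row b) (col a = col b) := by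
    intro a b hab
    have hne := hab.ne
    by_cases ha : a = v
    · subst ha
      right
      refine ⟨?_, ?_⟩
      · rw [hcv]; simp [col, hab]
      · simp only [row, eq_iff_iff, true_iff]; exact hne.symm
    · by_cases hb : b = v
      · subst hb
        right
        refine ⟨?_, ?_⟩
        · rw [hcv]; simp [col, hab.symm]
        · simp only [row, eq_iff_iff, iff_true]; exact hne
      · left
        refine ⟨by simp [row, ha, hb], ?_⟩
        have := hadj a b hab ha hb
        simp only [col]
        split_ifs with h1 h2 h2
        · exact absurd ⟨h1, h2⟩ this
        · exact fun h => hb h.symm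
        · exact ha
        · exact hne
  have hcuv : col u = v := by simp [col, hu]
  have hx1 : col x ≠ col y := by
    rcases key x y hxy with h | h
    · exact h.2
    · exact absurd (by simp [row, hx, hy]) h.2
  refine IsGrid.exists_isNACColouring (row := row) (col := col)
    ⟨key, ⟨v, u, ?_⟩, x, y, hx1⟩ ⟨x, y, hxy, by simp [row, hx, hy]⟩ ⟨v, u, hu, by rw [hcv, hcuv]⟩
  have := hu.ne
  simp only [row, ne_eq, eq_iff_iff, true_iff]
  exact fun h => this h.symm

theorem ConnectedNoNAC.everyVertexInTriangle {V : Type*} [Fintype V] {G : SimpleGraph V}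
    (hV : 3 ≤ Fintype.card V) (hG : ConnectedNoNAC G) : EveryVertexInTriangle G := by
  classical
  obtain ⟨hconn, hnac⟩ := hG
  by_contra hcon
  have hnt : Nontrivial V := Fintype.one_lt_card_iff_nontrivial.1 (by omega)
  have hdeg : ∀ x : V, ∃ y, G.Adj x y := fun x => hconn.preconnected.exists_adj_of_nontrivial x
  simp only [EveryVertexInTriangle, not_forall, not_exists, not_and] at hcon
  obtain ⟨v, hv⟩ := hcon
  obtain ⟨u, hu⟩ := hdeg v
  by_cases hstar : ∃ x y, G.Adj x y ∧ x ≠ v ∧ y ≠ v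
  · obtain ⟨x, y, hxy, hx, hy⟩ := hstar
    exact hnac (exists_isNACColouring_of_not_triangle (fun a b h1 h2 => hv a b h1 h2) hu hxy hx hy)
  · -- `G` is a star with centre `v`; the leaf `u` takes the role of `v`.
    push Not at hstar
    obtain ⟨x, hx⟩ : ∃ x, x ∉ ({u, v} : Finset V) := by
      by_contra! h
      have : (Finset.univ : Finset V) ⊆ {u, v} := fun x _ => h x
      have := Finset.card_le_card this
      have h2 : ({u, v} : Finset V).card ≤ 2 := Finset.card_le_two
      rw [Finset.card_univ] at this
      omega
    simp only [Finset.mem_insert, Finset.mem_singleton, not_or] at hx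
    obtain ⟨y, hy⟩ := hdeg x
    have hyv : y = v := hstar x y hy hx.2
    subst hyv
    refine hnac (exists_isNACColouring_of_not_triangle (v := u) (u := y) (x := x) (y := y)
      ?_ hu.symm hy hx.1 hu.ne)
    intro a b h1 h2 h3
    have ha := hstar u a h1 hu.ne'
    have hb := hstar u b h2 hu.ne'
    exact h3.ne (ha.trans hb.symm)

/-- For a NAC-colouring, `row` and `col` map a vertex to its red and its blue component. -/
theorem exists_isGrid_of_not_connectedNoNAC {V : Type u} [Nontrivial V] {G : SimpleGraph V}
    (h : ¬ ConnectedNoNAC G) :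
    ∃ (α β : Type u) (row : V → α) (col : V → β), IsGrid G row col := by
  by_cases hconn : G.Connected
  · have hnac : ∃ c : G.edgeSet → Bool, IsNACColouring G c := by
      by_contra hc; exact h ⟨hconn, hc⟩
    obtain ⟨c, hs, hc⟩ := hnac
    have key := fun b => (forall_isCycle_not_existsUnique_iff G c b).1
      (fun v w hw => hc v w hw b)
    refine ⟨_, _, (colourClass G c true).connectedComponentMk,
      (colourClass G c false).connectedComponentMk, ?_, ?_, ?_⟩
    · intro x y hxy
      simp only [SimpleGraph.ConnectedComponent.eq]
      cases hcol : c ⟨s(x, y), hxy⟩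
      · right
        exact ⟨SimpleGraph.Adj.reachable ⟨hxy, hcol⟩, key false x y hxy hcol⟩
      · left
        exact ⟨SimpleGraph.Adj.reachable ⟨hxy, hcol⟩, key true x y hxy hcol⟩
    · obtain ⟨⟨e, he⟩, hce⟩ := hs false
      induction e with
      | h x y =>
      refine ⟨x, y, ?_⟩
      rw [Ne, SimpleGraph.ConnectedComponent.eq]
      exact key false x y he hce
    · obtain ⟨⟨e, he⟩, hce⟩ := hs true
      induction e with
      | h x y =>
      refine ⟨x, y, ?_⟩
      rw [Ne, SimpleGraph.ConnectedComponent.eq]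
      exact key true x y he hce
  · -- Without connectedness the components, with `col` injective, already form a grid.
    have hpre : ¬ G.Preconnected := fun hp => hconn ⟨hp⟩
    simp only [SimpleGraph.Preconnected, not_forall] at hpre
    obtain ⟨x, y, hxy⟩ := hpre
    obtain ⟨a, b, hab⟩ := exists_pair_ne V
    refine ⟨_, _, G.connectedComponentMk, id, ?_, ⟨x, y, ?_⟩, a, b, hab⟩
    · intro a b hab
      left
      exact ⟨SimpleGraph.ConnectedComponent.eq.2 hab.reachable, hab.ne⟩
    · rwa [Ne, SimpleGraph.ConnectedComponent.eq]

/-! ### Grids in graphs with good expansion -/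

section
open scoped Classical

/-- Either one fibre of `f` contains almost all of `S`, or a union of fibres splits `S` into two
parts that are both large. -/
theorem exists_fibre_or_balanced_split {V κ : Type*} (f : V → κ) (S : Finset V) (t : ℕ)
    (ht : 3 * t ≤ S.card) :
    (∃ k, (S.filter fun v => f v ≠ k).card < t) ∨
      ∃ A : Set κ, t ≤ (S.filter fun v => f v ∈ A).card ∧
        t ≤ (S.filter fun v => f v ∉ A).card := by
  by_contra! hcon
  obtain ⟨h1, h2⟩ := hcon
  have hsum : ∀ A : Set κ, (S.filter fun v => f v ∈ A).card + (S.filter fun v => f v ∉ A).card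
      = S.card := fun A => Finset.card_filter_add_card_filter_not _
  let F : Finset (Finset κ) := (S.image f).powerset.filter fun A =>
    t ≤ (S.filter fun v => f v ∈ A).card
  have hF : F.Nonempty := by
    refine ⟨S.image f, ?_⟩
    simp only [F, Finset.mem_filter, Finset.mem_powerset, subset_refl, true_and]
    rw [Finset.filter_true_of_mem]
    · omega
    · exact fun v hv => Finset.mem_image_of_mem f hv
  obtain ⟨A, hA, hmin⟩ := Finset.exists_min_image F Finset.card hF
  simp only [F, Finset.mem_filter, Finset.mem_powerset] at hA hmin
  have hcA := h2 A (by simpa using hA.2)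
  have hsA := hsum A
  simp only [Finset.mem_coe] at hcA hsA
  have hAne : A.Nonempty := by
    rw [Finset.nonempty_iff_ne_empty]
    rintro rfl
    have := hA.2
    simp only [Finset.notMem_empty, not_false_eq_true, Finset.filter_true] at this hcA
    simp only [Finset.filter_false, Finset.card_empty] at this
    omega
  obtain ⟨k, hk⟩ := hAne
  have hlt : (S.filter fun v => f v ∈ A.erase k).card < t := by
    by_contra! hge
    have h3 := hmin (A.erase k) ⟨(Finset.erase_subset _ _).trans hA.1, hge⟩
    have := Finset.card_erase_lt_of_mem hk
    omega
  have hsub : (S.filter fun v => f v ∈ A) ⊆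
      (S.filter fun v => f v ∈ A.erase k) ∪ S.filter fun v => f v = k := by
    intro v hv
    simp only [Finset.mem_union, Finset.mem_filter, Finset.mem_erase] at hv ⊢
    tauto
  have hle := (Finset.card_le_card hsub).trans (Finset.card_union_le _ _)
  have h4 := h2 {k} (by simp only [Set.mem_singleton_iff]; omega)
  have h5 := h1 k
  simp only [Set.mem_singleton_iff] at h4
  simp only [ne_eq] at h5
  omega

/-- The number of triangles of `G` at `v`, counted as the edges of `G` between neighbours
of `v`. -/
noncomputable def trianglesAt {V : Type*} [Fintype V] (G : SimpleGraph V) (v : V) : ℕ :=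
  (Finset.univ.filter fun e : Sym2 V => e ∈ G.edgeSet ∧ ∀ x ∈ e, G.Adj v x).card

/-- The neighbours of `v` in `S`. -/
noncomputable def neighborsIn {V : Type*} (G : SimpleGraph V) (S : Finset V) (v : V) : Finset V :=
  S.filter fun x => G.Adj v x

theorem mem_neighborsIn {V : Type*} {G : SimpleGraph V} {S : Finset V} {v x : V} :
    x ∈ neighborsIn G S v ↔ x ∈ S ∧ G.Adj v x := by simp [neighborsIn]

/-- If the vertices of `S` meet all edges between neighbours of `v`, then few triangles at `v` or
many neighbours in `S`, since each neighbour `y` lies in at most `c` triangles with `v`. -/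
theorem trianglesAt_le_mul_of_cover {V : Type*} [Fintype V] {G : SimpleGraph V} {v : V}
    {S : Finset V} {c : ℕ}
    (hS : ∀ x y, G.Adj v x → G.Adj v y → G.Adj x y → x ∈ S ∨ y ∈ S)
    (hc : ∀ y, y ≠ v → (Finset.univ.filter fun x => G.Adj v x ∧ G.Adj y x).card ≤ c) :
    trianglesAt G v ≤ (neighborsIn G S v).card * c := by
  unfold trianglesAt
  have hsub : (Finset.univ.filter fun e : Sym2 V => e ∈ G.edgeSet ∧ ∀ x ∈ e, G.Adj v x) ⊆
      (neighborsIn G S v).biUnion fun y =>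
        (Finset.univ.filter fun x => G.Adj v x ∧ G.Adj y x).image fun x => s(y, x) := by
    intro e he
    induction e with
    | h x y =>
    simp only [Finset.mem_filter, Finset.mem_univ, true_and, SimpleGraph.mem_edgeSet,
      Sym2.mem_iff, forall_eq_or_imp, forall_eq] at he
    simp only [Finset.mem_biUnion, mem_neighborsIn, Finset.mem_image, Finset.mem_filter,
      Finset.mem_univ, true_and]
    obtain ⟨hxy, hx, hy⟩ := he
    rcases hS x y hx hy hxy with h | h
    · exact ⟨x, ⟨h, hx⟩, y, ⟨hy, hxy⟩, rfl⟩
    · exact ⟨y, ⟨h, hy⟩, x, ⟨hx, hxy.symm⟩, Sym2.eq_swap⟩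
  refine (Finset.card_le_card hsub).trans (Finset.card_biUnion_le_card_mul _ _ _ ?_)
  intro y hy
  exact Finset.card_image_le.trans (hc y (mem_neighborsIn.1 hy).2.ne')

/-- The expansion properties of the pair `G₁ ≤ G₂` of random graphs that exclude grids in every
graph between them whose vertices all lie in triangles. A vertex with at most `c * D` triangles
in `G₁` is called poor. -/
structure GoodPair {V : Type*} [Fintype V] (G₁ G₂ : SimpleGraph V) (s u c D : ℕ) : Prop where
  /-- Large sets are joined by an edge. -/
  joined : ∀ X Y : Finset V, s ≤ X.card → s ≤ Y.card → Disjoint X Y →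
    ∃ x ∈ X, ∃ y ∈ Y, G₁.Adj x y
  /-- Moderate sets are joined to all sets of almost all vertices. -/
  expands : ∀ X Y : Finset V, u ≤ X.card → Fintype.card V ≤ Y.card + 4 * s → Disjoint X Y →
    ∃ x ∈ X, ∃ y ∈ Y, G₁.Adj x y
  /-- Two disjoint moderate subsets of a small set have a common neighbour outside it. -/
  common : ∀ X Y Z : Finset V, u ≤ X.card → u ≤ Y.card → Disjoint X Y → X ⊆ Z → Y ⊆ Z →
    Z.card ≤ 2 * s → ∃ z ∉ Z, (∃ x ∈ X, G₁.Adj z x) ∧ ∃ y ∈ Y, G₁.Adj z y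
  /-- Small sets do not induce large minimum degree. -/
  sparse : ∀ H : Finset V, H.Nonempty → H.card < 3 * u → ∃ v ∈ H, (neighborsIn G₁ H v).card < D
  /-- Poor vertices have no common neighbours. -/
  poor_common : ∀ v w x : V, v ≠ w → trianglesAt G₁ v ≤ c * D → trianglesAt G₁ w ≤ c * D →
    ¬ (G₁.Adj v x ∧ G₁.Adj w x)
  /-- Poor vertices are not adjacent, even in the larger graph. -/
  poor_adj : ∀ v w : V, trianglesAt G₁ v ≤ c * D → trianglesAt G₁ w ≤ c * D → ¬ G₂.Adj v w
  /-- Codegrees are bounded. -/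
  codegree : ∀ v y : V, y ≠ v → (Finset.univ.filter fun x => G₁.Adj v x ∧ G₁.Adj y x).card ≤ c

variable {V : Type*} [Fintype V] {G₁ G G₂ : SimpleGraph V} {s u c D : ℕ}

/-- One row or one column contains all but fewer than `2 * s` vertices. -/
theorem GoodPair.exists_giant_line {α β : Type*} {row : V → α} {col : V → β}
    (hgood : GoodPair G₁ G₂ s u c D) (h1 : G₁ ≤ G)
    (hs : 6 * s ≤ Fintype.card V) (hg : IsGrid G row col) :
    (∃ k, (Finset.univ.filter fun v => row v ≠ k).card < 2 * s) ∨
      ∃ k, (Finset.univ.filter fun v => col v ≠ k).card < 2 * s := by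
  have hcard : 3 * (2 * s) ≤ (Finset.univ : Finset V).card := by rw [Finset.card_univ]; omega
  rcases exists_fibre_or_balanced_split row Finset.univ (2 * s) hcard with h | ⟨A, hA, hA'⟩
  · exact Or.inl h
  rcases exists_fibre_or_balanced_split col Finset.univ (2 * s) hcard with h | ⟨C, hC, hC'⟩
  · exact Or.inr h
  exfalso
  -- No edge joins opposite quadrants, so of each opposite pair one quadrant is small.
  have hno : ∀ (P Q P' Q' : V → Prop) [DecidablePred P] [DecidablePred Q] [DecidablePred P']
      [DecidablePred Q'], (∀ x y, P x → P' y → row x ≠ row y) →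
      (∀ x y, Q x → Q' y → col x ≠ col y) →
      (Finset.univ.filter fun v => P v ∧ Q v).card < s ∨
        (Finset.univ.filter fun v => P' v ∧ Q' v).card < s := by
    intro P Q P' Q' _ _ _ _ hP hQ
    by_contra! hcon
    obtain ⟨x, hx, y, hy, hxy⟩ := hgood.joined _ _ hcon.1 hcon.2 (by
      rw [Finset.disjoint_left]
      intro x hx hx'
      simp only [Finset.mem_filter, Finset.mem_univ, true_and] at hx hx'
      exact hP x x hx.1 hx'.1 rfl)
    simp only [Finset.mem_filter, Finset.mem_univ, true_and] at hx hy
    rcases hg.1 x y (h1 hxy) with h | h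
    · exact hP x y hx.1 hy.1 h.1
    · exact hQ x y hx.2 hy.2 h.1
  have hsplit : ∀ (P Q : V → Prop) [DecidablePred P] [DecidablePred Q],
      (Finset.univ.filter fun v => P v).card ≤
      (Finset.univ.filter fun v => P v ∧ Q v).card +
        (Finset.univ.filter fun v => P v ∧ ¬ Q v).card := by
    intro P Q _ _
    rw [← Finset.filter_filter, ← Finset.filter_filter,
      Finset.card_filter_add_card_filter_not]
  have hsplit' : ∀ (P Q : V → Prop) [DecidablePred P] [DecidablePred Q],
      (Finset.univ.filter fun v => Q v).card ≤
      (Finset.univ.filter fun v => P v ∧ Q v).card +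
        (Finset.univ.filter fun v => ¬ P v ∧ Q v).card := by
    intro P Q _ _
    have := hsplit Q P
    simpa only [and_comm] using this
  have d1 := hno (fun v => row v ∈ A) (fun v => col v ∈ C) (fun v => row v ∉ A)
    (fun v => col v ∉ C) (fun x y hx hy h => hy (h ▸ hx)) (fun x y hx hy h => hy (h ▸ hx))
  have d2 := hno (fun v => row v ∈ A) (fun v => col v ∉ C) (fun v => row v ∉ A)
    (fun v => col v ∈ C) (fun x y hx hy h => hy (h ▸ hx)) (fun x y hx hy h => hx (h ▸ hy))
  have e1 := hsplit (fun v => row v ∈ A) (fun v => col v ∈ C)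
  have e2 := hsplit (fun v => row v ∉ A) (fun v => col v ∈ C)
  have e3 := hsplit' (fun v => row v ∈ A) (fun v => col v ∈ C)
  have e4 := hsplit' (fun v => row v ∈ A) (fun v => col v ∉ C)
  omega

/-- The set `S` outside a giant row is small: each column meets it in few vertices, since the
part of the column in the giant row is independent and contains all neighbours in that row; and
two large unions of such parts would have a common neighbour in the giant row. -/
theorem GoodPair.card_compl_giant_row_lt {α β : Type*} {row : V → α} {col : V → β}
    (hgood : GoodPair G₁ G₂ s u c D) (h1 : G₁ ≤ G) (hg : IsGrid G row col) {k : α}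
    (hk : (Finset.univ.filter fun v => row v ≠ k).card < 2 * s) :
    (Finset.univ.filter fun v => row v ≠ k).card < 3 * u := by
  set S : Finset V := Finset.univ.filter fun v => row v ≠ k with hS
  have hmemS : ∀ v, v ∈ S ↔ row v ≠ k := fun v => by simp [hS]
  have hcross : ∀ x y, G₁.Adj x y → x ∈ S → y ∉ S → col x = col y := by
    intro x y hxy hx hy
    rw [hmemS] at hx hy
    push Not at hy
    rcases hg.1 x y (h1 hxy) with h | h
    · exact absurd (h.1.trans hy) hx
    · exact h.1
  have hsmall : ∀ b, (S.filter fun v => col v = b).card < u := by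
    intro b
    by_contra! hb
    have hind : (Finset.univ.filter fun v => row v = k ∧ col v = b).card < 2 * s := by
      by_contra! hge
      obtain ⟨X, hX, hXc⟩ := Finset.exists_subset_card_eq
        (show s ≤ (Finset.univ.filter fun v => row v = k ∧ col v = b).card by omega)
      obtain ⟨x, hx, y, hy, hxy⟩ := hgood.joined X
        ((Finset.univ.filter fun v => row v = k ∧ col v = b) \ X) hXc.ge
        (by rw [Finset.card_sdiff_of_subset hX]; omega) Finset.disjoint_sdiff
      have hx' := hX hx
      have hy' := (Finset.mem_sdiff.1 hy).1
      simp only [Finset.mem_filter, Finset.mem_univ, true_and] at hx' hy'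
      rcases hg.1 x y (h1 hxy) with h | h
      · exact h.2 (hx'.2.trans hy'.2.symm)
      · exact h.2 (hx'.1.trans hy'.1.symm)
    obtain ⟨x, hx, y, hy, hxy⟩ := hgood.expands (S.filter fun v => col v = b)
      (Finset.univ.filter fun v => row v = k ∧ col v ≠ b) hb (by
        have h3 : (Finset.univ : Finset V) ⊆ S ∪ ((Finset.univ.filter fun v => row v = k ∧
          col v = b) ∪ Finset.univ.filter fun v => row v = k ∧ col v ≠ b) := by
          intro v _
          simp only [Finset.mem_union, hmemS, Finset.mem_filter, Finset.mem_univ, true_and]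
          tauto
        have h4 := Finset.card_le_card h3
        have h5 := Finset.card_union_le S ((Finset.univ.filter fun v => row v = k ∧
          col v = b) ∪ Finset.univ.filter fun v => row v = k ∧ col v ≠ b)
        have h6 := Finset.card_union_le (Finset.univ.filter fun v => row v = k ∧
          col v = b) (Finset.univ.filter fun v => row v = k ∧ col v ≠ b)
        rw [Finset.card_univ] at h4
        omega) (by
        rw [Finset.disjoint_left]
        intro v hv hv'
        simp only [Finset.mem_filter, Finset.mem_univ, true_and] at hv hv'
        exact hv'.2 hv.2)
    simp only [Finset.mem_filter, Finset.mem_univ, true_and] at hx hy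
    have := hcross x y hxy hx.1 (by rw [hmemS]; simpa using hy.1)
    exact hy.2 (this.symm.trans hx.2)
  by_contra! hge
  rcases exists_fibre_or_balanced_split col S u hge with ⟨b, hb⟩ | ⟨C, hC, hC'⟩
  · have h2 := hsmall b
    have h3 := Finset.card_filter_add_card_filter_not (s := S) (fun v => col v = b)
    simp only [ne_eq] at hb
    omega
  · obtain ⟨z, hz, ⟨x, hx, hzx⟩, y, hy, hzy⟩ := hgood.common _ _ S hC hC' (by
      rw [Finset.disjoint_left]
      intro v hv hv'
      exact (Finset.mem_filter.1 hv').2 (Finset.mem_filter.1 hv).2)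
      (Finset.filter_subset _ _) (Finset.filter_subset _ _) hk.le
    rw [Finset.mem_filter] at hx hy
    have e1 := hcross x z hzx.symm hx.1 hz
    have e2 := hcross y z hzy.symm hy.1 hz
    exact hy.2 (by rw [e2, ← e1]; exact hx.2)

/-- A giant row is everything. Otherwise its complement `S` is small and no triangle has exactly
one vertex in `S`. The vertices of `S` that are not poor then have many neighbours in `S`, almost
all of which are not poor, contrary to sparsity. -/
theorem GoodPair.row_eq_of_giant_row {α β : Type*} {row : V → α} {col : V → β}
    (hgood : GoodPair G₁ G₂ s u c D) (h1 : G₁ ≤ G) (h2 : G ≤ G₂)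
    (hcov : EveryVertexInTriangle G) (hg : IsGrid G row col) {k : α}
    (hk : (Finset.univ.filter fun v => row v ≠ k).card < 2 * s) (v : V) : row v = k := by
  have hlt := hgood.card_compl_giant_row_lt h1 hg hk
  set S : Finset V := Finset.univ.filter fun v => row v ≠ k with hS
  have hmemS : ∀ v, v ∈ S ↔ row v ≠ k := fun v => by simp [hS]
  have htri : ∀ v x y, v ∈ S → G.Adj v x → G.Adj v y → G.Adj x y → x ∈ S ∨ y ∈ S := by
    intro v x y hv hvx hvy hxy
    by_contra! hcon
    rw [hmemS] at hv
    simp only [hmemS, not_not] at hcon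
    have e1 := (hg.1 v x hvx).resolve_left (fun h => hv (h.1.trans hcon.1))
    have e2 := (hg.1 v y hvy).resolve_left (fun h => hv (h.1.trans hcon.2))
    rcases hg.1 x y hxy with h | h
    · exact h.2 (e1.1.symm.trans e2.1)
    · exact h.2 (hcon.1.trans hcon.2.symm)
  set H : Finset V := S.filter fun v => c * D < trianglesAt G₁ v with hH
  have hHS : ∀ v ∈ S, v ∉ H → trianglesAt G₁ v ≤ c * D := by
    intro v hv hvH
    rw [hH, Finset.mem_filter] at hvH
    by_contra! hcon
    exact hvH ⟨hv, hcon⟩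
  have hdeg : ∀ v ∈ H, D ≤ (neighborsIn G₁ H v).card := by
    intro v hv
    have hv' := Finset.mem_filter.1 hv
    have hle := trianglesAt_le_mul_of_cover (G := G₁) (v := v) (S := S) (c := c)
      (fun x y hx hy hxy => htri v x y hv'.1 (h1 hx) (h1 hy) (h1 hxy)) (hgood.codegree v)
    have hlt2 : D < (neighborsIn G₁ S v).card := by
      by_contra! hcon
      have := Nat.mul_le_mul_right c hcon
      rw [Nat.mul_comm D c] at this
      omega
    have hsub : neighborsIn G₁ S v ⊆ neighborsIn G₁ H v ∪ neighborsIn G₁ (S \ H) v := by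
      intro x hx
      simp only [Finset.mem_union, mem_neighborsIn, Finset.mem_sdiff] at hx ⊢
      tauto
    have h3 := (Finset.card_le_card hsub).trans (Finset.card_union_le _ _)
    -- The vertices of `S \ H` are poor, so `v` is adjacent to at most one of them.
    have h4 : (neighborsIn G₁ (S \ H) v).card ≤ 1 := by
      rw [Finset.card_le_one]
      intro a ha b hb
      simp only [mem_neighborsIn, Finset.mem_sdiff] at ha hb
      by_contra hne
      exact hgood.poor_common a b v hne (hHS a ha.1.1 ha.1.2) (hHS b hb.1.1 hb.1.2)
        ⟨ha.2.symm, hb.2.symm⟩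
    omega
  by_contra hv
  have hvS : v ∈ S := (hmemS v).2 hv
  have hHne : H.Nonempty := by
    by_cases hvH : v ∈ H
    · exact ⟨v, hvH⟩
    · obtain ⟨x, y, hx, hy, hxy⟩ := hcov v
      have key : ∀ x, G.Adj v x → x ∈ S → x ∈ H := by
        intro x hx hxS
        by_contra hxH
        exact hgood.poor_adj v x (hHS v hvS hvH) (hHS x hxS hxH) (h2 hx)
      rcases htri v x y hvS hx hy hxy with h | h
      · exact ⟨x, key x hx h⟩
      · exact ⟨y, key y hy h⟩
  obtain ⟨w, hw, hwD⟩ := hgood.sparse H hHne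
    ((Finset.card_le_card (Finset.filter_subset _ _)).trans_lt hlt)
  exact absurd (hdeg w hw) (by omega)

/-- A giant row or column would be everything, and then `row` or `col` would be constant. -/
theorem GoodPair.not_isGrid {α β : Type*} {row : V → α} {col : V → β}
    (hgood : GoodPair G₁ G₂ s u c D) (h1 : G₁ ≤ G) (h2 : G ≤ G₂)
    (hs : 6 * s ≤ Fintype.card V) (hcov : EveryVertexInTriangle G) :
    ¬ IsGrid G row col := by
  intro hg
  rcases hgood.exists_giant_line h1 hs hg with ⟨k, hk⟩ | ⟨k, hk⟩
  · have h := hgood.row_eq_of_giant_row h1 h2 hcov hg hk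
    obtain ⟨x, y, hxy⟩ := hg.2.1
    exact hxy ((h x).trans (h y).symm)
  · have h := hgood.row_eq_of_giant_row h1 h2 hcov hg.swap hk
    obtain ⟨x, y, hxy⟩ := hg.2.2
    exact hxy ((h x).trans (h y).symm)

theorem GoodPair.connectedNoNAC [Nontrivial V] (hgood : GoodPair G₁ G₂ s u c D) (h1 : G₁ ≤ G)
    (h2 : G ≤ G₂) (hs : 6 * s ≤ Fintype.card V) (hcov : EveryVertexInTriangle G) :
    ConnectedNoNAC G := by
  by_contra hcon
  obtain ⟨_, _, _, _, hg⟩ := exists_isGrid_of_not_connectedNoNAC hcon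
  exact hgood.not_isGrid h1 h2 hs hcov hg

end

/-! ### The law of two graphs of the process -/

section
open scoped Classical

variable {V : Type*} [Fintype V]

theorem ncard_edgeSet_compl (G : SimpleGraph V) :
    G.edgeSet.ncard + Gᶜ.edgeSet.ncard = (Fintype.card V).choose 2 := by
  rw [← Set.ncard_union_eq, ← SimpleGraph.edgeSet_sup, sup_compl_eq_top,
    Set.ncard_eq_toFinset_card']
  · exact SimpleGraph.card_edgeFinset_top_eq_card_choose_two
  · rw [SimpleGraph.disjoint_edgeSet]; exact disjoint_compl_right

theorem edgeSet_sup_fromEdgeSet {V : Type*} {G : SimpleGraph V} {e : Sym2 V} (he : e ∈ Gᶜ.edgeSet) :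
    (G ⊔ SimpleGraph.fromEdgeSet {e}).edgeSet = insert e G.edgeSet := by
  have hd : ¬ e.IsDiag := Gᶜ.not_isDiag_of_mem_edgeSet he
  rw [SimpleGraph.edgeSet_sup, SimpleGraph.edgeSet_fromEdgeSet, Set.insert_eq, Set.union_comm]
  congr 1
  ext f
  simp only [Set.mem_sdiff, Set.mem_singleton_iff]
  constructor
  · exact fun h => h.1
  · rintro rfl; exact ⟨rfl, hd⟩

theorem notMem_edgeSet_of_mem_compl {V : Type*} {G : SimpleGraph V} {e : Sym2 V}
    (he : e ∈ Gᶜ.edgeSet) : e ∉ G.edgeSet := by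
  have : Disjoint G.edgeSet Gᶜ.edgeSet := by
    rw [SimpleGraph.disjoint_edgeSet]; exact disjoint_compl_right
  exact fun h => Set.disjoint_left.1 this h he

/-- One step adds one edge, and all graphs with one edge more are equally likely. -/
theorem randomGraphStep_apply (G H : SimpleGraph V)
    (hG : G.edgeSet.ncard < (Fintype.card V).choose 2) :
    randomGraphStep G H = if G ≤ H ∧ H.edgeSet.ncard = G.edgeSet.ncard + 1 then
      (((Fintype.card V).choose 2 - G.edgeSet.ncard : ℕ) : ENNReal)⁻¹ else 0 := by
  have hc := ncard_edgeSet_compl G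
  have hcard : (Set.toFinite Gᶜ.edgeSet).toFinset.card =
      (Fintype.card V).choose 2 - G.edgeSet.ncard := by
    rw [← Set.ncard_eq_toFinset_card]; omega
  have hne : (Set.toFinite Gᶜ.edgeSet).toFinset.Nonempty := by
    rw [← Finset.card_pos]; omega
  rw [randomGraphStep, dif_pos hne, PMF.map_apply, tsum_fintype]
  simp only [PMF.uniformOfFinset_apply, hcard, Set.Finite.mem_toFinset]
  split_ifs with h
  · have hd : (H.edgeSet \ G.edgeSet).ncard = 1 := by
      have := Set.ncard_sdiff_add_ncard_of_subset (SimpleGraph.edgeSet_mono h.1)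
      omega
    obtain ⟨e, he⟩ := Set.ncard_eq_one.1 hd
    have he1 : e ∈ H.edgeSet ∧ e ∉ G.edgeSet := by
      rw [← Set.mem_sdiff, he]; rfl
    have hec : e ∈ Gᶜ.edgeSet := by
      have : e ∈ (G ⊔ Gᶜ).edgeSet := by
        rw [sup_compl_eq_top]
        exact SimpleGraph.edgeSet_mono le_top he1.1
      rw [SimpleGraph.edgeSet_sup] at this
      exact this.resolve_left he1.2
    rw [Finset.sum_eq_single e]
    · rw [if_pos, if_pos hec]
      rw [← SimpleGraph.edgeSet_inj, edgeSet_sup_fromEdgeSet hec, Set.insert_eq, ← he,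
        Set.sdiff_union_of_subset (SimpleGraph.edgeSet_mono h.1)]
    · intro f _ hf
      split_ifs with h1 h2
      · exfalso
        apply hf
        have : f ∈ H.edgeSet \ G.edgeSet := by
          refine ⟨?_, notMem_edgeSet_of_mem_compl h2⟩
          rw [h1, edgeSet_sup_fromEdgeSet h2]
          exact Set.mem_insert _ _
        rw [he] at this
        exact this
      · rfl
      · rfl
    · simp
  · refine Finset.sum_eq_zero fun f _ => ?_
    split_ifs with h1 h2
    · exfalso
      apply h
      rw [h1]
      refine ⟨le_sup_left, ?_⟩
      rw [edgeSet_sup_fromEdgeSet h2, Set.ncard_insert_of_notMem (notMem_edgeSet_of_mem_compl h2)]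
    · rfl
    · rfl

theorem le_of_mem_support_randomGraphStep {G H : SimpleGraph V}
    (h : H ∈ (randomGraphStep G).support) : G ≤ H := by
  rw [randomGraphStep] at h
  split_ifs at h with hne
  · rw [PMF.support_map] at h
    obtain ⟨e, _, rfl⟩ := h
    exact le_sup_left
  · rw [PMF.support_pure] at h
    exact (Set.mem_singleton_iff.1 h).ge

theorem monotone_of_mem_support_randomGraphHistory (m : ℕ) (g : Fin (m + 1) → SimpleGraph V)
    (hg : g ∈ (randomGraphHistory V m).support) : Monotone g := by
  induction m with
  | zero =>
    intro i j _
    rw [Fin.eq_zero i, Fin.eq_zero j]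
  | succ m ih =>
    rw [randomGraphHistory, PMF.mem_support_bind_iff] at hg
    obtain ⟨g', hg', hg⟩ := hg
    rw [PMF.support_map] at hg
    obtain ⟨G, hG, rfl⟩ := hg
    have hmono := ih g' hg'
    have hle := le_of_mem_support_randomGraphStep hG
    intro i j hij
    induction j using Fin.lastCases with
    | last =>
      induction i using Fin.lastCases with
      | last => exact le_rfl
      | cast i =>
        simp only [Fin.snoc_castSucc, Fin.snoc_last]
        exact (hmono (Fin.le_last i)).trans hle
    | cast j =>
      induction i using Fin.lastCases with
      | last => exact absurd hij (by simp)
      | cast i =>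
        simp only [Fin.snoc_castSucc]
        exact hmono (by simpa using hij)

theorem randomGraphHistory_succ_map_castSucc (m : ℕ) :
    (randomGraphHistory V (m + 1)).map (fun g (i : Fin (m + 1)) => g i.castSucc) =
      randomGraphHistory V m := by
  rw [randomGraphHistory, PMF.map_bind]
  simp only [PMF.map_comp]
  have : ∀ g : Fin (m + 1) → SimpleGraph V,
      (PMF.map ((fun g (i : Fin (m + 1)) => g i.castSucc) ∘
        fun G => (Fin.snoc g G : Fin (m + 1 + 1) → SimpleGraph V))
        (randomGraphStep (g (Fin.last m)))) = PMF.pure g := by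
    intro g
    have : ((fun g (i : Fin (m + 1)) => g i.castSucc) ∘
        fun G => (Fin.snoc g G : Fin (m + 1 + 1) → SimpleGraph V)) = Function.const _ g := by
      funext G i
      simp
    rw [this, PMF.map_const]
  simp only [this, PMF.bind_pure]

theorem randomGraphHistory_map_castLE {m k : ℕ} (h : m ≤ k) :
    (randomGraphHistory V k).map
      (fun g (i : Fin (m + 1)) => g (Fin.castLE (Nat.succ_le_succ h) i)) =
      randomGraphHistory V m := by
  induction k, h using Nat.le_induction with
  | base => exact PMF.map_id _
  | succ k hk ih =>
    rw [← ih, ← randomGraphHistory_succ_map_castSucc k, PMF.map_comp]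
    rfl

/-- The number of graphs with one edge less than `B` that contain `A`. -/
theorem card_between (A B : SimpleGraph V) (m : ℕ) (hB : B.edgeSet.ncard = m + 1) (hAB : A ≤ B) :
    (Finset.univ.filter fun C : SimpleGraph V => A ≤ C ∧ C ≤ B ∧ C.edgeSet.ncard = m).card =
      m + 1 - A.edgeSet.ncard := by
  have h1 : (B.edgeSet \ A.edgeSet).ncard = m + 1 - A.edgeSet.ncard := by
    have := Set.ncard_sdiff_add_ncard_of_subset (SimpleGraph.edgeSet_mono hAB)
    omega
  rw [← h1, Set.ncard_eq_toFinset_card']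
  symm
  refine Finset.card_bij (fun e _ => B.deleteEdges {e}) ?_ ?_ ?_
  · intro e he
    rw [Set.mem_toFinset] at he
    simp only [Finset.mem_filter, Finset.mem_univ, true_and]
    refine ⟨?_, B.deleteEdges_le _, ?_⟩
    · rw [← SimpleGraph.edgeSet_subset_edgeSet, SimpleGraph.edgeSet_deleteEdges]
      intro f hf
      refine ⟨SimpleGraph.edgeSet_mono hAB hf, ?_⟩
      rintro rfl
      exact he.2 hf
    · rw [SimpleGraph.edgeSet_deleteEdges, Set.ncard_sdiff_singleton_of_mem he.1, hB]
      rfl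
  · intro e he f hf hef
    rw [Set.mem_toFinset] at he hf
    by_contra hne
    have h2 : e ∈ (B.deleteEdges {f}).edgeSet := by
      rw [SimpleGraph.edgeSet_deleteEdges]; exact ⟨he.1, hne⟩
    rw [← hef, SimpleGraph.edgeSet_deleteEdges] at h2
    exact h2.2 rfl
  · intro C hC
    simp only [Finset.mem_filter, Finset.mem_univ, true_and] at hC
    have h2 : (B.edgeSet \ C.edgeSet).ncard = 1 := by
      have := Set.ncard_sdiff_add_ncard_of_subset (SimpleGraph.edgeSet_mono hC.2.1)
      omega
    obtain ⟨e, he⟩ := Set.ncard_eq_one.1 h2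
    have he1 : e ∈ B.edgeSet \ C.edgeSet := by rw [he]; rfl
    refine ⟨e, ?_, ?_⟩
    · rw [Set.mem_toFinset]
      exact ⟨he1.1, fun h => he1.2 (SimpleGraph.edgeSet_mono hC.1 h)⟩
    · rw [← SimpleGraph.edgeSet_inj, SimpleGraph.edgeSet_deleteEdges, ← he,
        Set.sdiff_sdiff_cancel_left (SimpleGraph.edgeSet_mono hC.2.1)]

/-- The pairs of nested graphs with `s` and `t` edges. -/
def IsNested (s t : ℕ) (q : SimpleGraph V × SimpleGraph V) : Prop :=
  q.1 ≤ q.2 ∧ q.1.edgeSet.ncard = s ∧ q.2.edgeSet.ncard = t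

/-- In the process all pairs of nested graphs with the right numbers of edges are equally
likely. -/
theorem exists_const_randomGraphHistory_map (m : ℕ) (hm : m ≤ (Fintype.card V).choose 2)
    (s : Fin (m + 1)) : ∃ c : ENNReal, ∀ q : SimpleGraph V × SimpleGraph V,
      (randomGraphHistory V m).map (fun g => (g s, g (Fin.last m))) q =
        if IsNested s m q then c else 0 := by
  induction m with
  | zero =>
    refine ⟨1, fun q => ?_⟩
    rw [randomGraphHistory, PMF.pure_map, PMF.pure_apply]
    congr 1
    rw [eq_iff_iff]
    obtain ⟨A, B⟩ := q
    simp only [Prod.mk.injEq, IsNested, Fin.val_eq_zero, Set.ncard_eq_zero (Set.toFinite _),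
      SimpleGraph.edgeSet_eq_empty]
    constructor
    · rintro ⟨rfl, rfl⟩; simp
    · exact fun h => h.2
  | succ m ih =>
    -- For an earlier time `s'`, a pair `(A, B)` arises from the pairs `(A, C)` with `A ≤ C ≤ B` in
    -- which `C` has one edge less than `B`. Their number and the transition probability depend
    -- only on the numbers of edges.
    have key : ∀ s' : Fin (m + 1), ∃ c : ENNReal, ∀ q : SimpleGraph V × SimpleGraph V,
        (randomGraphHistory V (m + 1)).map (fun g => (g s'.castSucc, g (Fin.last (m + 1)))) q =
        if IsNested s' (m + 1) q then c else 0 := by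
      intro s'
      obtain ⟨c, hc⟩ := ih (by omega) s'
      have hrec : (randomGraphHistory V (m + 1)).map
            (fun g => (g s'.castSucc, g (Fin.last (m + 1)))) =
          ((randomGraphHistory V m).map (fun g => (g s', g (Fin.last m)))).bind
            fun q => (randomGraphStep q.2).map fun H => (q.1, H) := by
        rw [randomGraphHistory, PMF.map_bind, PMF.bind_map]
        congr 1
        funext g
        simp only [PMF.map_comp, Function.comp_def, Fin.snoc_castSucc, Fin.snoc_last]
      refine ⟨((m + 1 - (s' : ℕ) : ℕ) : ENNReal) *
        (c * (((Fintype.card V).choose 2 - m : ℕ) : ENNReal)⁻¹), ?_⟩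
      rintro ⟨A, B⟩
      rw [hrec, PMF.bind_apply, tsum_fintype, Fintype.sum_prod_type, Finset.sum_eq_single A]
      · have hterm : ∀ C : SimpleGraph V,
            (randomGraphHistory V m).map (fun g => (g s', g (Fin.last m))) (A, C) *
              ((randomGraphStep C).map fun H => (A, H)) (A, B) =
            if A.edgeSet.ncard = s' ∧ B.edgeSet.ncard = m + 1 ∧
                (A ≤ C ∧ C ≤ B ∧ C.edgeSet.ncard = m) then
              c * (((Fintype.card V).choose 2 - m : ℕ) : ENNReal)⁻¹ else 0 := by
          intro C
          have hmap : ((randomGraphStep C).map fun H => (A, H)) (A, B) =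
              randomGraphStep C B := by
            rw [PMF.map_apply, tsum_fintype, Finset.sum_eq_single B]
            · simp
            · intro D _ hD
              rw [if_neg]
              simp only [Prod.mk.injEq, true_and]
              exact fun h => hD h.symm
            · simp
          rw [hc, hmap]
          by_cases hn : IsNested s' m (A, C)
          · obtain ⟨h1, h2, h3⟩ := hn
            simp only at h1 h2 h3
            rw [if_pos ⟨h1, h2, h3⟩, randomGraphStep_apply C B (by omega), h3]
            by_cases hCB : C ≤ B ∧ B.edgeSet.ncard = m + 1
            · rw [if_pos hCB, if_pos ⟨h2, hCB.2, h1, hCB.1, rfl⟩]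
            · rw [if_neg hCB, if_neg, mul_zero]
              exact fun h => hCB ⟨h.2.2.2.1, h.2.1⟩
          · rw [if_neg hn, if_neg, zero_mul]
            exact fun h => hn ⟨h.2.2.1, h.1, h.2.2.2.2⟩
        simp only [hterm]
        by_cases hn : IsNested s' (m + 1) (A, B)
        · obtain ⟨h1, h2, h3⟩ := hn
          simp only at h1 h2 h3
          rw [if_pos ⟨h1, h2, h3⟩]
          simp only [h2, h3, true_and]
          rw [← Finset.sum_filter, Finset.sum_const, card_between A B m h3 h1, nsmul_eq_mul, h2]
        · rw [if_neg hn]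
          refine Finset.sum_eq_zero fun C _ => if_neg ?_
          exact fun h => hn ⟨h.2.2.1.trans h.2.2.2.1, h.1, h.2.1⟩
      · intro A' _ hA'
        refine Finset.sum_eq_zero fun C _ => ?_
        have h0 : ((randomGraphStep C).map fun H => (A', H)) (A, B) = 0 := by
          rw [PMF.map_apply, ENNReal.tsum_eq_zero.2]
          intro H
          rw [if_neg]
          simp only [Prod.mk.injEq, not_and]
          exact fun h => absurd h.symm hA'
        rw [h0, mul_zero]
      · simp
    induction s using Fin.lastCases with
    | cast s' => exact key s'
    | last =>
      -- The law of the last graph alone is read off from the case `s' = 0`, where `A` is empty.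
      obtain ⟨c, hc⟩ := key 0
      refine ⟨c, ?_⟩
      rintro ⟨A, B⟩
      have h1 : (randomGraphHistory V (m + 1)).map
            (fun g => (g (Fin.last (m + 1)), g (Fin.last (m + 1)))) =
          ((randomGraphHistory V (m + 1)).map
            (fun g => (g (0 : Fin (m + 1)).castSucc, g (Fin.last (m + 1))))).map
            fun q => (q.2, q.2) := by
        rw [PMF.map_comp]; rfl
      rw [h1, PMF.map_apply, tsum_fintype, Fintype.sum_prod_type, Finset.sum_eq_single ⊥,
        Finset.sum_eq_single B]
      · rw [hc]
        by_cases hAB : A = B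
        · subst hAB
          rw [if_pos rfl]
          refine if_congr ?_ rfl rfl
          simp [IsNested]
        · rw [if_neg (by simp only [Prod.mk.injEq, and_true]; exact hAB), if_neg]
          rintro ⟨h2, h3, h4⟩
          simp only [Fin.val_last] at h2 h3 h4
          apply hAB
          rw [← SimpleGraph.edgeSet_inj]
          exact Set.eq_of_subset_of_ncard_le (SimpleGraph.edgeSet_mono h2)
            (h4.trans h3.symm).le
      · intro C _ hC
        rw [if_neg]
        simp only [Prod.mk.injEq, not_and]
        exact fun _ h => hC h.symm
      · simp
      · intro A' _ hA'
        refine Finset.sum_eq_zero fun C _ => ?_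
        rw [hc, if_neg (c := IsNested _ _ _)]
        · simp
        · rintro ⟨_, h3, _⟩
          simp only [Fin.val_zero, Set.ncard_eq_zero (Set.toFinite _),
            SimpleGraph.edgeSet_eq_empty] at h3
          exact hA' h3
      · simp

/-- The graphs at times `s ≤ t` of the process form a uniformly random nested pair. -/
theorem randomGraphHistory_toOuterMeasure_pair (bad : SimpleGraph V → SimpleGraph V → Prop)
    {s t : ℕ} (hst : s ≤ t) (ht : t ≤ (Fintype.card V).choose 2) :
    (randomGraphHistory V ((Fintype.card V).choose 2)).toOuterMeasure
      {g | bad (g ⟨s, by omega⟩) (g ⟨t, by omega⟩)} *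
      ((Finset.univ.filter fun q : SimpleGraph V × SimpleGraph V => IsNested s t q).card :
        ENNReal) =
      ((Finset.univ.filter fun q : SimpleGraph V × SimpleGraph V =>
        IsNested s t q ∧ bad q.1 q.2).card : ENNReal) := by
  obtain ⟨c, hc⟩ := exists_const_randomGraphHistory_map t ht ⟨s, by omega⟩
  set μ := (randomGraphHistory V t).map
    (fun g => (g (⟨s, by omega⟩ : Fin (t + 1)), g (Fin.last t))) with hμ
  have h1 : (randomGraphHistory V ((Fintype.card V).choose 2)).toOuterMeasure
      {g | bad (g ⟨s, by omega⟩) (g ⟨t, by omega⟩)} =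
      μ.toOuterMeasure {q | bad q.1 q.2} := by
    rw [hμ, PMF.toOuterMeasure_map_apply, ← randomGraphHistory_map_castLE ht,
      PMF.toOuterMeasure_map_apply]
    rfl
  have hsum : ∑ q, μ q = 1 := by
    rw [← μ.tsum_coe, tsum_fintype]
  have h2 : ((Finset.univ.filter fun q : SimpleGraph V × SimpleGraph V =>
      IsNested s t q).card : ENNReal) * c = 1 := by
    rw [← hsum]
    simp only [hc]
    rw [← Finset.sum_filter, Finset.sum_const, nsmul_eq_mul]
  have h3 : μ.toOuterMeasure {q | bad q.1 q.2} =
      ((Finset.univ.filter fun q : SimpleGraph V × SimpleGraph V =>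
        IsNested s t q ∧ bad q.1 q.2).card : ENNReal) * c := by
    rw [PMF.toOuterMeasure_apply, tsum_fintype, ← nsmul_eq_mul, ← Finset.sum_const,
      Finset.sum_filter]
    refine Finset.sum_congr rfl fun q _ => ?_
    simp only [Set.indicator_apply, Set.mem_ofPred_eq, hc]
    by_cases hb : bad q.1 q.2 <;> simp [hb]
  rw [h1, h3, mul_assoc, mul_comm c, h2, mul_one]

end

/-! ### Independent edge labels -/

section
open scoped Classical

variable {ι Λ : Type*} [Fintype ι] [Fintype Λ]

/-- The expectation of `f` when the coordinates of `ω` are independent with weights `w`. -/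
noncomputable def labelExp (w : Λ → ℝ) (f : (ι → Λ) → ℝ) : ℝ :=
  ∑ ω, (∏ e, w (ω e)) * f ω

/-- The probability of `P` when the coordinates of `ω` are independent with weights `w`. -/
noncomputable def labelProb (w : Λ → ℝ) (P : (ι → Λ) → Prop) : ℝ :=
  labelExp w fun ω => if P ω then 1 else 0

theorem labelProb_eq (w : Λ → ℝ) (P : (ι → Λ) → Prop) [∀ ω, Decidable (P ω)] :
    labelProb w P = labelExp w fun ω => if P ω then 1 else 0 := by
  unfold labelProb
  congr 1
  funext ω
  congr

/-- Nonnegative weights with sum one. -/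
structure IsWeight (w : Λ → ℝ) : Prop where
  nonneg : ∀ l, 0 ≤ w l
  sum_eq_one : ∑ l, w l = 1

section
variable {w : Λ → ℝ}

theorem labelExp_prod (F : ι → Λ → ℝ) :
    labelExp w (fun ω => ∏ e, F e (ω e)) = ∏ e, ∑ l, w l * F e l := by
  rw [Finset.prod_univ_sum, Fintype.piFinset_univ, labelExp]
  exact Finset.sum_congr rfl fun ω _ => Finset.prod_mul_distrib.symm

/-- Independence, for functions of single coordinates grouped into disjoint blocks. -/
theorem labelExp_prod_blocks (hw : IsWeight w) {I : Type*} [Fintype I] (F : I → Finset ι)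
    (hF : ∀ i j, i ≠ j → Disjoint (F i) (F j)) (f : I → Λ → ℝ) :
    labelExp w (fun ω => ∏ i, ∏ e ∈ F i, f i (ω e)) = ∏ i, (∑ l, w l * f i l) ^ (F i).card := by
  have h1 : ∀ ω : ι → Λ, (∏ i, ∏ e ∈ F i, f i (ω e)) =
      ∏ e, ∏ i, if e ∈ F i then f i (ω e) else 1 := by
    intro ω
    rw [Finset.prod_comm]
    refine Finset.prod_congr rfl fun i _ => ?_
    rw [Finset.prod_ite_mem, Finset.univ_inter]
  simp only [h1]
  rw [labelExp_prod (fun e l => ∏ i, if e ∈ F i then f i l else 1)]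
  have h2 : ∀ e, (∑ l, w l * ∏ i, if e ∈ F i then f i l else 1) =
      ∏ i, if e ∈ F i then ∑ l, w l * f i l else 1 := by
    intro e
    by_cases he : ∃ i, e ∈ F i
    · obtain ⟨i, hi⟩ := he
      have hne : ∀ j, j ≠ i → e ∉ F j := fun j hj h =>
        Finset.disjoint_left.1 (hF i j hj.symm) hi h
      have h3 : ∀ g : I → ℝ, (∏ j, if e ∈ F j then g j else 1) = g i := by
        intro g
        rw [Finset.prod_eq_single i]
        · rw [if_pos hi]
        · exact fun j _ hj => if_neg (hne j hj)
        · simp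
      rw [h3 fun i => ∑ l, w l * f i l]
      exact Finset.sum_congr rfl fun l _ => by rw [h3 fun j => f j l]
    · push Not at he
      simp [he, hw.sum_eq_one]
  simp only [h2]
  rw [Finset.prod_comm]
  refine Finset.prod_congr rfl fun i _ => ?_
  rw [Finset.prod_ite_mem, Finset.univ_inter, Finset.prod_const]

theorem labelExp_mono (hw : IsWeight w) {f g : (ι → Λ) → ℝ} (h : ∀ ω, f ω ≤ g ω) :
    labelExp w f ≤ labelExp w g :=
  Finset.sum_le_sum fun ω _ =>
    mul_le_mul_of_nonneg_left (h ω) (Finset.prod_nonneg fun _ _ => hw.nonneg _)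

theorem labelExp_const (hw : IsWeight w) (a : ℝ) :
    labelExp (ι := ι) w (fun _ => a) = a := by
  have h : labelExp (ι := ι) w (fun _ => ∏ _e : ι, (1 : ℝ)) = 1 := by
    rw [labelExp_prod (fun _ _ => 1)]
    simp [hw.sum_eq_one]
  simp only [labelExp, Finset.prod_const_one, mul_one] at h
  simp only [labelExp, ← Finset.sum_mul, h, one_mul]

theorem labelExp_sum {I : Type*} (S : Finset I) (f : I → (ι → Λ) → ℝ) :
    labelExp w (fun ω => ∑ i ∈ S, f i ω) = ∑ i ∈ S, labelExp w (f i) := by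
  simp only [labelExp, Finset.mul_sum]
  rw [Finset.sum_comm]

theorem labelExp_add (f g : (ι → Λ) → ℝ) :
    labelExp w (fun ω => f ω + g ω) = labelExp w f + labelExp w g := by
  simp only [labelExp, mul_add, Finset.sum_add_distrib]

theorem labelExp_const_mul (a : ℝ) (f : (ι → Λ) → ℝ) :
    labelExp w (fun ω => a * f ω) = a * labelExp w f := by
  simp only [labelExp, Finset.mul_sum]
  exact Finset.sum_congr rfl fun ω _ => by ring

theorem labelExp_nonneg (hw : IsWeight w) {f : (ι → Λ) → ℝ} (h : ∀ ω, 0 ≤ f ω) :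
    0 ≤ labelExp w f :=
  (labelExp_const (ι := ι) hw 0).symm.le.trans (labelExp_mono hw h)

theorem labelProb_nonneg (hw : IsWeight w) (P : (ι → Λ) → Prop) : 0 ≤ labelProb w P :=
  labelExp_nonneg hw fun ω => by split_ifs <;> norm_num

theorem labelProb_mono (hw : IsWeight w) {P Q : (ι → Λ) → Prop} (h : ∀ ω, P ω → Q ω) :
    labelProb w P ≤ labelProb w Q :=
  labelExp_mono hw fun ω => by
    by_cases hP : P ω
    · simp [hP, h ω hP]
    · rw [if_neg hP]; split_ifs <;> norm_num

theorem labelProb_exists_le (hw : IsWeight w) {I : Type*} (S : Finset I)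
    (P : I → (ι → Λ) → Prop) :
    labelProb w (fun ω => ∃ i ∈ S, P i ω) ≤ ∑ i ∈ S, labelProb w (P i) := by
  unfold labelProb
  rw [← labelExp_sum]
  refine labelExp_mono hw fun ω => ?_
  have hnn : ∀ j ∈ S, (0 : ℝ) ≤ if P j ω then 1 else 0 := fun j _ => by split_ifs <;> norm_num
  split_ifs with h
  · obtain ⟨i, hi, hP⟩ := h
    refine le_trans ?_ (Finset.single_le_sum hnn hi)
    rw [if_pos hP]
  · exact Finset.sum_nonneg hnn

/-- The union bound with a uniform bound for the single events. -/
theorem labelProb_exists_le_card_mul (hw : IsWeight w) {I : Type*} (S : Finset I)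
    (P : I → (ι → Λ) → Prop) (b : ℝ) (hb : ∀ i ∈ S, labelProb w (P i) ≤ b) :
    labelProb w (fun ω => ∃ i ∈ S, P i ω) ≤ S.card * b := by
  refine (labelProb_exists_le hw S P).trans ?_
  rw [← nsmul_eq_mul]
  exact Finset.sum_le_card_nsmul S _ b hb

theorem labelProb_or_le (hw : IsWeight w) (P Q : (ι → Λ) → Prop) :
    labelProb w (fun ω => P ω ∨ Q ω) ≤ labelProb w P + labelProb w Q := by
  unfold labelProb
  rw [← labelExp_add]
  refine labelExp_mono hw fun ω => ?_
  by_cases hP : P ω <;> by_cases hQ : Q ω <;> simp [hP, hQ]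

/-- The probability that a label satisfies `P`. -/
noncomputable def weightOf (w : Λ → ℝ) (P : Λ → Prop) : ℝ := ∑ l, w l * if P l then 1 else 0

theorem weightOf_nonneg (hw : IsWeight w) (P : Λ → Prop) : 0 ≤ weightOf w P :=
  Finset.sum_nonneg fun l _ => mul_nonneg (hw.nonneg l) (by split_ifs <;> norm_num)

theorem weightOf_not (hw : IsWeight w) (P : Λ → Prop) :
    weightOf w (fun l => ¬ P l) = 1 - weightOf w P := by
  rw [eq_sub_iff_add_eq, weightOf, weightOf, ← Finset.sum_add_distrib]
  refine Eq.trans ?_ hw.sum_eq_one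
  refine Finset.sum_congr rfl fun l _ => ?_
  by_cases h : P l <;> simp [h]

theorem labelProb_forall_mem (hw : IsWeight w) (F : Finset ι) (P : Λ → Prop) :
    labelProb w (fun ω : ι → Λ => ∀ e ∈ F, P (ω e)) = weightOf w P ^ F.card := by
  have := labelExp_prod_blocks hw (fun _ : Unit => F) (by simp)
    (fun _ l => if P l then (1 : ℝ) else 0)
  rw [labelProb_eq]
  simpa [Finset.prod_boole, weightOf] using this

end

/-! ### From independent labels to the process -/

/-- The graph of the pairs whose label satisfies `P`. -/
def labelGraph {V : Type*} (P : Λ → Prop) (ω : Sym2 V → Λ) : SimpleGraph V where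
  Adj x y := x ≠ y ∧ P (ω s(x, y))
  symm := ⟨fun x y h => ⟨h.1.symm, by rw [Sym2.eq_swap]; exact h.2⟩⟩
  loopless := ⟨fun _ h => h.1 rfl⟩

omit [Fintype Λ] in
theorem mem_edgeSet_labelGraph {V : Type*} {P : Λ → Prop} {ω : Sym2 V → Λ} {e : Sym2 V} :
    e ∈ (labelGraph P ω).edgeSet ↔ ¬ e.IsDiag ∧ P (ω e) := by
  induction e with
  | h x y => simp [labelGraph]

/-- The weights of the labels `0`, `1`, `2`: an edge with label `0` is in both graphs, an edge
with label `1` only in the larger one, an edge with label `2` in neither. -/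
def nestedWeight (p p' : ℝ) : Fin 3 → ℝ := ![p, p' - p, 1 - p']

theorem isWeight_nestedWeight {p p' : ℝ} (h0 : 0 ≤ p) (h1 : p ≤ p') (h2 : p' ≤ 1) :
    IsWeight (nestedWeight p p') := by
  refine ⟨fun l => ?_, ?_⟩
  · fin_cases l <;> simp [nestedWeight] <;> linarith
  · simp [nestedWeight, Fin.sum_univ_three]

theorem weightOf_nestedWeight_lower (p p' : ℝ) : weightOf (nestedWeight p p') (· = 0) = p := by
  simp [weightOf, nestedWeight]

theorem weightOf_nestedWeight_upper (p p' : ℝ) : weightOf (nestedWeight p p') (· ≠ 2) = p' := by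
  simp [weightOf, nestedWeight, Fin.sum_univ_three]

variable {V : Type*} [Fintype V]

/-- The smaller of the two nested random graphs. -/
abbrev lowerGraph (ω : Sym2 V → Fin 3) : SimpleGraph V := labelGraph (· = 0) ω

/-- The larger of the two nested random graphs. -/
abbrev upperGraph (ω : Sym2 V → Fin 3) : SimpleGraph V := labelGraph (· ≠ 2) ω

omit [Fintype V] in
theorem lowerGraph_le_upperGraph (ω : Sym2 V → Fin 3) : lowerGraph ω ≤ upperGraph ω :=
  fun x y h => ⟨h.1, by rw [h.2]; decide⟩

/-- The probability of a given nested pair depends only on the numbers of edges. -/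
theorem labelProb_nested_eq {p p' : ℝ} (hw : IsWeight (nestedWeight p p')) {A B : SimpleGraph V}
    (hAB : A ≤ B) :
    labelProb (nestedWeight p p') (fun ω : Sym2 V → Fin 3 => (lowerGraph ω, upperGraph ω) = (A, B))
      = p ^ A.edgeSet.ncard * (p' - p) ^ (B.edgeSet.ncard - A.edgeSet.ncard) *
        (1 - p') ^ ((Fintype.card V).choose 2 - B.edgeSet.ncard) := by
  let F : Fin 3 → Finset (Sym2 V) :=
    ![A.edgeSet.toFinset, (B.edgeSet \ A.edgeSet).toFinset, Bᶜ.edgeSet.toFinset]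
  have hABs := SimpleGraph.edgeSet_mono hAB
  have hmem : ∀ i e, e ∈ F i ↔ (i = 0 ∧ e ∈ A.edgeSet) ∨
      (i = 1 ∧ e ∈ B.edgeSet ∧ e ∉ A.edgeSet) ∨ (i = 2 ∧ e ∈ Bᶜ.edgeSet) := by
    intro i e
    fin_cases i <;> simp [F]
  have hdisj : ∀ i j, i ≠ j → Disjoint (F i) (F j) := by
    intro i j hij
    rw [Finset.disjoint_left]
    intro e hi hj
    rw [hmem] at hi hj
    have h1 : e ∈ Bᶜ.edgeSet → e ∉ B.edgeSet := notMem_edgeSet_of_mem_compl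
    have h2 : e ∈ A.edgeSet → e ∈ B.edgeSet := fun h => hABs h
    grind
  have hcompl : ∀ e : Sym2 V, e ∈ Bᶜ.edgeSet ↔ ¬ e.IsDiag ∧ e ∉ B.edgeSet := by
    intro e
    induction e with
    | h x y => simp [SimpleGraph.compl_adj]
  have h := labelExp_prod_blocks hw F hdisj (fun i l => if l = i then (1 : ℝ) else 0)
  have hl : ∀ ω : Sym2 V → Fin 3, (∏ i, ∏ e ∈ F i, if ω e = i then (1 : ℝ) else 0) =
      if (lowerGraph ω, upperGraph ω) = (A, B) then 1 else 0 := by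
    intro ω
    suffices hiff : (∀ i ∈ Finset.univ, ∀ e ∈ F i, ω e = i) ↔
        (lowerGraph ω, upperGraph ω) = (A, B) by
      simp only [Finset.prod_boole]
      by_cases hX : (lowerGraph ω, upperGraph ω) = (A, B)
      · rw [if_pos hX]
        exact Finset.prod_eq_one fun i hi => if_pos (hiff.2 hX i hi)
      · rw [if_neg hX]
        have h3 := mt hiff.1 hX
        push Not at h3
        obtain ⟨i, hi, e, he, hne⟩ := h3
        exact Finset.prod_eq_zero hi (if_neg fun h => hne (h e he))
    simp only [Finset.mem_univ, true_imp_iff, hmem]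
    rw [Prod.mk.injEq, ← SimpleGraph.edgeSet_inj, ← SimpleGraph.edgeSet_inj, Set.ext_iff,
      Set.ext_iff]
    simp only [mem_edgeSet_labelGraph]
    constructor
    · intro hω
      have key : ∀ e, (e ∈ A.edgeSet → ω e = 0) ∧ (e ∈ B.edgeSet ∧ e ∉ A.edgeSet → ω e = 1) ∧
          (e ∈ Bᶜ.edgeSet → ω e = 2) := fun e =>
        ⟨fun h => hω 0 e (Or.inl ⟨rfl, h⟩), fun h => hω 1 e (Or.inr (Or.inl ⟨rfl, h⟩)),
          fun h => hω 2 e (Or.inr (Or.inr ⟨rfl, h⟩))⟩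
      constructor
      · intro e
        obtain ⟨k1, k2, k3⟩ := key e
        rw [hcompl] at k3
        have hd : e ∈ B.edgeSet → ¬ e.IsDiag := B.not_isDiag_of_mem_edgeSet
        have hs : e ∈ A.edgeSet → e ∈ B.edgeSet := fun h => hABs h
        by_cases ha : e ∈ A.edgeSet
        · simp [ha, k1 ha, hd (hs ha)]
        · simp only [ha, iff_false, not_and]
          intro hdiag
          by_cases hb : e ∈ B.edgeSet
          · rw [k2 ⟨hb, ha⟩]; decide
          · rw [k3 ⟨hdiag, hb⟩]; decide
      · intro e
        obtain ⟨k1, k2, k3⟩ := key e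
        rw [hcompl] at k3
        have hd : e ∈ B.edgeSet → ¬ e.IsDiag := B.not_isDiag_of_mem_edgeSet
        by_cases hb : e ∈ B.edgeSet
        · simp only [hb, iff_true]
          refine ⟨hd hb, ?_⟩
          by_cases ha : e ∈ A.edgeSet
          · rw [k1 ha]; decide
          · rw [k2 ⟨hb, ha⟩]; decide
        · simp only [hb, iff_false, not_and, not_not]
          intro hdiag
          exact k3 ⟨hdiag, hb⟩
    · rintro ⟨hA, hB⟩ i e (⟨rfl, he⟩ | ⟨rfl, he⟩ | ⟨rfl, he⟩)
      · exact ((hA e).2 he).2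
      · have h1 := (hB e).2 he.1
        have h2 := fun h => he.2 ((hA e).1 ⟨h1.1, h⟩)
        generalize ω e = l at h1 h2
        revert h2; have := h1.2; revert this; clear h1; revert l; decide
      · rw [hcompl] at he
        by_contra hne
        exact he.2 ((hB e).1 ⟨he.1, hne⟩)
  simp only [hl] at h
  rw [labelProb_eq, h, Fin.prod_univ_three]
  have hc := ncard_edgeSet_compl B
  have e1 : (F 0).card = A.edgeSet.ncard := (Set.ncard_eq_toFinset_card' _).symm
  have e2 : (F 1).card = B.edgeSet.ncard - A.edgeSet.ncard := by
    have h1 := Set.ncard_sdiff_add_ncard_of_subset hABs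
    have h2 : (F 1).card = (B.edgeSet \ A.edgeSet).ncard := (Set.ncard_eq_toFinset_card' _).symm
    omega
  have e3 : (F 2).card = (Fintype.card V).choose 2 - B.edgeSet.ncard := by
    have h2 : (F 2).card = Bᶜ.edgeSet.ncard := (Set.ncard_eq_toFinset_card' _).symm
    omega
  rw [e1, e2, e3]
  simp [nestedWeight]

/-- An event for the two nested random graphs is at least as likely as for the graphs at
two suitable times of the process: given the numbers of edges, both pairs are uniform. -/
theorem exists_times_le_labelProb {p p' : ℝ} (hw : IsWeight (nestedWeight p p'))
    (bad : SimpleGraph V → SimpleGraph V → Prop) :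
    ∃ (s t : ℕ) (hst : s ≤ t) (ht : t ≤ (Fintype.card V).choose 2),
      (randomGraphHistory V ((Fintype.card V).choose 2)).toOuterMeasure
        {g | bad (g ⟨s, by omega⟩) (g ⟨t, by omega⟩)} ≤
      ENNReal.ofReal (labelProb (nestedWeight p p')
        fun ω : Sym2 V → Fin 3 => bad (lowerGraph ω) (upperGraph ω)) := by
  set N := (Fintype.card V).choose 2 with hN
  set W : ℕ → ℕ → ℝ := fun s t => p ^ s * (p' - p) ^ (t - s) * (1 - p') ^ (N - t) with hW
  have hW0 : ∀ s t, 0 ≤ W s t := by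
    intro s t
    have h0 := hw.nonneg 0
    have h1 := hw.nonneg 1
    have h2 := hw.nonneg 2
    simp only [nestedWeight, Matrix.cons_val_zero, Matrix.cons_val_one, Matrix.cons_val] at h0 h1 h2
    positivity
  have hle : ∀ G : SimpleGraph V, G.edgeSet.ncard ≤ N := by
    intro G
    have := ncard_edgeSet_compl G
    omega
  -- The probability of an event as a sum over the numbers of edges.
  have key : ∀ Q : SimpleGraph V → SimpleGraph V → Prop,
      labelProb (nestedWeight p p') (fun ω : Sym2 V → Fin 3 => Q (lowerGraph ω) (upperGraph ω)) =
      ∑ st ∈ (Finset.range (N + 1) ×ˢ Finset.range (N + 1)).filter (fun st => st.1 ≤ st.2),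
        W st.1 st.2 * ((Finset.univ.filter fun q : SimpleGraph V × SimpleGraph V =>
          IsNested st.1 st.2 q ∧ Q q.1 q.2).card : ℝ) := by
    intro Q
    have h1 : ∀ ω : Sym2 V → Fin 3, (if Q (lowerGraph ω) (upperGraph ω) then (1 : ℝ) else 0) =
        ∑ q ∈ Finset.univ.filter (fun q : SimpleGraph V × SimpleGraph V => q.1 ≤ q.2 ∧ Q q.1 q.2),
          if (lowerGraph ω, upperGraph ω) = q then (1 : ℝ) else 0 := by
      intro ω
      rw [Finset.sum_ite_eq]
      simp [lowerGraph_le_upperGraph ω]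
    rw [labelProb]
    simp only [h1]
    rw [labelExp_sum, ← Finset.sum_fiberwise_of_maps_to
      (t := (Finset.range (N + 1) ×ˢ Finset.range (N + 1)).filter (fun st => st.1 ≤ st.2))
      (g := fun q : SimpleGraph V × SimpleGraph V => (q.1.edgeSet.ncard, q.2.edgeSet.ncard))]
    · refine Finset.sum_congr rfl fun st _ => ?_
      rw [mul_comm, ← nsmul_eq_mul, ← Finset.sum_const]
      refine Finset.sum_congr ?_ ?_
      · ext q
        simp only [Finset.mem_filter, Finset.mem_univ, true_and, Prod.ext_iff]
        unfold IsNested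
        tauto
      · rintro ⟨A, B⟩ hq
        simp only [Finset.mem_filter, Finset.mem_univ, true_and] at hq
        unfold IsNested at hq
        have := labelProb_nested_eq hw hq.1.1
        rw [labelProb_eq] at this
        rw [this, hW, hq.1.2.1, hq.1.2.2]
    · intro q hq
      simp only [Finset.mem_filter, Finset.mem_univ, true_and] at hq
      simp only [Finset.mem_filter, Finset.mem_product, Finset.mem_range]
      exact ⟨⟨Nat.lt_succ_of_le (hle _), Nat.lt_succ_of_le (hle _)⟩,
        Set.ncard_le_ncard (SimpleGraph.edgeSet_mono hq.1)⟩
  -- Otherwise `η` would be less than a weighted average whose value is `η`.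
  by_contra! hcon
  set η := labelProb (nestedWeight p p')
    fun ω : Sym2 V → Fin 3 => bad (lowerGraph ω) (upperGraph ω) with hη
  have hη0 : 0 ≤ η := labelProb_nonneg hw _
  have hone := key fun _ _ => True
  have hbad := key bad
  have htrue : labelProb (nestedWeight p p') (fun _ : Sym2 V → Fin 3 => True) = 1 := by
    simp only [labelProb, if_true]
    exact labelExp_const hw 1
  rw [htrue] at hone
  simp only [and_true] at hone
  rw [← hη] at hbad
  set T := (Finset.range (N + 1) ×ˢ Finset.range (N + 1)).filter (fun st => st.1 ≤ st.2)
  have hlt : ∀ st ∈ T,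
      0 < (Finset.univ.filter fun q : SimpleGraph V × SimpleGraph V =>
        IsNested st.1 st.2 q).card →
      η * ((Finset.univ.filter fun q : SimpleGraph V × SimpleGraph V =>
        IsNested st.1 st.2 q).card : ℝ) <
      ((Finset.univ.filter fun q : SimpleGraph V × SimpleGraph V =>
          IsNested st.1 st.2 q ∧ bad q.1 q.2).card : ℝ) := by
    rintro ⟨s, t⟩ hst hpos
    simp only [T, Finset.mem_filter, Finset.mem_product, Finset.mem_range] at hst
    have h1 := hcon s t hst.2 (by omega)
    have h2 := randomGraphHistory_toOuterMeasure_pair bad hst.2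
      (show t ≤ (Fintype.card V).choose 2 by omega)
    simp only at hpos ⊢
    set a := (Finset.univ.filter fun q : SimpleGraph V × SimpleGraph V => IsNested s t q).card
    set b := (Finset.univ.filter fun q : SimpleGraph V × SimpleGraph V =>
          IsNested s t q ∧ bad q.1 q.2).card
    have h3 : ENNReal.ofReal η * a < b := by
      rw [← h2]
      refine ENNReal.mul_lt_mul_left (by exact_mod_cast hpos.ne') (ENNReal.natCast_ne_top a) h1
    have h4 : ENNReal.ofReal η * (a : ENNReal) = ENNReal.ofReal (η * a) := by
      rw [ENNReal.ofReal_mul hη0, ENNReal.ofReal_natCast]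
    have h5 : ((b : ℕ) : ENNReal) = ENNReal.ofReal (b : ℝ) := (ENNReal.ofReal_natCast b).symm
    rw [h4, h5] at h3
    exact (ENNReal.ofReal_lt_ofReal_iff_of_nonneg
      (mul_nonneg hη0 (Nat.cast_nonneg a))).1 h3
  have hex : ∃ st ∈ T, 0 < W st.1 st.2 * ((Finset.univ.filter
      fun q : SimpleGraph V × SimpleGraph V => IsNested st.1 st.2 q).card : ℝ) := by
    by_contra! hno
    have := Finset.sum_nonpos hno
    linarith
  have hzero : η = ∑ st ∈ T, η * (W st.1 st.2 * ((Finset.univ.filter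
      fun q : SimpleGraph V × SimpleGraph V => IsNested st.1 st.2 q).card : ℝ)) := by
    rw [← Finset.mul_sum, ← hone, mul_one]
  have hstrict : ∑ st ∈ T, η * (W st.1 st.2 * ((Finset.univ.filter
      fun q : SimpleGraph V × SimpleGraph V => IsNested st.1 st.2 q).card : ℝ)) <
      ∑ st ∈ T, W st.1 st.2 * ((Finset.univ.filter fun q : SimpleGraph V × SimpleGraph V =>
          IsNested st.1 st.2 q ∧ bad q.1 q.2).card : ℝ) := by
    refine Finset.sum_lt_sum ?_ ?_
    · intro st hst
      rw [mul_left_comm]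
      refine mul_le_mul_of_nonneg_left ?_ (hW0 _ _)
      rcases Nat.eq_zero_or_pos (Finset.univ.filter
        fun q : SimpleGraph V × SimpleGraph V => IsNested st.1 st.2 q).card with h | h
      · rw [h, Nat.cast_zero, mul_zero]
        exact Nat.cast_nonneg _
      · exact (hlt st hst h).le
    · obtain ⟨st, hst, hpos⟩ := hex
      refine ⟨st, hst, ?_⟩
      have ha : 0 < (Finset.univ.filter
        fun q : SimpleGraph V × SimpleGraph V => IsNested st.1 st.2 q).card := by
        rcases Nat.eq_zero_or_pos (Finset.univ.filter
          fun q : SimpleGraph V × SimpleGraph V => IsNested st.1 st.2 q).card with h | h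
        · rw [h, Nat.cast_zero, mul_zero] at hpos; exact absurd hpos (lt_irrefl _)
        · exact h
      have hWp : 0 < W st.1 st.2 := by
        rcases (hW0 st.1 st.2).eq_or_lt with h | h
        · rw [← h, zero_mul] at hpos; exact absurd hpos (lt_irrefl _)
        · exact h
      rw [mul_left_comm]
      exact mul_lt_mul_of_pos_left (hlt st hst ha) hWp
  rw [← hzero, ← hbad] at hstrict
  exact lt_irrefl _ hstrict

end

/-! ### Union bounds for expansion and sparsity -/

section
open scoped Classical

variable {V Λ : Type*} [Fintype V] [Fintype Λ] {w : Λ → ℝ} {P : Λ → Prop}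

/-- The pairs with one element in `X` and one in `Y`. -/
noncomputable def pairsBetween {V : Type*} (X Y : Finset V) : Finset (Sym2 V) :=
  (X ×ˢ Y).image fun q => s(q.1, q.2)

omit [Fintype V] in
theorem mem_pairsBetween {X Y : Finset V} {e : Sym2 V} :
    e ∈ pairsBetween X Y ↔ ∃ x ∈ X, ∃ y ∈ Y, s(x, y) = e := by
  simp only [pairsBetween, Finset.mem_image, Finset.mem_product, Prod.exists]
  constructor
  · rintro ⟨x, y, ⟨hx, hy⟩, h⟩; exact ⟨x, hx, y, hy, h⟩
  · rintro ⟨x, hx, y, hy, h⟩; exact ⟨x, y, ⟨hx, hy⟩, h⟩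

omit [Fintype V] in
theorem card_pairsBetween {X Y : Finset V} (h : Disjoint X Y) :
    (pairsBetween X Y).card = X.card * Y.card := by
  rw [pairsBetween, Finset.card_image_of_injOn, Finset.card_product]
  rintro ⟨x, y⟩ hq ⟨x', y'⟩ hq' hxy
  simp only [Finset.coe_product, Set.mem_prod, Finset.mem_coe] at hq hq'
  simp only [Sym2.eq_iff] at hxy
  rcases hxy with ⟨rfl, rfl⟩ | ⟨rfl, rfl⟩
  · rfl
  · exact absurd hq'.2 (Finset.disjoint_left.1 h hq.1)

theorem labelProb_forall_not_adj (hw : IsWeight w) {X Y : Finset V} (h : Disjoint X Y) :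
    labelProb w (fun ω : Sym2 V → Λ => ∀ x ∈ X, ∀ y ∈ Y, ¬ (labelGraph P ω).Adj x y) =
      (1 - weightOf w P) ^ (X.card * Y.card) := by
  rw [← card_pairsBetween h, ← weightOf_not hw, ← labelProb_forall_mem hw]
  congr 1
  funext ω
  rw [eq_iff_iff]
  constructor
  · intro H e he
    obtain ⟨x, hx, y, hy, rfl⟩ := mem_pairsBetween.1 he
    exact fun hP => H x hx y hy ⟨fun hxy => Finset.disjoint_left.1 h hx (hxy ▸ hy), hP⟩
  · intro H x hx y hy hadj
    exact H _ (mem_pairsBetween.2 ⟨x, hx, y, hy, rfl⟩) hadj.2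

theorem labelProb_exists_not_joined_le (hw : IsWeight w) (a b : ℕ) :
    labelProb w (fun ω : Sym2 V → Λ => ∃ X Y : Finset V, a ≤ X.card ∧ b ≤ Y.card ∧ Disjoint X Y ∧
      ∀ x ∈ X, ∀ y ∈ Y, ¬ (labelGraph P ω).Adj x y) ≤
    ((Fintype.card V).choose a : ℝ) * ((Fintype.card V).choose b : ℝ) *
      (1 - weightOf w P) ^ (a * b) := by
  let S : Finset (Finset V × Finset V) :=
    ((Finset.univ.powersetCard a) ×ˢ (Finset.univ.powersetCard b)).filter
      fun q => Disjoint q.1 q.2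
  have hp : 0 ≤ (1 - weightOf w P) ^ (a * b) := by
    rw [← weightOf_not hw]; exact pow_nonneg (weightOf_nonneg hw _) _
  refine (labelProb_mono hw (Q := fun ω => ∃ q ∈ S,
    ∀ x ∈ q.1, ∀ y ∈ q.2, ¬ (labelGraph P ω).Adj x y) ?_).trans
    ((labelProb_exists_le_card_mul hw S (fun q ω =>
    ∀ x ∈ q.1, ∀ y ∈ q.2, ¬ (labelGraph P ω).Adj x y) ((1 - weightOf w P) ^ (a * b)) ?_).trans ?_)
  · rintro ω ⟨X, Y, hX, hY, hXY, h⟩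
    obtain ⟨X', hX', hXc⟩ := Finset.exists_subset_card_eq hX
    obtain ⟨Y', hY', hYc⟩ := Finset.exists_subset_card_eq hY
    refine ⟨(X', Y'), ?_, fun x hx y hy => h x (hX' hx) y (hY' hy)⟩
    simp only [S, Finset.mem_filter, Finset.mem_product, Finset.mem_powersetCard,
      Finset.subset_univ, true_and]
    exact ⟨⟨hXc, hYc⟩, Finset.disjoint_of_subset_left hX' (Finset.disjoint_of_subset_right hY' hXY)⟩
  · rintro ⟨X, Y⟩ hq
    simp only [S, Finset.mem_filter, Finset.mem_product, Finset.mem_powersetCard,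
      Finset.subset_univ, true_and] at hq
    rw [labelProb_forall_not_adj hw hq.2, hq.1.1, hq.1.2]
  · refine mul_le_mul_of_nonneg_right ?_ hp
    have := Finset.card_filter_le ((Finset.univ.powersetCard a) ×ˢ (Finset.univ.powersetCard b))
      fun q : Finset V × Finset V => Disjoint q.1 q.2
    rw [Finset.card_product, Finset.card_powersetCard, Finset.card_powersetCard,
      Finset.card_univ] at this
    exact_mod_cast this

/-- Independence of linear combinations of products over disjoint blocks. -/
theorem labelExp_prod_sum_blocks {ι : Type*} [Fintype ι] (hw : IsWeight w) {I J : Type*}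
    [Fintype I] [Fintype J] (a : J → ℝ) (F : I → J → Finset ι)
    (hF : ∀ i i' j j', i ≠ i' → Disjoint (F i j) (F i' j')) (f : Λ → ℝ) :
    labelExp w (fun ω => ∏ i, ∑ j, a j * ∏ e ∈ F i j, f (ω e)) =
      ∏ i, ∑ j, a j * (∑ l, w l * f l) ^ (F i j).card := by
  simp only [Finset.prod_univ_sum, Fintype.piFinset_univ]
  rw [labelExp_sum]
  refine Finset.sum_congr rfl fun φ _ => ?_
  simp only [Finset.prod_mul_distrib]
  rw [labelExp_const_mul, labelExp_prod_blocks hw (fun i => F i (φ i))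
    (fun i i' h => hF i i' _ _ h) (fun _ => f)]

/-- The events that a vertex `z` is adjacent to both `X` and `Y` are independent for distinct
vertices `z` outside `X ∪ Y`. -/
theorem labelProb_no_common_neighbor (hw : IsWeight w) {X Y Z : Finset V} (hXY : Disjoint X Y)
    (hXZ : X ⊆ Z) (hYZ : Y ⊆ Z) {u : ℕ} (hX : X.card = u) (hY : Y.card = u) :
    labelProb w (fun ω : Sym2 V → Λ => ∀ z ∉ Z, (∀ x ∈ X, ¬ (labelGraph P ω).Adj z x) ∨
      ∀ y ∈ Y, ¬ (labelGraph P ω).Adj z y) =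
    (1 - (1 - (1 - weightOf w P) ^ u) ^ 2) ^ (Fintype.card V - Z.card) := by
  let F : {z // z ∉ Z} → Fin 3 → Finset (Sym2 V) := fun z =>
    ![pairsBetween {z.1} X, pairsBetween {z.1} Y, pairsBetween {z.1} (X ∪ Y)]
  have hXY' : X ∪ Y ⊆ Z := Finset.union_subset hXZ hYZ
  have hsub : ∀ z j, F z j ⊆ pairsBetween {z.1} (X ∪ Y) := by
    intro z j e he
    fin_cases j
    · obtain ⟨x, hx, y, hy, rfl⟩ := mem_pairsBetween.1 he
      exact mem_pairsBetween.2 ⟨x, hx, y, Finset.mem_union_left _ hy, rfl⟩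
    · obtain ⟨x, hx, y, hy, rfl⟩ := mem_pairsBetween.1 he
      exact mem_pairsBetween.2 ⟨x, hx, y, Finset.mem_union_right _ hy, rfl⟩
    · exact he
  have hF : ∀ i i' j j', i ≠ i' → Disjoint (F i j) (F i' j') := by
    intro i i' j j' hne
    rw [Finset.disjoint_left]
    intro e he he'
    obtain ⟨x, hx, y, hy, rfl⟩ := mem_pairsBetween.1 (hsub _ _ he)
    obtain ⟨x', hx', y', hy', h⟩ := mem_pairsBetween.1 (hsub _ _ he')
    rw [Finset.mem_singleton] at hx hx'
    subst hx hx'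
    rw [Sym2.eq_iff] at h
    rcases h with h | h
    · exact hne (Subtype.ext h.1.symm)
    · exact i.2 (h.2 ▸ hXY' hy')
  -- For each `z` the indicator of the union of the two events comes from inclusion-exclusion.
  have h := labelExp_prod_sum_blocks hw ![1, 1, -1] F hF (fun l => if ¬ P l then (1 : ℝ) else 0)
  have hev : ∀ ω : Sym2 V → Λ, (∏ i, ∑ j, (![1, 1, -1] : Fin 3 → ℝ) j *
      ∏ e ∈ F i j, if ¬ P (ω e) then (1 : ℝ) else 0) =
      if (∀ z ∉ Z, (∀ x ∈ X, ¬ (labelGraph P ω).Adj z x) ∨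
        ∀ y ∈ Y, ¬ (labelGraph P ω).Adj z y) then 1 else 0 := by
    intro ω
    have hadj : ∀ (z : {z // z ∉ Z}) (S : Finset V), S ⊆ Z →
        (∏ e ∈ pairsBetween {z.1} S, if ¬ P (ω e) then (1 : ℝ) else 0) =
          if ∀ x ∈ S, ¬ (labelGraph P ω).Adj z x then 1 else 0 := by
      intro z S hS
      have hiff : (∀ e ∈ pairsBetween {z.1} S, ¬ P (ω e)) ↔
          ∀ x ∈ S, ¬ (labelGraph P ω).Adj z x := by
        constructor
        · intro H x hx hadj
          exact H _ (mem_pairsBetween.2 ⟨z, Finset.mem_singleton_self _, x, hx, rfl⟩) hadj.2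
        · intro H e he hP
          obtain ⟨x, hx, y, hy, rfl⟩ := mem_pairsBetween.1 he
          rw [Finset.mem_singleton] at hx
          subst hx
          exact H y hy ⟨fun h => z.2 (h ▸ hS hy), hP⟩
      rw [Finset.prod_boole]
      split_ifs <;> tauto
    have hterm : ∀ z : {z // z ∉ Z}, (∑ j, (![1, 1, -1] : Fin 3 → ℝ) j *
        ∏ e ∈ F z j, if ¬ P (ω e) then (1 : ℝ) else 0) =
        if (∀ x ∈ X, ¬ (labelGraph P ω).Adj z x) ∨ ∀ y ∈ Y, ¬ (labelGraph P ω).Adj z y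
          then 1 else 0 := by
      intro z
      rw [Fin.sum_univ_three]
      have e0 : F z 0 = pairsBetween {z.1} X := rfl
      have e1 : F z 1 = pairsBetween {z.1} Y := rfl
      have e2 : F z 2 = pairsBetween {z.1} (X ∪ Y) := rfl
      rw [e0, e1, e2, hadj z X hXZ, hadj z Y hYZ, hadj z _ hXY']
      have hor : (∀ x ∈ X ∪ Y, ¬ (labelGraph P ω).Adj z x) ↔
          (∀ x ∈ X, ¬ (labelGraph P ω).Adj z x) ∧ ∀ y ∈ Y, ¬ (labelGraph P ω).Adj z y := by
        simp only [Finset.mem_union]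
        constructor
        · exact fun H => ⟨fun x hx => H x (Or.inl hx), fun x hx => H x (Or.inr hx)⟩
        · rintro ⟨H1, H2⟩ x (hx | hx)
          · exact H1 x hx
          · exact H2 x hx
      by_cases hA : ∀ x ∈ X, ¬ (labelGraph P ω).Adj z x <;>
      by_cases hB : ∀ y ∈ Y, ¬ (labelGraph P ω).Adj z y
      · rw [if_pos hA, if_pos hB, if_pos (hor.2 ⟨hA, hB⟩), if_pos (Or.inl hA)]
        simp
      · rw [if_pos hA, if_neg hB, if_neg (fun h => hB (hor.1 h).2), if_pos (Or.inl hA)]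
        simp
      · rw [if_neg hA, if_pos hB, if_neg (fun h => hA (hor.1 h).1), if_pos (Or.inr hB)]
        simp
      · rw [if_neg hA, if_neg hB, if_neg (fun h => hA (hor.1 h).1), if_neg (by tauto)]
        simp
    simp only [hterm]
    by_cases H : ∀ z ∉ Z, (∀ x ∈ X, ¬ (labelGraph P ω).Adj z x) ∨
        ∀ y ∈ Y, ¬ (labelGraph P ω).Adj z y
    · rw [if_pos H]
      exact Finset.prod_eq_one fun z _ => if_pos (H z.1 z.2)
    · rw [if_neg H]
      push Not at H
      obtain ⟨z, hz, ⟨x, hx, hzx⟩, y, hy, hzy⟩ := H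
      refine Finset.prod_eq_zero (Finset.mem_univ ⟨z, hz⟩) (if_neg ?_)
      rintro (H | H)
      · exact H x hx hzx
      · exact H y hy hzy
  simp only [hev] at h
  rw [labelProb_eq, h]
  have hm : (∑ l, w l * if ¬ P l then (1 : ℝ) else 0) = 1 - weightOf w P := by
    rw [← weightOf_not hw]
    unfold weightOf
    exact Finset.sum_congr rfl fun l _ => by congr
  rw [hm]
  have hcard : ∀ (z : {z // z ∉ Z}) (S : Finset V), S ⊆ Z →
      (pairsBetween {z.1} S).card = S.card := by
    intro z S hS
    rw [card_pairsBetween (Finset.disjoint_singleton_left.2 fun h => z.2 (hS h)),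
      Finset.card_singleton, one_mul]
  have hone : ∀ z : {z // z ∉ Z}, (∑ j, (![1, 1, -1] : Fin 3 → ℝ) j *
      (1 - weightOf w P) ^ (F z j).card) = 1 - (1 - (1 - weightOf w P) ^ u) ^ 2 := by
    intro z
    rw [Fin.sum_univ_three]
    have e0 : (F z 0).card = u := (hcard z X hXZ).trans hX
    have e1 : (F z 1).card = u := (hcard z Y hYZ).trans hY
    have e2 : (F z 2).card = u + u := by
      refine (hcard z _ hXY').trans ?_
      rw [Finset.card_union_of_disjoint hXY, hX, hY]
    rw [e0, e1, e2]
    simp only [Matrix.cons_val_zero, Matrix.cons_val_one, Matrix.cons_val]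
    ring
  simp only [hone]
  rw [Finset.prod_const, Finset.card_univ, Fintype.card_subtype_compl]
  simp

theorem labelProb_exists_no_common_neighbor_le (hw : IsWeight w) (u r : ℕ)
    (hr : r ≤ Fintype.card V) :
    labelProb w (fun ω : Sym2 V → Λ => ∃ X Y Z : Finset V, u ≤ X.card ∧ u ≤ Y.card ∧
      Disjoint X Y ∧ X ⊆ Z ∧ Y ⊆ Z ∧ Z.card ≤ r ∧ ∀ z ∉ Z,
        (∀ x ∈ X, ¬ (labelGraph P ω).Adj z x) ∨ ∀ y ∈ Y, ¬ (labelGraph P ω).Adj z y) ≤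
    ((Fintype.card V).choose u : ℝ) * ((Fintype.card V).choose u : ℝ) *
      ((Fintype.card V).choose r : ℝ) *
      (1 - (1 - (1 - weightOf w P) ^ u) ^ 2) ^ (Fintype.card V - r) := by
  let S : Finset (Finset V × Finset V × Finset V) :=
    ((Finset.univ.powersetCard u) ×ˢ (Finset.univ.powersetCard u) ×ˢ
      (Finset.univ.powersetCard r)).filter
      fun q => Disjoint q.1 q.2.1 ∧ q.1 ⊆ q.2.2 ∧ q.2.1 ⊆ q.2.2
  have h01 : 0 ≤ 1 - weightOf w P ∧ 1 - weightOf w P ≤ 1 := by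
    refine ⟨?_, by linarith [weightOf_nonneg hw P]⟩
    rw [← weightOf_not hw]; exact weightOf_nonneg hw _
  have hp : 0 ≤ (1 - (1 - (1 - weightOf w P) ^ u) ^ 2) ^ (Fintype.card V - r) := by
    have h0 := pow_nonneg h01.1 u
    have h1 := pow_le_one₀ h01.1 h01.2 (n := u)
    refine pow_nonneg ?_ _
    nlinarith
  refine (labelProb_mono hw (Q := fun ω => ∃ q ∈ S,
    ∀ z ∉ q.2.2, (∀ x ∈ q.1, ¬ (labelGraph P ω).Adj z x) ∨
      ∀ y ∈ q.2.1, ¬ (labelGraph P ω).Adj z y) ?_).trans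
    ((labelProb_exists_le_card_mul hw S (fun q ω =>
    ∀ z ∉ q.2.2, (∀ x ∈ q.1, ¬ (labelGraph P ω).Adj z x) ∨
      ∀ y ∈ q.2.1, ¬ (labelGraph P ω).Adj z y) _ (fun q hq => ?_)).trans
        (mul_le_mul_of_nonneg_right ?_ hp))
  · rintro ω ⟨X, Y, Z, hX, hY, hXY, hXZ, hYZ, hZ, h⟩
    obtain ⟨X', hX', hXc⟩ := Finset.exists_subset_card_eq hX
    obtain ⟨Y', hY', hYc⟩ := Finset.exists_subset_card_eq hY
    obtain ⟨Z', hZ', -, hZc⟩ := Finset.exists_subsuperset_card_eq (Finset.subset_univ Z) hZ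
      (by rwa [Finset.card_univ])
    refine ⟨(X', Y', Z'), ?_, fun z hz => ?_⟩
    · simp only [S, Finset.mem_filter, Finset.mem_product, Finset.mem_powersetCard,
        Finset.subset_univ, true_and]
      exact ⟨⟨hXc, hYc, hZc⟩,
        Finset.disjoint_of_subset_left hX' (Finset.disjoint_of_subset_right hY' hXY),
        (hX'.trans hXZ).trans hZ', (hY'.trans hYZ).trans hZ'⟩
    · rcases h z (fun hz' => hz (hZ' hz')) with h | h
      · exact Or.inl fun x hx => h x (hX' hx)
      · exact Or.inr fun y hy => h y (hY' hy)
  · simp only [S, Finset.mem_filter, Finset.mem_product, Finset.mem_powersetCard,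
      Finset.subset_univ, true_and] at hq
    rw [labelProb_no_common_neighbor hw hq.2.1 hq.2.2.1 hq.2.2.2 hq.1.1 hq.1.2.1, hq.1.2.2]
  · have := Finset.card_filter_le ((Finset.univ.powersetCard u) ×ˢ
      (Finset.univ.powersetCard u) ×ˢ (Finset.univ.powersetCard r))
      fun q : Finset V × Finset V × Finset V =>
        Disjoint q.1 q.2.1 ∧ q.1 ⊆ q.2.2 ∧ q.2.1 ⊆ q.2.2
    rw [Finset.card_product, Finset.card_product, Finset.card_powersetCard,
      Finset.card_powersetCard, Finset.card_univ, ← mul_assoc] at this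
    exact_mod_cast this

/-- A set of minimum degree at least `2 * K` in the graph it induces spans many edges. -/
theorem mul_card_le_card_edges {V : Type*} {G : SimpleGraph V} {H : Finset V} {K : ℕ}
    (h : ∀ v ∈ H, 2 * K ≤ (neighborsIn G H v).card) :
    K * H.card ≤ (H.sym2.filter fun e => e ∈ G.edgeSet).card := by
  have h1 : H.card * (2 * K) ≤ ∑ v ∈ H, (neighborsIn G H v).card := by
    rw [← smul_eq_mul]
    exact Finset.card_nsmul_le_sum _ _ _ h
  rw [← Finset.card_sigma] at h1
  have h2 := Finset.card_le_mul_card_image_of_maps_to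
    (s := H.sigma (neighborsIn G H)) (t := H.sym2.filter fun e => e ∈ G.edgeSet)
    (f := fun q => s(q.1, q.2)) (n := 2) (by
      rintro ⟨v, x⟩ hq
      simp only [Finset.mem_sigma, mem_neighborsIn] at hq
      simp only [Finset.mem_filter, Finset.mk_mem_sym2_iff, SimpleGraph.mem_edgeSet]
      exact ⟨⟨hq.1, hq.2.1⟩, hq.2.2⟩) (by
      intro e _
      induction e with
      | h a b =>
      refine (Finset.card_le_card (t := {⟨a, b⟩, ⟨b, a⟩}) ?_).trans Finset.card_le_two
      rintro ⟨v, x⟩ hq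
      simp only [Finset.mem_filter, Sym2.eq_iff] at hq
      simp only [Finset.mem_insert, Finset.mem_singleton]
      rcases hq.2 with ⟨rfl, rfl⟩ | ⟨rfl, rfl⟩ <;> simp)
  have h3 : H.card * (2 * K) = 2 * (K * H.card) := by ring
  omega

theorem labelProb_exists_dense_le (hw : IsWeight w) (M K : ℕ) :
    labelProb w (fun ω : Sym2 V → Λ => ∃ H : Finset V, H.Nonempty ∧ H.card ≤ M ∧
      ∀ v ∈ H, 2 * K ≤ (neighborsIn (labelGraph P ω) H v).card) ≤
    ∑ h ∈ Finset.Icc 1 M, ((Fintype.card V).choose h : ℝ) *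
      (((h + 1).choose 2).choose (K * h) * weightOf w P ^ (K * h)) := by
  refine (labelProb_mono hw (Q := fun ω => ∃ h ∈ Finset.Icc 1 M,
    ∃ H ∈ Finset.univ.powersetCard h, ∃ F ∈ (H.sym2 : Finset (Sym2 V)).powersetCard (K * h),
      ∀ e ∈ F, P (ω e)) ?_).trans ?_
  · rintro ω ⟨H, hne, hM, hdeg⟩
    obtain ⟨F, hF, hFc⟩ := Finset.exists_subset_card_eq (mul_card_le_card_edges hdeg)
    refine ⟨H.card, Finset.mem_Icc.2 ⟨Finset.card_pos.2 hne, hM⟩, H, ?_, F, ?_, ?_⟩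
    · exact Finset.mem_powersetCard.2 ⟨Finset.subset_univ _, rfl⟩
    · exact Finset.mem_powersetCard.2 ⟨hF.trans (Finset.filter_subset _ _), hFc⟩
    · intro e he
      exact (mem_edgeSet_labelGraph.1 (Finset.mem_filter.1 (hF he)).2).2
  · refine (labelProb_exists_le hw _ _).trans (Finset.sum_le_sum fun h _ => ?_)
    refine (labelProb_exists_le_card_mul hw _ _
      ((((h + 1).choose 2).choose (K * h) : ℝ) * weightOf w P ^ (K * h)) fun H hH => ?_).trans ?_
    · refine (labelProb_exists_le_card_mul hw _ _ (weightOf w P ^ (K * h)) fun F hF => ?_).trans ?_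
      · rw [labelProb_forall_mem hw, (Finset.mem_powersetCard.1 hF).2]
      · rw [Finset.card_powersetCard, Finset.card_sym2, (Finset.mem_powersetCard.1 hH).2]
    · rw [Finset.card_powersetCard, Finset.card_univ]

theorem labelProb_lt_codegree_le (hw : IsWeight w) (c : ℕ) {u v : V} (huv : u ≠ v) :
    labelProb w (fun ω : Sym2 V → Λ => c < (Finset.univ.filter fun x =>
      (labelGraph P ω).Adj u x ∧ (labelGraph P ω).Adj v x).card) ≤
    (Fintype.card V).choose (c + 1) * weightOf w P ^ (2 * (c + 1)) := by
  let S : Finset (Finset V) := (Finset.univ.powersetCard (c + 1)).filter fun Z => Disjoint {u, v} Z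
  refine (labelProb_mono hw (Q := fun ω => ∃ Z ∈ S, ∀ e ∈ pairsBetween {u, v} Z, P (ω e))
    ?_).trans ((labelProb_exists_le_card_mul hw S (fun Z ω => ∀ e ∈ pairsBetween {u, v} Z, P (ω e))
      (weightOf w P ^ (2 * (c + 1))) fun Z hZ => ?_).trans
      (mul_le_mul_of_nonneg_right ?_ (pow_nonneg (weightOf_nonneg hw P) _)))
  · intro ω hω
    obtain ⟨Z, hZ, hZc⟩ := Finset.exists_subset_card_eq (Nat.succ_le_of_lt hω)
    have hZ' : ∀ x ∈ Z, (labelGraph P ω).Adj u x ∧ (labelGraph P ω).Adj v x := fun x hx =>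
      (Finset.mem_filter.1 (hZ hx)).2
    refine ⟨Z, ?_, ?_⟩
    · simp only [S, Finset.mem_filter, Finset.mem_powersetCard, Finset.subset_univ, true_and]
      refine ⟨hZc, ?_⟩
      rw [Finset.disjoint_left]
      intro x hx hxZ
      rw [Finset.mem_insert, Finset.mem_singleton] at hx
      rcases hx with rfl | rfl
      · exact (hZ' _ hxZ).1.ne rfl
      · exact (hZ' _ hxZ).2.ne rfl
    · intro e he
      obtain ⟨x, hx, y, hy, rfl⟩ := mem_pairsBetween.1 he
      rw [Finset.mem_insert, Finset.mem_singleton] at hx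
      rcases hx with rfl | rfl
      · exact (hZ' _ hy).1.2
      · exact (hZ' _ hy).2.2
  · simp only [S, Finset.mem_filter, Finset.mem_powersetCard, Finset.subset_univ, true_and] at hZ
    rw [labelProb_forall_mem hw, card_pairsBetween hZ.2, hZ.1, Finset.card_pair huv]
  · have := Finset.card_filter_le (Finset.univ.powersetCard (c + 1))
      fun Z : Finset V => Disjoint {u, v} Z
    rw [Finset.card_powersetCard, Finset.card_univ] at this
    exact_mod_cast this

end

/-! ### Exposing neighbourhoods -/

section
open scoped Classical

variable {V Λ : Type*} [Fintype V] [Fintype Λ] {w : Λ → ℝ} {P : Λ → Prop}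

/-- The pairs of distinct elements of `X`. -/
noncomputable def pairsIn {V : Type*} (X : Finset V) : Finset (Sym2 V) :=
  X.sym2.filter fun e => ¬ e.IsDiag

theorem mk_mem_pairsIn {V : Type*} {X : Finset V} {x y : V} :
    s(x, y) ∈ pairsIn X ↔ x ∈ X ∧ y ∈ X ∧ x ≠ y := by
  simp [pairsIn, and_assoc]

theorem card_pairsIn {V : Type*} (X : Finset V) : (pairsIn X).card = X.card.choose 2 := by
  have h1 : (X.sym2.filter fun e => e.IsDiag) = X.image fun x => s(x, x) := by
    ext e
    induction e with
    | h x y =>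
    simp only [Finset.mem_filter, Finset.mk_mem_sym2_iff, Sym2.mk_isDiag_iff, Finset.mem_image,
      Sym2.eq_iff]
    constructor
    · rintro ⟨⟨hx, _⟩, rfl⟩; exact ⟨x, hx, by simp⟩
    · rintro ⟨a, ha, ⟨rfl, rfl⟩ | ⟨rfl, rfl⟩⟩ <;> exact ⟨⟨ha, ha⟩, rfl⟩
  have h2 : (X.sym2.filter fun e => e.IsDiag).card = X.card := by
    rw [h1, Finset.card_image_of_injective]
    intro x y h
    simpa using h
  have h3 := Finset.card_filter_add_card_filter_not (s := X.sym2) (fun e => e.IsDiag)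
  rw [Finset.card_sym2, Nat.choose_succ_succ, Nat.choose_one_right] at h3
  unfold pairsIn
  simp only [Nat.succ_eq_add_one, Nat.reduceAdd] at h3
  omega

theorem choose_two_add_le_card_pairsIn_union {V : Type*} (X Y : Finset V) {c : ℕ}
    (h : (X ∩ Y).card ≤ c) :
    X.card.choose 2 + Y.card.choose 2 ≤ (pairsIn X ∪ pairsIn Y).card + c.choose 2 := by
  have h1 := Finset.card_union_add_card_inter (pairsIn X) (pairsIn Y)
  have h2 : pairsIn X ∩ pairsIn Y = pairsIn (X ∩ Y) := by
    ext e
    induction e with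
    | h x y => simp only [Finset.mem_inter, mk_mem_pairsIn]; tauto
  rw [h2, card_pairsIn, card_pairsIn, card_pairsIn] at h1
  have h3 := Nat.choose_le_choose 2 h
  omega

/-- The number of triangles of `G` at `v` with two vertices in `W`. -/
noncomputable def trianglesIn {V : Type*} (G : SimpleGraph V) (W : Finset V) (v : V) : ℕ :=
  ((pairsIn (neighborsIn G W v)).filter fun e => e ∈ G.edgeSet).card

theorem trianglesIn_le_trianglesAt (G : SimpleGraph V) (W : Finset V) (v : V) :
    trianglesIn G W v ≤ trianglesAt G v := by
  refine Finset.card_le_card fun e he => ?_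
  induction e with
  | h x y =>
  simp only [Finset.mem_filter, mk_mem_pairsIn, mem_neighborsIn, Finset.mem_univ, true_and,
    Sym2.mem_iff, forall_eq_or_imp, forall_eq] at he ⊢
  tauto

theorem trianglesAt_eq_zero_of_trianglesIn {G : SimpleGraph V} {W : Finset V} {v : V}
    (h : trianglesIn G W v = 0) (hW : ∀ x, G.Adj v x → x ∈ W) : trianglesAt G v = 0 := by
  rw [trianglesAt, Finset.card_eq_zero, Finset.filter_eq_empty_iff]
  rw [trianglesIn, Finset.card_eq_zero, Finset.filter_eq_empty_iff] at h
  intro e _ he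
  induction e with
  | h x y =>
  simp only [SimpleGraph.mem_edgeSet, Sym2.mem_iff, forall_eq_or_imp, forall_eq] at he
  refine h (x := s(x, y)) ?_ he.1
  simp only [mk_mem_pairsIn, mem_neighborsIn]
  exact ⟨⟨hW _ he.2.1, he.2.1⟩, ⟨hW _ he.2.2, he.2.2⟩, he.1.ne⟩

theorem trianglesAt_eq_zero_iff {G : SimpleGraph V} {v : V} :
    trianglesAt G v = 0 ↔ ¬ ∃ x y, G.Adj v x ∧ G.Adj v y ∧ G.Adj x y := by
  rw [trianglesAt, Finset.card_eq_zero, Finset.filter_eq_empty_iff]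
  constructor
  · rintro h ⟨x, y, hx, hy, hxy⟩
    refine h (Finset.mem_univ s(x, y)) ⟨hxy, ?_⟩
    simp only [Sym2.mem_iff, forall_eq_or_imp, forall_eq]
    exact ⟨hx, hy⟩
  · intro h e _ he
    induction e with
    | h x y =>
    simp only [SimpleGraph.mem_edgeSet, Sym2.mem_iff, forall_eq_or_imp, forall_eq] at he
    exact h ⟨x, y, he.2.1, he.2.2, he.1⟩

/-- The expectation of `y ^ (d.choose 2)` for a binomial random variable `d` with parameters
`N` and `p`. -/
noncomputable def binomPairExp (N : ℕ) (p y : ℝ) : ℝ :=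
  ∑ d ∈ Finset.range (N + 1), (N.choose d : ℝ) * (p ^ d * (1 - p) ^ (N - d) * y ^ d.choose 2)

omit [Fintype V] in
theorem sum_powerset_eq_binomPairExp (W : Finset V) (p y : ℝ) :
    ∑ X ∈ W.powerset, p ^ X.card * (1 - p) ^ (W \ X).card * y ^ X.card.choose 2 =
      binomPairExp W.card p y := by
  have h := Finset.sum_powerset_apply_card
    (fun d => p ^ d * (1 - p) ^ (W.card - d) * y ^ d.choose 2) (x := W)
  rw [binomPairExp]
  simp only [nsmul_eq_mul] at h
  rw [← h]
  refine Finset.sum_congr rfl fun X hX => ?_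
  rw [Finset.card_sdiff_of_subset (Finset.mem_powerset.1 hX)]

theorem weightOf_eq_sum (hw : IsWeight w) (P : Λ → Prop) (z : ℝ) :
    (∑ l, w l * if P l then z else 1) = 1 - weightOf w P + weightOf w P * z := by
  rw [← weightOf_not hw, weightOf, weightOf, Finset.sum_mul, ← Finset.sum_add_distrib]
  refine Finset.sum_congr rfl fun l _ => ?_
  by_cases h : P l <;> simp [h]

omit [Fintype V] [Fintype Λ] in
/-- The neighbourhood of `u` in `W` is `X` when the labels of the pairs between `u` and `W` say
so. -/
theorem prod_pairsBetween_eq_ite {W X : Finset V} {u : V} (hu : u ∉ W) (hX : X ⊆ W)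
    (ω : Sym2 V → Λ) :
    (∏ e ∈ pairsBetween {u} X, if P (ω e) then (1 : ℝ) else 0) *
      (∏ e ∈ pairsBetween {u} (W \ X), if ¬ P (ω e) then (1 : ℝ) else 0) =
    if neighborsIn (labelGraph P ω) W u = X then 1 else 0 := by
  have hadj : ∀ x ∈ W, (labelGraph P ω).Adj u x ↔ P (ω s(u, x)) := by
    intro x hx
    exact ⟨fun h => h.2, fun h => ⟨fun hux => hu (hux ▸ hx), h⟩⟩
  have hiff : neighborsIn (labelGraph P ω) W u = X ↔
      (∀ e ∈ pairsBetween {u} X, P (ω e)) ∧ ∀ e ∈ pairsBetween {u} (W \ X), ¬ P (ω e) := by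
    constructor
    · rintro rfl
      constructor
      · intro e he
        obtain ⟨a, ha, x, hx, rfl⟩ := mem_pairsBetween.1 he
        rw [Finset.mem_singleton] at ha
        subst ha
        exact (mem_neighborsIn.1 hx).2.2
      · intro e he hP
        obtain ⟨a, ha, x, hx, rfl⟩ := mem_pairsBetween.1 he
        rw [Finset.mem_singleton] at ha
        subst ha
        rw [Finset.mem_sdiff, mem_neighborsIn] at hx
        exact hx.2 ⟨hx.1, (hadj x hx.1).2 hP⟩
    · rintro ⟨h1, h2⟩
      ext x
      rw [mem_neighborsIn]
      constructor
      · rintro ⟨hx, hux⟩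
        by_contra hxX
        exact h2 _ (mem_pairsBetween.2 ⟨u, Finset.mem_singleton_self _, x,
          Finset.mem_sdiff.2 ⟨hx, hxX⟩, rfl⟩) hux.2
      · intro hx
        exact ⟨hX hx, (hadj x (hX hx)).2 (h1 _ (mem_pairsBetween.2
          ⟨u, Finset.mem_singleton_self _, x, hx, rfl⟩))⟩
  rw [Finset.prod_boole, Finset.prod_boole]
  by_cases h : neighborsIn (labelGraph P ω) W u = X
  · rw [if_pos h, if_pos (hiff.1 h).1, if_pos (hiff.1 h).2, one_mul]
  · rw [if_neg h]
    by_cases h1 : ∀ e ∈ pairsBetween {u} X, P (ω e)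
    · rw [if_neg fun h2 => h (hiff.2 ⟨h1, h2⟩), mul_zero]
    · rw [if_neg h1, zero_mul]

/-- The probability that `u` has no triangle in `W` and no neighbour by the pairs in `A`. -/
theorem labelProb_trianglesIn_eq_zero (hw : IsWeight w) {u : V} {W : Finset V} (hu : u ∉ W)
    {A : Finset (Sym2 V)} (hA : ∀ e ∈ A, ∀ x ∈ W, x ∉ e) :
    labelProb w (fun ω : Sym2 V → Λ => trianglesIn (labelGraph P ω) W u = 0 ∧ ∀ e ∈ A, ¬ P (ω e)) =
      (1 - weightOf w P) ^ A.card * binomPairExp W.card (weightOf w P) (1 - weightOf w P) := by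
  have hm : (∑ l, w l * if ¬ P l then (1 : ℝ) else 0) = 1 - weightOf w P := by
    rw [← weightOf_not hw]
    unfold weightOf
    exact Finset.sum_congr rfl fun l _ => by congr
  have hm1 : (∑ l, w l * if P l then (1 : ℝ) else 0) = weightOf w P := rfl
  have hblock : ∀ X ∈ W.powerset, labelExp w (fun ω : Sym2 V → Λ =>
      (if neighborsIn (labelGraph P ω) W u = X then (1 : ℝ) else 0) *
        ((∏ e ∈ pairsIn X, if ¬ P (ω e) then (1 : ℝ) else 0) *
        ∏ e ∈ A, if ¬ P (ω e) then (1 : ℝ) else 0)) =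
      (1 - weightOf w P) ^ A.card * (weightOf w P ^ X.card * (1 - weightOf w P) ^ (W \ X).card *
        (1 - weightOf w P) ^ X.card.choose 2) := by
    intro X hX
    rw [Finset.mem_powerset] at hX
    let F : Fin 4 → Finset (Sym2 V) :=
      ![pairsBetween {u} X, pairsBetween {u} (W \ X), pairsIn X, A]
    have hmem : ∀ i x y, s(x, y) ∈ F i ↔
        (i = 0 ∧ (x = u ∧ y ∈ X ∨ y = u ∧ x ∈ X)) ∨
        (i = 1 ∧ (x = u ∧ y ∈ W \ X ∨ y = u ∧ x ∈ W \ X)) ∨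
        (i = 2 ∧ x ∈ X ∧ y ∈ X ∧ x ≠ y) ∨ (i = 3 ∧ s(x, y) ∈ A) := by
      intro i x y
      have hb : ∀ Y, s(x, y) ∈ pairsBetween {u} Y ↔ (x = u ∧ y ∈ Y ∨ y = u ∧ x ∈ Y) := by
        intro Y
        simp only [mem_pairsBetween, Finset.mem_singleton, exists_eq_left, Sym2.eq_iff]
        constructor
        · rintro ⟨a, ha, ⟨rfl, rfl⟩ | ⟨rfl, rfl⟩⟩
          · exact Or.inl ⟨rfl, ha⟩
          · exact Or.inr ⟨rfl, ha⟩
        · rintro (⟨rfl, h⟩ | ⟨rfl, h⟩)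
          · exact ⟨y, h, Or.inl ⟨rfl, rfl⟩⟩
          · exact ⟨x, h, Or.inr ⟨rfl, rfl⟩⟩
      fin_cases i <;> simp [F, hb, mk_mem_pairsIn]
    have hdisj : ∀ i j, i ≠ j → Disjoint (F i) (F j) := by
      intro i j hij
      rw [Finset.disjoint_left]
      intro e hi hj
      induction e with
      | h x y =>
      rw [hmem] at hi hj
      have hA' : s(x, y) ∈ A → x ∉ W ∧ y ∉ W := fun h =>
        ⟨fun hx => hA _ h x hx (by simp), fun hy => hA _ h y hy (by simp)⟩
      simp only [Finset.mem_sdiff] at hi hj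
      have hXW := fun x => @hX x
      grind
    have h := labelExp_prod_blocks hw F hdisj
      ![fun l => if P l then (1 : ℝ) else 0, fun l => if ¬ P l then (1 : ℝ) else 0,
        fun l => if ¬ P l then (1 : ℝ) else 0, fun l => if ¬ P l then (1 : ℝ) else 0]
    simp only [Fin.prod_univ_four, F, Matrix.cons_val_zero, Matrix.cons_val_one,
      Matrix.cons_val] at h
    simp only [prod_pairsBetween_eq_ite hu hX] at h
    rw [hm, hm1, card_pairsIn,
      card_pairsBetween (Finset.disjoint_singleton_left.2 fun h => hu (hX h)),
      card_pairsBetween (Finset.disjoint_singleton_left.2 fun h => hu (Finset.sdiff_subset h)),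
      Finset.card_singleton, one_mul, one_mul] at h
    simp only [mul_assoc] at h ⊢
    rw [h]
    ring
  rw [labelProb_eq, ← sum_powerset_eq_binomPairExp, Finset.mul_sum, ← Finset.sum_congr rfl hblock,
    ← labelExp_sum]
  congr 1
  funext ω
  rw [Finset.sum_eq_single (neighborsIn (labelGraph P ω) W u)]
  · rw [if_pos rfl, one_mul, Finset.prod_boole, Finset.prod_boole]
    have hiff : trianglesIn (labelGraph P ω) W u = 0 ↔
        ∀ e ∈ pairsIn (neighborsIn (labelGraph P ω) W u), ¬ P (ω e) := by
      rw [trianglesIn, Finset.card_eq_zero, Finset.filter_eq_empty_iff]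
      refine forall₂_congr fun e he => ?_
      rw [mem_edgeSet_labelGraph]
      have := (Finset.mem_filter.1 he).2
      tauto
    by_cases h1 : ∀ e ∈ pairsIn (neighborsIn (labelGraph P ω) W u), ¬ P (ω e)
    · rw [if_pos h1, one_mul]
      by_cases h2 : ∀ e ∈ A, ¬ P (ω e)
      · rw [if_pos h2, if_pos ⟨hiff.2 h1, h2⟩]
      · rw [if_neg h2, if_neg fun h => h2 h.2]
    · rw [if_neg h1, zero_mul, if_neg fun h => h1 (hiff.1 h.1)]
  · intro X _ hX
    rw [if_neg hX.symm, zero_mul]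
  · intro h
    exact absurd (Finset.mem_powerset.2 (Finset.filter_subset _ _)) h

/-- Two vertices with few triangles: given the neighbourhoods of `u` and `v` in `W`, the pairs
inside them are still independent, and few of the pairs lie inside both. The number of triangles
is controlled by its generating function at `z`. The labels in `A` are independent of all this. -/
theorem labelProb_few_triangles_le (hw : IsWeight w) {P' : Λ → Prop} {u v : V} (huv : u ≠ v)
    {W : Finset V} (hu : u ∉ W) (hv : v ∉ W) {A : Finset (Sym2 V)}
    (hA : ∀ e ∈ A, ∀ x ∈ W, x ∉ e) (k c : ℕ) {z : ℝ} (hz0 : 0 ≤ z) (hz1 : z ≤ 1)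
    (hp1 : weightOf w P < 1) :
    z ^ (2 * k) * labelProb w (fun ω : Sym2 V → Λ => trianglesIn (labelGraph P ω) W u ≤ k ∧
      trianglesIn (labelGraph P ω) W v ≤ k ∧
      (neighborsIn (labelGraph P ω) W u ∩ neighborsIn (labelGraph P ω) W v).card ≤ c ∧
      ∀ e ∈ A, P' (ω e)) ≤
    weightOf w P' ^ A.card * ((1 - weightOf w P + weightOf w P * z) ^ c.choose 2)⁻¹ *
      binomPairExp W.card (weightOf w P) (1 - weightOf w P + weightOf w P * z) ^ 2 := by
  set p := weightOf w P with hp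
  set y := 1 - p + p * z with hy
  have hp0 : 0 ≤ p := weightOf_nonneg hw P
  have hy0 : 0 < y := by rw [hy]; nlinarith
  have hy1 : y ≤ 1 := by rw [hy]; nlinarith
  have hq0 : 0 ≤ weightOf w P' := weightOf_nonneg hw P'
  have hm : (∑ l, w l * if ¬ P l then (1 : ℝ) else 0) = 1 - p := by
    rw [hp, ← weightOf_not hw]
    unfold weightOf
    exact Finset.sum_congr rfl fun l _ => by congr
  have hm1 : (∑ l, w l * if P l then (1 : ℝ) else 0) = p := rfl
  have hm2 : (∑ l, w l * if P' l then (1 : ℝ) else 0) = weightOf w P' := rfl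
  have hm3 : (∑ l, w l * if P l then z else 1) = y := weightOf_eq_sum hw P z
  set S := (W.powerset ×ˢ W.powerset).filter fun q => (q.1 ∩ q.2).card ≤ c with hS
  have hblock : ∀ q ∈ S, labelExp w (fun ω : Sym2 V → Λ =>
      (if neighborsIn (labelGraph P ω) W u = q.1 then (1 : ℝ) else 0) *
        ((if neighborsIn (labelGraph P ω) W v = q.2 then (1 : ℝ) else 0) *
        ((∏ e ∈ pairsIn q.1 ∪ pairsIn q.2, if P (ω e) then z else 1) *
        ∏ e ∈ A, if P' (ω e) then (1 : ℝ) else 0))) =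
      (p ^ q.1.card * (1 - p) ^ (W \ q.1).card) * (p ^ q.2.card * (1 - p) ^ (W \ q.2).card) *
        y ^ (pairsIn q.1 ∪ pairsIn q.2).card * weightOf w P' ^ A.card := by
    rintro ⟨X, Y⟩ hq
    simp only [hS, Finset.mem_filter, Finset.mem_product, Finset.mem_powerset] at hq
    obtain ⟨⟨hX, hY⟩, -⟩ := hq
    simp only
    let F : Fin 6 → Finset (Sym2 V) :=
      ![pairsBetween {u} X, pairsBetween {u} (W \ X), pairsBetween {v} Y, pairsBetween {v} (W \ Y),
        pairsIn X ∪ pairsIn Y, A]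
    have hmem : ∀ i x y, s(x, y) ∈ F i →
        (i = 0 ∧ (x = u ∧ y ∈ X ∨ y = u ∧ x ∈ X)) ∨
        (i = 1 ∧ (x = u ∧ y ∈ W \ X ∨ y = u ∧ x ∈ W \ X)) ∨
        (i = 2 ∧ (x = v ∧ y ∈ Y ∨ y = v ∧ x ∈ Y)) ∨
        (i = 3 ∧ (x = v ∧ y ∈ W \ Y ∨ y = v ∧ x ∈ W \ Y)) ∨
        (i = 4 ∧ x ∈ W ∧ y ∈ W) ∨ (i = 5 ∧ s(x, y) ∈ A) := by
      intro i x y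
      have hb : ∀ a Z, s(x, y) ∈ pairsBetween {a} Z ↔ (x = a ∧ y ∈ Z ∨ y = a ∧ x ∈ Z) := by
        intro a Y
        simp only [mem_pairsBetween, Finset.mem_singleton, exists_eq_left, Sym2.eq_iff]
        constructor
        · rintro ⟨a, ha, ⟨rfl, rfl⟩ | ⟨rfl, rfl⟩⟩
          · exact Or.inl ⟨rfl, ha⟩
          · exact Or.inr ⟨rfl, ha⟩
        · rintro (⟨rfl, h⟩ | ⟨rfl, h⟩)
          · exact ⟨y, h, Or.inl ⟨rfl, rfl⟩⟩
          · exact ⟨x, h, Or.inr ⟨rfl, rfl⟩⟩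
      have h4 : s(x, y) ∈ pairsIn X ∪ pairsIn Y → x ∈ W ∧ y ∈ W := by
        rw [Finset.mem_union, mk_mem_pairsIn, mk_mem_pairsIn]
        rintro (h | h)
        · exact ⟨hX h.1, hX h.2.1⟩
        · exact ⟨hY h.1, hY h.2.1⟩
      intro h
      fin_cases i
      · exact Or.inl ⟨rfl, (hb _ _).1 h⟩
      · exact Or.inr (Or.inl ⟨rfl, (hb _ _).1 h⟩)
      · exact Or.inr (Or.inr (Or.inl ⟨rfl, (hb _ _).1 h⟩))
      · exact Or.inr (Or.inr (Or.inr (Or.inl ⟨rfl, (hb _ _).1 h⟩)))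
      · exact Or.inr (Or.inr (Or.inr (Or.inr (Or.inl ⟨rfl, h4 h⟩))))
      · exact Or.inr (Or.inr (Or.inr (Or.inr (Or.inr ⟨rfl, h⟩))))
    have hdisj : ∀ i j, i ≠ j → Disjoint (F i) (F j) := by
      intro i j hij
      rw [Finset.disjoint_left]
      intro e hi hj
      induction e with
      | h x y =>
      have hi := hmem _ _ _ hi
      have hj := hmem _ _ _ hj
      have hA' : s(x, y) ∈ A → x ∉ W ∧ y ∉ W := fun h =>
        ⟨fun hx => hA _ h x hx (by simp), fun hy => hA _ h y hy (by simp)⟩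
      simp only [Finset.mem_sdiff] at hi hj
      have hXW := fun x => @hX x
      have hYW := fun x => @hY x
      clear hmem hS hm hm1 hm2 hm3
      grind
    have h := labelExp_prod_blocks hw F hdisj
      ![fun l => if P l then (1 : ℝ) else 0, fun l => if ¬ P l then (1 : ℝ) else 0,
        fun l => if P l then (1 : ℝ) else 0, fun l => if ¬ P l then (1 : ℝ) else 0,
        fun l => if P l then z else 1, fun l => if P' l then (1 : ℝ) else 0]
    simp only [Fin.prod_univ_six, F, Matrix.cons_val_zero, Matrix.cons_val_one,
      Matrix.cons_val] at h
    have hcard : ∀ a Z, a ∉ W → Z ⊆ W → (pairsBetween {a} Z).card = Z.card := by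
      intro a Z ha hZ
      rw [card_pairsBetween (Finset.disjoint_singleton_left.2 fun h => ha (hZ h)),
        Finset.card_singleton, one_mul]
    rw [hm, hm1, hm2, hm3, hcard u X hu hX, hcard v Y hv hY,
      hcard u (W \ X) hu Finset.sdiff_subset, hcard v (W \ Y) hv Finset.sdiff_subset] at h
    have hpw : ∀ ω : Sym2 V → Λ,
        (∏ e ∈ pairsBetween {u} X, if P (ω e) then (1 : ℝ) else 0) *
        (∏ e ∈ pairsBetween {u} (W \ X), if ¬ P (ω e) then (1 : ℝ) else 0) *
        (∏ e ∈ pairsBetween {v} Y, if P (ω e) then (1 : ℝ) else 0) *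
        (∏ e ∈ pairsBetween {v} (W \ Y), if ¬ P (ω e) then (1 : ℝ) else 0) *
        (∏ e ∈ pairsIn X ∪ pairsIn Y, if P (ω e) then z else 1) *
        (∏ e ∈ A, if P' (ω e) then (1 : ℝ) else 0) =
        (if neighborsIn (labelGraph P ω) W u = X then (1 : ℝ) else 0) *
        ((if neighborsIn (labelGraph P ω) W v = Y then (1 : ℝ) else 0) *
        ((∏ e ∈ pairsIn X ∪ pairsIn Y, if P (ω e) then z else 1) *
        ∏ e ∈ A, if P' (ω e) then (1 : ℝ) else 0)) := by
      intro ω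
      rw [← prod_pairsBetween_eq_ite hu hX, ← prod_pairsBetween_eq_ite hv hY]
      ring
    simp only [hpw] at h
    rw [h]
    ring
  have hprod_nonneg : ∀ (ω : Sym2 V → Λ) (q : Finset V × Finset V), 0 ≤
      (if neighborsIn (labelGraph P ω) W u = q.1 then (1 : ℝ) else 0) *
        ((if neighborsIn (labelGraph P ω) W v = q.2 then (1 : ℝ) else 0) *
        ((∏ e ∈ pairsIn q.1 ∪ pairsIn q.2, if P (ω e) then z else 1) *
        ∏ e ∈ A, if P' (ω e) then (1 : ℝ) else 0)) := by
    intro ω q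
    have h1 : 0 ≤ ∏ e ∈ pairsIn q.1 ∪ pairsIn q.2, if P (ω e) then z else 1 :=
      Finset.prod_nonneg fun e _ => by split_ifs <;> linarith
    have h2 : 0 ≤ ∏ e ∈ A, if P' (ω e) then (1 : ℝ) else 0 :=
      Finset.prod_nonneg fun e _ => by split_ifs <;> linarith
    have h3 : ∀ (Q : Prop) [Decidable Q], (0 : ℝ) ≤ if Q then 1 else 0 := fun Q _ => by
      split_ifs <;> norm_num
    exact mul_nonneg (h3 _) (mul_nonneg (h3 _) (mul_nonneg h1 h2))
  -- The event occurs for the actual neighbourhoods, where the number of edges is at most `2 * k`.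
  have hpoint : ∀ ω : Sym2 V → Λ, z ^ (2 * k) * (if trianglesIn (labelGraph P ω) W u ≤ k ∧
      trianglesIn (labelGraph P ω) W v ≤ k ∧
      (neighborsIn (labelGraph P ω) W u ∩ neighborsIn (labelGraph P ω) W v).card ≤ c ∧
      ∀ e ∈ A, P' (ω e) then (1 : ℝ) else 0) ≤ ∑ q ∈ S,
      (if neighborsIn (labelGraph P ω) W u = q.1 then (1 : ℝ) else 0) *
        ((if neighborsIn (labelGraph P ω) W v = q.2 then (1 : ℝ) else 0) *
        ((∏ e ∈ pairsIn q.1 ∪ pairsIn q.2, if P (ω e) then z else 1) *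
        ∏ e ∈ A, if P' (ω e) then (1 : ℝ) else 0)) := by
    intro ω
    by_cases hev : trianglesIn (labelGraph P ω) W u ≤ k ∧
      trianglesIn (labelGraph P ω) W v ≤ k ∧
      (neighborsIn (labelGraph P ω) W u ∩ neighborsIn (labelGraph P ω) W v).card ≤ c ∧
      ∀ e ∈ A, P' (ω e)
    · rw [if_pos hev, mul_one]
      have hmemS : (neighborsIn (labelGraph P ω) W u, neighborsIn (labelGraph P ω) W v) ∈ S := by
        simp only [hS, Finset.mem_filter, Finset.mem_product, Finset.mem_powerset]
        exact ⟨⟨Finset.filter_subset _ _, Finset.filter_subset _ _⟩, hev.2.2.1⟩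
      refine le_trans ?_ (Finset.single_le_sum (fun q _ => hprod_nonneg ω q) hmemS)
      simp only [if_true, one_mul]
      rw [Finset.prod_boole, if_pos hev.2.2.2, mul_one, Finset.prod_ite, Finset.prod_const_one,
        mul_one, Finset.prod_const]
      refine pow_le_pow_of_le_one hz0 hz1 ?_
      have hcnt : ∀ e ∈ (pairsIn (neighborsIn (labelGraph P ω) W u) ∪
          pairsIn (neighborsIn (labelGraph P ω) W v)), P (ω e) → e ∈ (labelGraph P ω).edgeSet := by
        intro e he hP
        rw [mem_edgeSet_labelGraph]
        refine ⟨?_, hP⟩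
        rcases Finset.mem_union.1 he with h | h
        · exact (Finset.mem_filter.1 h).2
        · exact (Finset.mem_filter.1 h).2
      have hsub : ((pairsIn (neighborsIn (labelGraph P ω) W u) ∪
          pairsIn (neighborsIn (labelGraph P ω) W v)).filter fun e => P (ω e)) ⊆
          ((pairsIn (neighborsIn (labelGraph P ω) W u)).filter
            fun e => e ∈ (labelGraph P ω).edgeSet) ∪
          ((pairsIn (neighborsIn (labelGraph P ω) W v)).filter
            fun e => e ∈ (labelGraph P ω).edgeSet) := by
        intro e he
        rw [Finset.mem_filter] at he
        have := hcnt e he.1 he.2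
        simp only [Finset.mem_union, Finset.mem_filter] at he ⊢
        tauto
      have h1 := (Finset.card_le_card hsub).trans (Finset.card_union_le _ _)
      have h2 := hev.1
      have h3 := hev.2.1
      unfold trianglesIn at h2 h3
      omega
    · rw [if_neg hev, mul_zero]
      exact Finset.sum_nonneg fun q _ => hprod_nonneg ω q
  rw [labelProb_eq, ← labelExp_const_mul]
  refine (labelExp_mono hw hpoint).trans ?_
  rw [labelExp_sum, Finset.sum_congr rfl hblock]
  have hterm : ∀ q ∈ S, (p ^ q.1.card * (1 - p) ^ (W \ q.1).card) *
      (p ^ q.2.card * (1 - p) ^ (W \ q.2).card) *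
        y ^ (pairsIn q.1 ∪ pairsIn q.2).card * weightOf w P' ^ A.card ≤
      weightOf w P' ^ A.card * (y ^ c.choose 2)⁻¹ *
        ((p ^ q.1.card * (1 - p) ^ (W \ q.1).card * y ^ q.1.card.choose 2) *
        (p ^ q.2.card * (1 - p) ^ (W \ q.2).card * y ^ q.2.card.choose 2)) := by
    intro q hq
    have hle := choose_two_add_le_card_pairsIn_union q.1 q.2 (Finset.mem_filter.1 hq).2
    have h1 : y ^ (pairsIn q.1 ∪ pairsIn q.2).card ≤
        (y ^ c.choose 2)⁻¹ * (y ^ q.1.card.choose 2 * y ^ q.2.card.choose 2) := by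
      rw [← pow_add, le_inv_mul_iff₀ (pow_pos hy0 _), ← pow_add]
      refine pow_le_pow_of_le_one hy0.le hy1 ?_
      omega
    have h1p : 0 ≤ 1 - p := by linarith
    have h2 : 0 ≤ (p ^ q.1.card * (1 - p) ^ (W \ q.1).card) *
      (p ^ q.2.card * (1 - p) ^ (W \ q.2).card) * weightOf w P' ^ A.card := by positivity
    calc _ = ((p ^ q.1.card * (1 - p) ^ (W \ q.1).card) *
          (p ^ q.2.card * (1 - p) ^ (W \ q.2).card) * weightOf w P' ^ A.card) *
          y ^ (pairsIn q.1 ∪ pairsIn q.2).card := by ring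
      _ ≤ _ := mul_le_mul_of_nonneg_left h1 h2
      _ = _ := by ring
  refine (Finset.sum_le_sum hterm).trans ?_
  rw [← Finset.mul_sum, sq, ← sum_powerset_eq_binomPairExp, Finset.sum_mul_sum,
    ← Finset.sum_product']
  have h1p : 0 ≤ 1 - p := by linarith
  refine mul_le_mul_of_nonneg_left ?_ (by positivity)
  refine Finset.sum_le_sum_of_subset_of_nonneg (Finset.filter_subset _ _) fun q _ _ => ?_
  positivity

end

/-! ### Poor vertices and uncovered vertices -/

section
open scoped Classical

theorem sum_binomial_mul_pow (N : ℕ) (p r : ℝ) :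
    ∑ d ∈ Finset.range (N + 1), (N.choose d : ℝ) * (p ^ d * (1 - p) ^ (N - d) * r ^ d) =
      (1 - p + p * r) ^ N := by
  rw [add_comm (1 - p), add_pow]
  refine Finset.sum_congr rfl fun d _ => ?_
  rw [mul_pow]
  ring

theorem binomPairExp_nonneg (N : ℕ) {p y : ℝ} (hp0 : 0 ≤ p) (hp1 : p ≤ 1) (hy : 0 ≤ y) :
    0 ≤ binomPairExp N p y := by
  have : 0 ≤ 1 - p := by linarith
  exact Finset.sum_nonneg fun d _ => by positivity

/-- Either the degree is below its mean by a factor `1 - ε`, which has exponentially small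
probability, or there are at least `m.choose 2` pairs. The first case is bounded by the
exponential moment at `(1 + ε)⁻¹`. -/
theorem binomPairExp_le {N m : ℕ} {p y ε : ℝ} (hp0 : 0 ≤ p) (hp1 : p ≤ 1) (hy0 : 0 ≤ y)
    (hy1 : y ≤ 1) (hε0 : 0 < ε) (hε1 : ε ≤ 1) (hm : (m : ℝ) ≤ (1 - ε) * (p * N)) :
    binomPairExp N p y ≤ Real.exp (-(p * N * ε ^ 3 / 2)) + y ^ m.choose 2 := by
  set r : ℝ := (1 + ε)⁻¹ with hr
  have hr0 : 0 < r := by positivity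
  have hr1 : r ≤ 1 := inv_le_one_of_one_le₀ (by linarith)
  have hpoint : ∀ d : ℕ, y ^ d.choose 2 ≤ (r ^ m)⁻¹ * r ^ d + y ^ m.choose 2 * 1 ^ d := by
    intro d
    rcases lt_or_ge d m with h | h
    · have h1 : 1 ≤ (r ^ m)⁻¹ * r ^ d := by
        rw [← div_eq_inv_mul, one_le_div (pow_pos hr0 _)]
        exact pow_le_pow_of_le_one hr0.le hr1 h.le
      have h2 : y ^ d.choose 2 ≤ 1 := pow_le_one₀ hy0 hy1
      have h3 : 0 ≤ y ^ m.choose 2 * 1 ^ d := by positivity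
      linarith
    · have h1 : y ^ d.choose 2 ≤ y ^ m.choose 2 :=
        pow_le_pow_of_le_one hy0 hy1 (Nat.choose_le_choose 2 h)
      have h2 : 0 ≤ (r ^ m)⁻¹ * r ^ d := by positivity
      rw [one_pow, mul_one]
      linarith
  have h1p : 0 ≤ 1 - p := by linarith
  have hle : binomPairExp N p y ≤ (r ^ m)⁻¹ * (1 - p + p * r) ^ N + y ^ m.choose 2 := by
    have e1 := sum_binomial_mul_pow N p r
    have e2 := sum_binomial_mul_pow N p 1
    rw [mul_one, sub_add_cancel, one_pow] at e2
    rw [← mul_one (y ^ m.choose 2), ← e1]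
    nth_rewrite 2 [← e2]
    rw [Finset.mul_sum, Finset.mul_sum, ← Finset.sum_add_distrib, binomPairExp]
    refine Finset.sum_le_sum fun d _ => ?_
    have h := mul_le_mul_of_nonneg_left (hpoint d)
      (show 0 ≤ (N.choose d : ℝ) * (p ^ d * (1 - p) ^ (N - d)) by positivity)
    calc _ = (N.choose d : ℝ) * (p ^ d * (1 - p) ^ (N - d)) * y ^ d.choose 2 := by ring
      _ ≤ _ := h
      _ = _ := by ring
  refine hle.trans (add_le_add_left ?_ _)
  have hrm : (r ^ m)⁻¹ ≤ Real.exp (ε * m) := by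
    rw [hr, inv_pow, inv_inv, mul_comm, Real.exp_nat_mul]
    refine pow_le_pow_left₀ (by linarith) ?_ _
    linarith [Real.add_one_le_exp ε]
  have hpr : (1 - p + p * r) ^ N ≤ Real.exp (-(p * (1 - r)) * N) := by
    rw [mul_comm _ (N : ℝ), Real.exp_nat_mul]
    refine pow_le_pow_left₀ (by nlinarith) ?_ _
    linarith [Real.add_one_le_exp (-(p * (1 - r)))]
  calc _ ≤ Real.exp (ε * m) * Real.exp (-(p * (1 - r)) * N) :=
        mul_le_mul hrm hpr (pow_nonneg (by nlinarith) _) (Real.exp_pos _).le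
    _ = Real.exp (ε * m + -(p * (1 - r)) * N) := (Real.exp_add _ _).symm
    _ ≤ _ := by
        rw [Real.exp_le_exp]
        have h1 : 1 - r = ε * r := by rw [hr]; field_simp; ring
        have h2 : ε * m ≤ ε * ((1 - ε) * (p * N)) := mul_le_mul_of_nonneg_left hm hε0.le
        have h3 : 1 / 2 ≤ r := by
          rw [hr, one_div]
          exact inv_anti₀ (by linarith) (by linarith)
        have h4 : 1 - ε - r = - (ε ^ 2 * r) := by rw [hr]; field_simp; ring
        have h5 : 0 ≤ p * N * ε ^ 3 := by positivity
        rw [h1]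
        calc _ ≤ ε * ((1 - ε) * (p * N)) + -(p * (ε * r)) * N := by linarith
          _ = p * N * ε * (1 - ε - r) := by ring
          _ = -(p * N * ε ^ 3 * r) := by rw [h4]; ring
          _ ≤ _ := by nlinarith

/-- The matching lower bound: with probability close to one the degree is at most `M`. -/
theorem le_binomPairExp {N M : ℕ} {p y ε : ℝ} (hp0 : 0 ≤ p) (hp1 : p ≤ 1) (hy0 : 0 ≤ y)
    (hy1 : y ≤ 1) (hε0 : 0 < ε) (hM : (1 + ε) ^ 2 * (p * N) ≤ M + 1) :
    y ^ M.choose 2 * (1 - Real.exp (-(ε ^ 2 * (p * N)))) ≤ binomPairExp N p y := by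
  set r : ℝ := 1 + ε with hr
  have hr1 : 1 ≤ r := by linarith
  have hr0 : 0 < r := by linarith
  have h1p : 0 ≤ 1 - p := by linarith
  have hpoint : ∀ d : ℕ, y ^ M.choose 2 * (1 ^ d - (r ^ (M + 1))⁻¹ * r ^ d) ≤ y ^ d.choose 2 := by
    intro d
    rw [one_pow, ← div_eq_inv_mul]
    rcases lt_or_ge M d with h | h
    · have h1 : 1 ≤ r ^ d / r ^ (M + 1) := by
        rw [one_le_div (pow_pos hr0 _)]
        exact pow_le_pow_right₀ hr1 h
      have h2 : 0 ≤ y ^ M.choose 2 := by positivity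
      have h3 : 0 ≤ y ^ d.choose 2 := by positivity
      nlinarith
    · have h1 : y ^ M.choose 2 ≤ y ^ d.choose 2 :=
        pow_le_pow_of_le_one hy0 hy1 (Nat.choose_le_choose 2 h)
      have h2 : 0 ≤ r ^ d / r ^ (M + 1) := by positivity
      have h3 : 0 ≤ y ^ M.choose 2 := by positivity
      nlinarith
  have hle : y ^ M.choose 2 * (1 - (r ^ (M + 1))⁻¹ * (1 - p + p * r) ^ N) ≤
      binomPairExp N p y := by
    have e1 := sum_binomial_mul_pow N p r
    have e2 := sum_binomial_mul_pow N p 1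
    rw [mul_one, sub_add_cancel, one_pow] at e2
    rw [← e1]
    nth_rewrite 1 [← e2]
    rw [Finset.mul_sum, ← Finset.sum_sub_distrib, Finset.mul_sum, binomPairExp]
    refine Finset.sum_le_sum fun d _ => ?_
    have h := mul_le_mul_of_nonneg_left (hpoint d)
      (show 0 ≤ (N.choose d : ℝ) * (p ^ d * (1 - p) ^ (N - d)) by positivity)
    calc _ = (N.choose d : ℝ) * (p ^ d * (1 - p) ^ (N - d)) *
          (y ^ M.choose 2 * (1 ^ d - (r ^ (M + 1))⁻¹ * r ^ d)) := by ring
      _ ≤ _ := h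
      _ = _ := by ring
  refine (mul_le_mul_of_nonneg_left ?_ (by positivity)).trans hle
  refine sub_le_sub_left ?_ _
  have hrM : (r ^ (M + 1))⁻¹ ≤ Real.exp (-(ε * r⁻¹) * ((M : ℝ) + 1)) := by
    rw [← inv_pow, mul_comm, ← Nat.cast_add_one, Real.exp_nat_mul]
    refine pow_le_pow_left₀ (by positivity) ?_ _
    have h1 : r⁻¹ = 1 - ε * r⁻¹ := by rw [hr]; field_simp; ring
    calc r⁻¹ = -(ε * r⁻¹) + 1 := by linarith
      _ ≤ _ := Real.add_one_le_exp _
  have hpr : (1 - p + p * r) ^ N ≤ Real.exp (p * ε * N) := by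
    rw [mul_comm _ (N : ℝ), Real.exp_nat_mul]
    refine pow_le_pow_left₀ (by nlinarith) ?_ _
    have := Real.add_one_le_exp (p * ε)
    rw [hr]
    linarith
  calc _ ≤ Real.exp (-(ε * r⁻¹) * ((M : ℝ) + 1)) * Real.exp (p * ε * N) :=
        mul_le_mul hrM hpr (pow_nonneg (by nlinarith) _) (Real.exp_pos _).le
    _ = Real.exp (-(ε * r⁻¹) * ((M : ℝ) + 1) + p * ε * N) := (Real.exp_add _ _).symm
    _ ≤ _ := by
        rw [Real.exp_le_exp]
        have h1 : ε * r⁻¹ * (r ^ 2 * (p * N)) ≤ ε * r⁻¹ * ((M : ℝ) + 1) :=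
          mul_le_mul_of_nonneg_left hM (by positivity)
        have h2 : ε * r⁻¹ * (r ^ 2 * (p * N)) = ε * r * (p * N) := by field_simp
        rw [h2, hr] at h1
        rw [hr]
        nlinarith

variable {V Λ : Type*} [Fintype V] [Fintype Λ] {w : Λ → ℝ} {P : Λ → Prop}

theorem card_univ_sdiff_pair {u v : V} (huv : u ≠ v) :
    (Finset.univ \ {u, v} : Finset V).card = Fintype.card V - 2 := by
  rw [Finset.card_sdiff_of_subset (Finset.subset_univ _), Finset.card_univ, Finset.card_pair huv]

theorem labelProb_trianglesAt_eq_zero_le (hw : IsWeight w) {u v : V} (huv : u ≠ v) :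
    labelProb w (fun ω : Sym2 V → Λ => trianglesAt (labelGraph P ω) u = 0) ≤
      binomPairExp (Fintype.card V - 2) (weightOf w P) (1 - weightOf w P) := by
  have h := labelProb_trianglesIn_eq_zero (P := P) hw (u := u) (W := Finset.univ \ {u, v})
    (by simp) (A := ∅) (by simp)
  rw [Finset.card_empty, pow_zero, one_mul, card_univ_sdiff_pair huv] at h
  rw [← h]
  refine labelProb_mono hw fun ω hω => ⟨?_, by simp⟩
  have := trianglesIn_le_trianglesAt (labelGraph P ω) (Finset.univ \ {u, v}) u
  omega

/-- If `u` and `v` are not adjacent, all triangles at `u` avoid `v`. -/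
theorem le_labelProb_trianglesAt_eq_zero (hw : IsWeight w) {u v : V} (huv : u ≠ v) :
    (1 - weightOf w P) * binomPairExp (Fintype.card V - 2) (weightOf w P) (1 - weightOf w P) ≤
      labelProb w (fun ω : Sym2 V → Λ => trianglesAt (labelGraph P ω) u = 0) := by
  have h := labelProb_trianglesIn_eq_zero (P := P) hw (u := u) (W := Finset.univ \ {u, v})
    (by simp) (A := {s(u, v)}) (by
      intro e he x hx
      rw [Finset.mem_singleton] at he
      subst he
      simpa using hx)
  rw [Finset.card_singleton, pow_one, card_univ_sdiff_pair huv] at h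
  rw [← h]
  refine labelProb_mono hw fun ω hω => ?_
  refine trianglesAt_eq_zero_of_trianglesIn hω.1 fun x hx => ?_
  simp only [Finset.mem_sdiff, Finset.mem_univ, true_and, Finset.mem_insert,
    Finset.mem_singleton, not_or]
  refine ⟨hx.ne', ?_⟩
  rintro rfl
  exact hω.2 _ (Finset.mem_singleton_self _) hx.2

theorem everyVertexInTriangle_iff {G : SimpleGraph V} :
    EveryVertexInTriangle G ↔ ∀ v, trianglesAt G v ≠ 0 := by
  refine forall_congr' fun v => ?_
  rw [Ne, trianglesAt_eq_zero_iff, not_not]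

theorem labelProb_not_everyVertexInTriangle_le [Nontrivial V] (hw : IsWeight w) :
    labelProb w (fun ω : Sym2 V → Λ => ¬ EveryVertexInTriangle (labelGraph P ω)) ≤
      Fintype.card V * binomPairExp (Fintype.card V - 2) (weightOf w P) (1 - weightOf w P) := by
  refine (labelProb_mono hw (Q := fun ω => ∃ v ∈ Finset.univ, trianglesAt (labelGraph P ω) v = 0)
    fun ω hω => ?_).trans ((labelProb_exists_le_card_mul hw Finset.univ _ _ fun v _ => ?_).trans
      (le_of_eq (by rw [Finset.card_univ])))
  · rw [everyVertexInTriangle_iff] at hω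
    push Not at hω
    obtain ⟨v, hv⟩ := hω
    exact ⟨v, Finset.mem_univ _, hv⟩
  · obtain ⟨x, hx⟩ := exists_ne v
    exact labelProb_trianglesAt_eq_zero_le hw hx.symm

/-- The number of common neighbours. -/
noncomputable def codegree {V : Type*} [Fintype V] (G : SimpleGraph V) (u v : V) : ℕ :=
  (Finset.univ.filter fun x => G.Adj u x ∧ G.Adj v x).card

theorem card_neighborsIn_inter_le {G : SimpleGraph V} {W : Finset V} {u v : V} :
    (neighborsIn G W u ∩ neighborsIn G W v).card ≤ codegree G u v := by
  refine Finset.card_le_card fun x hx => ?_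
  simp only [Finset.mem_inter, mem_neighborsIn, Finset.mem_filter, Finset.mem_univ,
    true_and] at hx ⊢
  exact ⟨hx.1.2, hx.2.2⟩

/-- The second moment bound for the number of vertices in no triangle. -/
theorem labelProb_everyVertexInTriangle_le [Nontrivial V] (hw : IsWeight w) (c : ℕ)
    (hp1 : weightOf w P < 1)
    (hq : 0 < binomPairExp (Fintype.card V - 2) (weightOf w P) (1 - weightOf w P)) :
    labelProb w (fun ω : Sym2 V → Λ => EveryVertexInTriangle (labelGraph P ω)) ≤
      (Fintype.card V * ((1 - weightOf w P) *
        binomPairExp (Fintype.card V - 2) (weightOf w P) (1 - weightOf w P)))⁻¹ +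
      (((1 - weightOf w P) ^ c.choose 2)⁻¹ +
        (Fintype.card V).choose (c + 1) * weightOf w P ^ (2 * (c + 1)) /
        binomPairExp (Fintype.card V - 2) (weightOf w P) (1 - weightOf w P) ^ 2) /
        (1 - weightOf w P) ^ 2 - 1 := by
  set p := weightOf w P with hp
  set q := binomPairExp (Fintype.card V - 2) p (1 - p) with hqdef
  set n : ℝ := (Fintype.card V : ℝ) with hn
  set κ := ((Fintype.card V).choose (c + 1) : ℝ) * p ^ (2 * (c + 1)) with hκ
  have hn0 : 0 < n := by rw [hn]; exact_mod_cast Fintype.card_pos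
  have h1p : 0 < 1 - p := by linarith
  have hp0 : 0 ≤ p := weightOf_nonneg hw P
  let I : V → (Sym2 V → Λ) → ℝ := fun u ω => if trianglesAt (labelGraph P ω) u = 0 then 1 else 0
  set m := ∑ u, labelExp w (I u) with hm
  have hIlow : ∀ u, (1 - p) * q ≤ labelExp w (I u) := by
    intro u
    obtain ⟨x, hx⟩ := exists_ne u
    have := le_labelProb_trianglesAt_eq_zero (P := P) hw hx.symm
    rwa [labelProb_eq] at this
  have hmlow : n * ((1 - p) * q) ≤ m := by
    have := Finset.card_nsmul_le_sum Finset.univ (fun u => labelExp w (I u)) _ fun u _ => hIlow u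
    rwa [nsmul_eq_mul, Finset.card_univ] at this
  have hμ0 : 0 < n * ((1 - p) * q) := by positivity
  have hm0 : 0 < m := hμ0.trans_le hmlow
  have hpair : ∀ u v, u ≠ v → labelExp w (fun ω => I u ω * I v ω) ≤
      ((1 - p) ^ c.choose 2)⁻¹ * q ^ 2 + κ := by
    intro u v huv
    have h1 : labelExp w (fun ω => I u ω * I v ω) = labelProb w (fun ω : Sym2 V → Λ =>
        trianglesAt (labelGraph P ω) u = 0 ∧ trianglesAt (labelGraph P ω) v = 0) := by
      rw [labelProb_eq]
      congr 1
      funext ω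
      simp only [I]
      split_ifs <;> simp_all
    rw [h1]
    have h2 := labelProb_few_triangles_le (P := P) (P' := P) hw huv
      (W := Finset.univ \ {u, v}) (by simp) (by simp) (A := ∅) (by simp) 0 c le_rfl
      zero_le_one hp1
    rw [mul_zero, pow_zero, one_mul, Finset.card_empty, pow_zero, one_mul, mul_zero, add_zero,
      card_univ_sdiff_pair huv] at h2
    have h3 := labelProb_lt_codegree_le (P := P) hw c huv
    refine (labelProb_mono hw fun ω hω => ?_).trans ((labelProb_or_le hw _ _).trans
      (add_le_add h2 h3))
    by_cases hc : codegree (labelGraph P ω) u v ≤ c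
    · left
      refine ⟨?_, ?_, card_neighborsIn_inter_le.trans hc, by simp⟩
      · exact (trianglesIn_le_trianglesAt _ _ _).trans hω.1.le
      · exact (trianglesIn_le_trianglesAt _ _ _).trans hω.2.le
    · right
      exact not_le.1 hc
  have hκ0 : 0 ≤ κ := by positivity
  set B := ((1 - p) ^ c.choose 2)⁻¹ * q ^ 2 + κ with hB
  have hB0 : 0 ≤ B := by positivity
  have hsq : labelExp w (fun ω => (∑ u, I u ω) ^ 2) ≤ m + n ^ 2 * B := by
    have e1 : ∀ ω : Sym2 V → Λ, (∑ u, I u ω) ^ 2 = ∑ u, ∑ v, I u ω * I v ω := by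
      intro ω; rw [sq, Finset.sum_mul_sum]
    simp only [e1]
    rw [labelExp_sum]
    have e2 : ∀ u, labelExp w (fun ω => ∑ v, I u ω * I v ω) ≤ labelExp w (I u) + n * B := by
      intro u
      rw [labelExp_sum, ← Finset.add_sum_erase _ _ (Finset.mem_univ u)]
      refine add_le_add (le_of_eq ?_) ?_
      · congr 1
        funext ω
        simp only [I]
        split_ifs <;> simp
      · refine (Finset.sum_le_card_nsmul _ _ B fun v hv => ?_).trans ?_
        · exact hpair u v (Finset.ne_of_mem_erase hv).symm
        · rw [nsmul_eq_mul]
          refine mul_le_mul_of_nonneg_right ?_ hB0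
          rw [hn]
          exact_mod_cast Finset.card_le_univ _
    refine (Finset.sum_le_sum fun u _ => e2 u).trans (le_of_eq ?_)
    rw [Finset.sum_add_distrib, Finset.sum_const, Finset.card_univ, nsmul_eq_mul, ← hn]
    ring
  -- Chebyshev's inequality: if all vertices are in triangles, `(∑ u, I u ω / m - 1) ^ 2 = 1`.
  have hcheb : labelProb w (fun ω : Sym2 V → Λ => EveryVertexInTriangle (labelGraph P ω)) ≤
      (m ^ 2)⁻¹ * (m + n ^ 2 * B) - 1 := by
    have e1 : labelExp w (fun ω => (m ^ 2)⁻¹ * (∑ u, I u ω) ^ 2 + (-2 * m⁻¹ * ∑ u, I u ω + 1)) =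
        (m ^ 2)⁻¹ * labelExp w (fun ω => (∑ u, I u ω) ^ 2) - 1 := by
      rw [labelExp_add, labelExp_add, labelExp_const_mul, labelExp_const_mul, labelExp_sum,
        labelExp_const hw, ← hm]
      field_simp
      ring
    refine le_trans ?_ (sub_le_sub_right (mul_le_mul_of_nonneg_left hsq (by positivity)) 1)
    rw [← e1]
    refine labelExp_mono hw fun ω => ?_
    have e2 : (m ^ 2)⁻¹ * (∑ u, I u ω) ^ 2 + (-2 * m⁻¹ * ∑ u, I u ω + 1) =
        (m⁻¹ * (∑ u, I u ω) - 1) ^ 2 := by field_simp; ring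
    split_ifs with h
    · have h := everyVertexInTriangle_iff.1 h
      have : ∑ u, I u ω = 0 := Finset.sum_eq_zero fun u _ => if_neg (h u)
      rw [this]
      norm_num
    · rw [e2]; positivity
  refine hcheb.trans (sub_le_sub_right ?_ 1)
  have e3 : (m ^ 2)⁻¹ * (m + n ^ 2 * B) = m⁻¹ + n ^ 2 * B / m ^ 2 := by field_simp
  rw [e3]
  refine add_le_add (inv_anti₀ hμ0 hmlow) ?_
  calc n ^ 2 * B / m ^ 2 ≤ n ^ 2 * B / (n * ((1 - p) * q)) ^ 2 := by gcongr
    _ = _ := by rw [hB]; field_simp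

/-- The probability that a given pair of vertices is poor and the labels in `A` satisfy `P'`. -/
theorem labelProb_poor_pair_le (hw : IsWeight w) {P' : Λ → Prop} {u v x : V} (huv : u ≠ v)
    (hux : u ≠ x) (hvx : v ≠ x) {A : Finset (Sym2 V)}
    (hA : ∀ e ∈ A, ∀ a ∈ e, a = u ∨ a = v ∨ a = x) (k c : ℕ) {z : ℝ} (hz0 : 0 < z) (hz1 : z ≤ 1)
    (hp1 : weightOf w P < 1) :
    labelProb w (fun ω : Sym2 V → Λ => trianglesAt (labelGraph P ω) u ≤ k ∧
      trianglesAt (labelGraph P ω) v ≤ k ∧ codegree (labelGraph P ω) u v ≤ c ∧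
      ∀ e ∈ A, P' (ω e)) ≤
    weightOf w P' ^ A.card * ((z ^ (2 * k))⁻¹ *
      ((1 - weightOf w P + weightOf w P * z) ^ c.choose 2)⁻¹ *
      binomPairExp (Fintype.card V - 3) (weightOf w P)
        (1 - weightOf w P + weightOf w P * z) ^ 2) := by
  have hW : (Finset.univ \ {u, v, x} : Finset V).card = Fintype.card V - 3 := by
    rw [Finset.card_sdiff_of_subset (Finset.subset_univ _), Finset.card_univ,
      Finset.card_eq_three.2 ⟨u, v, x, huv, hux, hvx, rfl⟩]
  have h := labelProb_few_triangles_le (P := P) (P' := P') hw huv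
    (W := Finset.univ \ {u, v, x}) (by simp) (by simp) (A := A) (by
      intro e he a ha hae
      simp only [Finset.mem_sdiff, Finset.mem_univ, true_and, Finset.mem_insert,
        Finset.mem_singleton] at ha
      exact ha (hA e he a hae)) k c hz0.le hz1 hp1
  rw [hW, ← le_inv_mul_iff₀ (pow_pos hz0 _)] at h
  refine (labelProb_mono hw fun ω hω => ?_).trans (h.trans (le_of_eq (by ring)))
  exact ⟨(trianglesIn_le_trianglesAt _ _ _).trans hω.1,
    (trianglesIn_le_trianglesAt _ _ _).trans hω.2.1,
    card_neighborsIn_inter_le.trans hω.2.2.1, hω.2.2.2⟩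

/-- The bound for the probability that the random pair of graphs fails to be good. -/
theorem labelProb_not_goodPair_le [Nontrivial V] {p p' : ℝ} (hw : IsWeight (nestedWeight p p'))
    (hn : 3 ≤ Fintype.card V) (s u c K : ℕ) (hs : 4 * s ≤ Fintype.card V) {z : ℝ} (hz0 : 0 < z)
    (hz1 : z ≤ 1) (hp1 : p < 1) :
    labelProb (nestedWeight p p') (fun ω : Sym2 V → Fin 3 =>
      ¬ GoodPair (lowerGraph ω) (upperGraph ω) s u c (2 * K)) ≤
    ((Fintype.card V).choose s : ℝ) * ((Fintype.card V).choose s : ℝ) * (1 - p) ^ (s * s) +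
    (((Fintype.card V).choose u : ℝ) * ((Fintype.card V).choose (Fintype.card V - 4 * s) : ℝ) *
      (1 - p) ^ (u * (Fintype.card V - 4 * s)) +
    (((Fintype.card V).choose u : ℝ) * ((Fintype.card V).choose u : ℝ) *
      ((Fintype.card V).choose (2 * s) : ℝ) *
      (1 - (1 - (1 - p) ^ u) ^ 2) ^ (Fintype.card V - 2 * s) +
    ((∑ h ∈ Finset.Icc 1 (3 * u), ((Fintype.card V).choose h : ℝ) *
      (((h + 1).choose 2).choose (K * h) * p ^ (K * h))) +
    ((Fintype.card V : ℝ) ^ 2 * ((Fintype.card V).choose (c + 1) * p ^ (2 * (c + 1))) +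
    (((Fintype.card V : ℝ) ^ 3 * p ^ 2 + (Fintype.card V : ℝ) ^ 2 * p') *
      ((z ^ (2 * (c * (2 * K))))⁻¹ * ((1 - p + p * z) ^ c.choose 2)⁻¹ *
      binomPairExp (Fintype.card V - 3) p (1 - p + p * z) ^ 2)))))) := by
  set w := nestedWeight p p' with hwdef
  have hpl : weightOf w (· = 0) = p := weightOf_nestedWeight_lower p p'
  have hpu : weightOf w (· ≠ 2) = p' := weightOf_nestedWeight_upper p p'
  have hp0 : 0 ≤ p := by rw [← hpl]; exact weightOf_nonneg hw _
  have hp'0 : 0 ≤ p' := by rw [← hpu]; exact weightOf_nonneg hw _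
  set n : ℝ := (Fintype.card V : ℝ) with hndef
  set R := (z ^ (2 * (c * (2 * K))))⁻¹ * ((1 - p + p * z) ^ c.choose 2)⁻¹ *
      binomPairExp (Fintype.card V - 3) p (1 - p + p * z) ^ 2 with hR
  have hy0 : 0 < 1 - p + p * z := by nlinarith
  have hR0 : 0 ≤ R := by
    have := binomPairExp_nonneg (Fintype.card V - 3) hp0 hp1.le hy0.le
    positivity
  have b1 := labelProb_exists_not_joined_le (V := V) (P := (· = 0)) hw s s
  have b2 := labelProb_exists_not_joined_le (V := V) (P := (· = 0)) hw u (Fintype.card V - 4 * s)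
  have b3 := labelProb_exists_no_common_neighbor_le (V := V) (P := (· = 0)) hw u (2 * s)
    (by omega)
  have b4 := labelProb_exists_dense_le (V := V) (P := (· = 0)) hw (3 * u) K
  rw [hpl] at b1 b2 b3 b4
  have b5 : labelProb w (fun ω : Sym2 V → Fin 3 => ∃ q ∈ Finset.univ.filter
      (fun q : V × V => q.1 ≠ q.2), c < codegree (lowerGraph ω) q.1 q.2) ≤
      n ^ 2 * ((Fintype.card V).choose (c + 1) * p ^ (2 * (c + 1))) := by
    refine (labelProb_exists_le_card_mul hw _ _ ((Fintype.card V).choose (c + 1) *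
      p ^ (2 * (c + 1))) ?_).trans (mul_le_mul_of_nonneg_right ?_ (by positivity))
    · rintro ⟨a, b⟩ hab
      have := labelProb_lt_codegree_le (P := (· = 0)) hw c (Finset.mem_filter.1 hab).2
      rwa [hpl] at this
    · have := Finset.card_filter_le Finset.univ (fun q : V × V => q.1 ≠ q.2)
      rw [Finset.card_univ, Fintype.card_prod] at this
      rw [hndef, sq]
      exact_mod_cast this
  have b6 : labelProb w (fun ω : Sym2 V → Fin 3 => ∃ q ∈ Finset.univ.filter
      (fun q : V × V × V => q.1 ≠ q.2.1 ∧ q.1 ≠ q.2.2 ∧ q.2.1 ≠ q.2.2),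
      trianglesAt (lowerGraph ω) q.1 ≤ c * (2 * K) ∧
      trianglesAt (lowerGraph ω) q.2.1 ≤ c * (2 * K) ∧ codegree (lowerGraph ω) q.1 q.2.1 ≤ c ∧
      ∀ e ∈ ({s(q.1, q.2.2), s(q.2.1, q.2.2)} : Finset (Sym2 V)), ω e = 0) ≤
      n ^ 3 * p ^ 2 * R := by
    rw [mul_assoc]
    refine (labelProb_exists_le_card_mul hw _ _ (p ^ 2 * R) ?_).trans
      (mul_le_mul_of_nonneg_right ?_ (by positivity))
    · rintro ⟨a, b, x⟩ hab
      obtain ⟨hab, hax, hbx⟩ := (Finset.mem_filter.1 hab).2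
      simp only at hab hax hbx
      have hc2 : ({s(a, x), s(b, x)} : Finset (Sym2 V)).card = 2 := by
        rw [Finset.card_pair]
        simp only [Ne, Sym2.eq_iff, not_or, not_and]
        exact ⟨fun h => absurd h hab, fun h => absurd h hax⟩
      have := labelProb_poor_pair_le (P := (· = 0)) (P' := (· = 0)) hw hab hax hbx
        (A := {s(a, x), s(b, x)}) (by
          intro e he y hy
          rw [Finset.mem_insert, Finset.mem_singleton] at he
          rcases he with rfl | rfl <;> rw [Sym2.mem_iff] at hy <;> tauto)
        (c * (2 * K)) c hz0 hz1 (by rwa [hpl])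
      rwa [hpl, hc2] at this
    · have := Finset.card_filter_le Finset.univ
        (fun q : V × V × V => q.1 ≠ q.2.1 ∧ q.1 ≠ q.2.2 ∧ q.2.1 ≠ q.2.2)
      rw [Finset.card_univ, Fintype.card_prod, Fintype.card_prod] at this
      have e : n ^ 3 = n * (n * n) := by ring
      rw [e, hndef]
      exact_mod_cast this
  have b7 : labelProb w (fun ω : Sym2 V → Fin 3 => ∃ q ∈ Finset.univ.filter
      (fun q : V × V => q.1 ≠ q.2),
      trianglesAt (lowerGraph ω) q.1 ≤ c * (2 * K) ∧
      trianglesAt (lowerGraph ω) q.2 ≤ c * (2 * K) ∧ codegree (lowerGraph ω) q.1 q.2 ≤ c ∧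
      ∀ e ∈ ({s(q.1, q.2)} : Finset (Sym2 V)), ω e ≠ 2) ≤
      n ^ 2 * p' * R := by
    rw [mul_assoc]
    refine (labelProb_exists_le_card_mul hw _ _ (p' * R) ?_).trans
      (mul_le_mul_of_nonneg_right ?_ (by positivity))
    · rintro ⟨a, b⟩ hab
      have hab := (Finset.mem_filter.1 hab).2
      simp only at hab
      obtain ⟨x, hx⟩ : ∃ x, x ∉ ({a, b} : Finset V) := by
        by_contra! h
        have h1 : (Finset.univ : Finset V) ⊆ {a, b} := fun x _ => h x
        have h2 := (Finset.card_le_card h1).trans Finset.card_le_two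
        rw [Finset.card_univ] at h2
        omega
      rw [Finset.mem_insert, Finset.mem_singleton, not_or] at hx
      have := labelProb_poor_pair_le (P := (· = 0)) (P' := (· ≠ 2)) hw hab (Ne.symm hx.1)
        (Ne.symm hx.2) (A := {s(a, b)}) (by
          intro e he y hy
          rw [Finset.mem_singleton] at he
          subst he
          rw [Sym2.mem_iff] at hy
          tauto)
        (c * (2 * K)) c hz0 hz1 (by rwa [hpl])
      rwa [hpl, hpu, Finset.card_singleton, pow_one] at this
    · have := Finset.card_filter_le Finset.univ (fun q : V × V => q.1 ≠ q.2)
      rw [Finset.card_univ, Fintype.card_prod] at this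
      rw [hndef, sq]
      exact_mod_cast this
  have hsum : (n ^ 3 * p ^ 2 + n ^ 2 * p') * R = n ^ 3 * p ^ 2 * R + n ^ 2 * p' * R := by ring
  rw [hsum]
  refine (labelProb_mono hw fun ω hω => ?_).trans
    ((labelProb_or_le hw _ _).trans (add_le_add b1 ((labelProb_or_le hw _ _).trans (add_le_add b2
    ((labelProb_or_le hw _ _).trans (add_le_add b3 ((labelProb_or_le hw _ _).trans (add_le_add b4
    ((labelProb_or_le hw _ _).trans (add_le_add b5 ((labelProb_or_le hw _ _).trans
    (add_le_add b6 b7))))))))))))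
  by_contra hcon
  simp only [not_or] at hcon
  obtain ⟨c1, c2, c3, c4, c5, c6, c7⟩ := hcon
  apply hω
  have hcod : ∀ v y : V, y ≠ v → codegree (lowerGraph ω) v y ≤ c := by
    intro v y hvy
    by_contra! hlt
    exact c5 ⟨(v, y), Finset.mem_filter.2 ⟨Finset.mem_univ _, hvy.symm⟩, hlt⟩
  refine ⟨?_, ?_, ?_, ?_, ?_, ?_, hcod⟩
  · intro X Y hX hY hXY
    by_contra! hno
    exact c1 ⟨X, Y, hX, hY, hXY, hno⟩
  · intro X Y hX hY hXY
    by_contra! hno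
    exact c2 ⟨X, Y, hX, by omega, hXY, hno⟩
  · intro X Y Z hX hY hXY hXZ hYZ hZ
    by_contra! hno
    refine c3 ⟨X, Y, Z, hX, hY, hXY, hXZ, hYZ, hZ, fun z hz => ?_⟩
    by_cases h : ∃ x ∈ X, (lowerGraph ω).Adj z x
    · exact Or.inr (hno z hz h)
    · left
      push Not at h
      exact h
  · intro H hH hHu
    by_contra! hno
    exact c4 ⟨H, hH, hHu.le, hno⟩
  · rintro a b x hab ha hb ⟨hax, hbx⟩
    refine c6 ⟨(a, b, x), Finset.mem_filter.2 ⟨Finset.mem_univ _, hab, hax.ne, hbx.ne⟩, ha, hb,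
      hcod a b hab.symm, ?_⟩
    intro e he
    rw [Finset.mem_insert, Finset.mem_singleton] at he
    rcases he with rfl | rfl
    · exact hax.2
    · exact hbx.2
  · intro a b ha hb hab
    refine c7 ⟨(a, b), Finset.mem_filter.2 ⟨Finset.mem_univ _, hab.ne⟩, ha, hb,
      hcod a b hab.ne', ?_⟩
    intro e he
    rw [Finset.mem_singleton] at he
    subst he
    exact hab.2

end

/-! ### Asymptotics -/

section

theorem eventually_mul_log_le_rpow (C : ℝ) {a : ℝ} (ha : 0 < a) :
    ∀ᶠ n : ℕ in atTop, C * Real.log n ≤ (n : ℝ) ^ a := by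
  have h := (isLittleO_log_rpow_atTop ha).bound (c := (|C| + 1)⁻¹) (by positivity)
  filter_upwards [tendsto_natCast_atTop_atTop.eventually h, eventually_ge_atTop 1] with n hn hn1
  have hn1' : (1 : ℝ) ≤ n := by exact_mod_cast hn1
  have hlog : 0 ≤ Real.log n := Real.log_nonneg hn1'
  rw [Real.norm_of_nonneg hlog, Real.norm_of_nonneg (by positivity), ← div_eq_inv_mul,
    le_div_iff₀ (by positivity)] at hn
  nlinarith [le_abs_self C]

theorem eventually_le_rpow (C : ℝ) {a : ℝ} (ha : 0 < a) :
    ∀ᶠ n : ℕ in atTop, C ≤ (n : ℝ) ^ a :=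
  ((tendsto_rpow_atTop ha).comp tendsto_natCast_atTop_atTop).eventually_ge_atTop C

/-- A quantity bounded by a negative power tends to zero. -/
theorem eventually_le_of_le_rpow {f : ℕ → ℝ} (C : ℝ) {a : ℝ} (ha : 0 < a)
    (h : ∀ᶠ n : ℕ in atTop, f n ≤ C * (n : ℝ) ^ (-a)) {ε : ℝ} (hε : 0 < ε) :
    ∀ᶠ n : ℕ in atTop, f n ≤ ε := by
  filter_upwards [h, eventually_le_rpow (C / ε) ha, eventually_gt_atTop 0] with n h1 h2 h3
  refine h1.trans ?_
  have hn : (0 : ℝ) < n := by exact_mod_cast h3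
  rw [Real.rpow_neg hn.le, ← div_eq_mul_inv, div_le_iff₀ (by positivity)]
  rw [div_le_iff₀ hε] at h2
  linarith

theorem choose_le_exp {n : ℕ} (hn : 0 < n) (k : ℕ) :
    (n.choose k : ℝ) ≤ Real.exp (k * Real.log n) := by
  have hn' : (0 : ℝ) < n := by exact_mod_cast hn
  rw [Real.exp_nat_mul, Real.exp_log hn']
  exact_mod_cast Nat.choose_le_pow n k

theorem one_sub_pow_le_exp {p : ℝ} (hp : p ≤ 1) (k : ℕ) :
    (1 - p) ^ k ≤ Real.exp (-(p * k)) := by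
  have h : -(p * k) = k * (-p) := by ring
  rw [h, Real.exp_nat_mul]
  refine pow_le_pow_left₀ (by linarith) ?_ _
  linarith [Real.add_one_le_exp (-p)]

/-- The density of the smaller random graph. At this density the expected number of vertices in
no triangle is a small positive power of `n`. The constant `37 / 20` lies between `5 / 3`, needed
for the poor vertices to be far apart, and `2`, where all vertices come to lie in triangles. -/
noncomputable def coverDensity (n : ℕ) : ℝ :=
  (37 / 20 * Real.log n) ^ (1 / 3 : ℝ) * (n : ℝ) ^ (-(2 / 3) : ℝ)

/-- The basic estimates for the density `p` of the smaller random graph. -/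
structure CoverDensity (n : ℕ) (p : ℝ) : Prop where
  pos : 0 < n
  cube : (n : ℝ) ^ 2 * p ^ 3 = 37 / 20 * Real.log n
  lower : (n : ℝ) ^ (-(2 / 3) : ℝ) ≤ p
  upper : p ≤ (n : ℝ) ^ (-(33 / 50) : ℝ)

theorem eventually_coverDensity : ∀ᶠ n : ℕ in atTop, CoverDensity n (coverDensity n) := by
  filter_upwards [eventually_mul_log_le_rpow (37 / 20) (a := 1 / 50) (by norm_num),
    eventually_gt_atTop 0,
    (Real.tendsto_log_atTop.comp tendsto_natCast_atTop_atTop).eventually_ge_atTop (1 : ℝ)]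
    with n h1 h2 h3
  have hn : (0 : ℝ) < n := by exact_mod_cast h2
  have h3 : 1 ≤ Real.log n := h3
  have hl : 0 ≤ 37 / 20 * Real.log n := by linarith
  refine ⟨h2, ?_, ?_, ?_⟩
  · rw [coverDensity, mul_pow, ← Real.rpow_natCast _ 3, ← Real.rpow_natCast _ 3,
      ← Real.rpow_natCast _ 2, ← Real.rpow_mul hl, ← Real.rpow_mul hn.le]
    norm_num
    rw [mul_left_comm, mul_inv_cancel₀ (by positivity), mul_one]
  · rw [coverDensity]
    have : 1 ≤ (37 / 20 * Real.log n) ^ (1 / 3 : ℝ) :=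
      Real.one_le_rpow (by linarith) (by norm_num)
    have h4 : 0 ≤ (n : ℝ) ^ (-(2 / 3) : ℝ) := by positivity
    nlinarith
  · rw [coverDensity]
    have h4 : (37 / 20 * Real.log n) ^ (1 / 3 : ℝ) ≤ (n : ℝ) ^ (1 / 150 : ℝ) := by
      refine (Real.rpow_le_rpow hl h1 (by norm_num)).trans (le_of_eq ?_)
      rw [← Real.rpow_mul hn.le]
      norm_num
    refine (mul_le_mul_of_nonneg_right h4 (by positivity)).trans (le_of_eq ?_)
    rw [← Real.rpow_add hn]
    norm_num

/-- The size of the sets that are joined by edges. The exponent exceeds `2 / 3`, so that this is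
much more than the inverse density times `log n`. -/
noncomputable def largeSize (n : ℕ) : ℕ := ⌈(n : ℝ) ^ (7 / 10 : ℝ)⌉₊

/-- The size of the sets that have common neighbours outside small sets. The exponent
exceeds `31 / 60`, so that the common neighbours outnumber the sets of size `largeSize n`, and is
below `2 / 3`, so that sets of this size are sparse. -/
noncomputable def moderateSize (n : ℕ) : ℕ := ⌈(n : ℝ) ^ (14 / 25 : ℝ)⌉₊

theorem natCeil_rpow_le {n : ℕ} (hn : 0 < n) {a : ℝ} (ha : 0 ≤ a) :
    (⌈(n : ℝ) ^ a⌉₊ : ℝ) ≤ 2 * (n : ℝ) ^ a := by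
  have hn1 : (1 : ℝ) ≤ n := by exact_mod_cast hn
  have h1 := Nat.ceil_lt_add_one (a := (n : ℝ) ^ a) (by positivity)
  have h2 := Real.one_le_rpow hn1 ha
  linarith

theorem moderateSize_le_largeSize {n : ℕ} (hn : 0 < n) : moderateSize n ≤ largeSize n := by
  have hn1 : (1 : ℝ) ≤ n := by exact_mod_cast hn
  exact Nat.ceil_le_ceil (Real.rpow_le_rpow_of_exponent_le hn1 (by norm_num))

theorem eventually_mul_largeSize_le (C : ℕ) : ∀ᶠ n : ℕ in atTop, C * largeSize n ≤ n := by
  filter_upwards [eventually_le_rpow (C * 2) (a := 3 / 10) (by norm_num), eventually_gt_atTop 0]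
    with n h1 h2
  have hn : (0 : ℝ) < n := by exact_mod_cast h2
  have h3 := natCeil_rpow_le h2 (a := 7 / 10) (by norm_num)
  have h4 : (n : ℝ) ^ (3 / 10 : ℝ) * (n : ℝ) ^ (7 / 10 : ℝ) = n := by
    rw [← Real.rpow_add hn]; norm_num
  have h5 : ((C * largeSize n : ℕ) : ℝ) ≤ n := by
    rw [← h4, Nat.cast_mul]
    calc (C : ℝ) * largeSize n ≤ C * (2 * (n : ℝ) ^ (7 / 10 : ℝ)) :=
          mul_le_mul_of_nonneg_left h3 (Nat.cast_nonneg _)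
      _ = C * 2 * (n : ℝ) ^ (7 / 10 : ℝ) := by ring
      _ ≤ _ := mul_le_mul_of_nonneg_right h1 (by positivity)
  exact_mod_cast h5

theorem eventually_joined_bound {ε : ℝ} (hε : 0 < ε) : ∀ᶠ n : ℕ in atTop, ∀ p, CoverDensity n p →
    (n.choose (largeSize n) : ℝ) * (n.choose (largeSize n) : ℝ) *
      (1 - p) ^ (largeSize n * largeSize n) ≤ ε := by
  filter_upwards [eventually_le_of_le_rpow 1 (a := 1) one_pos
      (f := fun n => (n : ℝ) ^ (-1 : ℝ)) (Eventually.of_forall fun n => by simp) hε,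
    eventually_mul_log_le_rpow 3 (a := 1 / 30) (by norm_num)] with n h1 h2 p hp
  refine le_trans ?_ h1
  have hn : (0 : ℝ) < n := by exact_mod_cast hp.pos
  have hn1 : (1 : ℝ) ≤ n := by exact_mod_cast hp.pos
  have hlog := Real.log_nonneg hn1
  have hp1 : p ≤ 1 := hp.upper.trans (Real.rpow_le_one_of_one_le_of_nonpos hn1 (by norm_num))
  have hs : (n : ℝ) ^ (7 / 10 : ℝ) ≤ largeSize n := Nat.le_ceil _
  have hs1 : (1 : ℝ) ≤ largeSize n := (Real.one_le_rpow hn1 (by norm_num)).trans hs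
  have hps : (n : ℝ) ^ (1 / 30 : ℝ) ≤ p * largeSize n := by
    have : (n : ℝ) ^ (1 / 30 : ℝ) = (n : ℝ) ^ (-(2 / 3) : ℝ) * (n : ℝ) ^ (7 / 10 : ℝ) := by
      rw [← Real.rpow_add hn]; norm_num
    rw [this]
    exact mul_le_mul hp.lower hs (by positivity) ((by positivity : (0 : ℝ) ≤ _).trans hp.lower)
  have hc := choose_le_exp hp.pos (largeSize n)
  have h3 := one_sub_pow_le_exp hp1 (largeSize n * largeSize n)
  have h1p : 0 ≤ 1 - p := by linarith
  calc _ ≤ Real.exp (largeSize n * Real.log n) * Real.exp (largeSize n * Real.log n) *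
        Real.exp (-(p * (largeSize n * largeSize n : ℕ))) := by gcongr
    _ = Real.exp (largeSize n * Real.log n + largeSize n * Real.log n -
        p * (largeSize n * largeSize n : ℕ)) := by
      rw [← Real.exp_add, ← Real.exp_add]; rfl
    _ ≤ Real.exp (Real.log n * (-1)) := by
      rw [Real.exp_le_exp]
      push_cast
      nlinarith
    _ = _ := by rw [Real.rpow_def_of_pos hn]

theorem eventually_expands_bound {ε : ℝ} (hε : 0 < ε) : ∀ᶠ n : ℕ in atTop, ∀ p, CoverDensity n p →
    (n.choose (moderateSize n) : ℝ) * (n.choose (n - 4 * largeSize n) : ℝ) *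
      (1 - p) ^ (moderateSize n * (n - 4 * largeSize n)) ≤ ε := by
  filter_upwards [eventually_le_of_le_rpow 1 (a := 1) one_pos
      (f := fun n => (n : ℝ) ^ (-1 : ℝ)) (Eventually.of_forall fun n => by simp) hε,
    eventually_mul_log_le_rpow 24 (a := 29 / 150) (by norm_num),
    eventually_mul_largeSize_le 8] with n h1 h2 h8 p hp
  refine le_trans ?_ h1
  have hn : (0 : ℝ) < n := by exact_mod_cast hp.pos
  have hn1 : (1 : ℝ) ≤ n := by exact_mod_cast hp.pos
  have hlog := Real.log_nonneg hn1
  have hp1 : p ≤ 1 := hp.upper.trans (Real.rpow_le_one_of_one_le_of_nonpos hn1 (by norm_num))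
  have hp0 : 0 ≤ p := (by positivity : (0 : ℝ) ≤ _).trans hp.lower
  have hs : (n : ℝ) ^ (7 / 10 : ℝ) ≤ largeSize n := Nat.le_ceil _
  have hs1 : (1 : ℝ) ≤ largeSize n := (Real.one_le_rpow hn1 (by norm_num)).trans hs
  have hs2 : (largeSize n : ℝ) ≤ 2 * (n : ℝ) ^ (7 / 10 : ℝ) :=
    natCeil_rpow_le hp.pos (by norm_num)
  have hu : (n : ℝ) ^ (14 / 25 : ℝ) ≤ moderateSize n := Nat.le_ceil _
  have hus : (moderateSize n : ℝ) ≤ largeSize n := by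
    exact_mod_cast moderateSize_le_largeSize hp.pos
  have hpu : (n : ℝ) ^ (29 / 150 : ℝ) * (n : ℝ) ^ (7 / 10 : ℝ) ≤ p * moderateSize n * n := by
    have : (n : ℝ) ^ (29 / 150 : ℝ) * (n : ℝ) ^ (7 / 10 : ℝ) =
        (n : ℝ) ^ (-(2 / 3) : ℝ) * (n : ℝ) ^ (14 / 25 : ℝ) * n := by
      rw [← Real.rpow_add hn, ← Real.rpow_add hn, ← Real.rpow_add_one hn.ne']; norm_num
    rw [this]
    exact mul_le_mul_of_nonneg_right (mul_le_mul hp.lower hu (by positivity) hp0) hn.le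
  have hsub : ((n - 4 * largeSize n : ℕ) : ℝ) = n - 4 * largeSize n := by
    rw [Nat.cast_sub (by omega)]; push_cast; ring
  have h8' : 8 * (largeSize n : ℝ) ≤ n := by exact_mod_cast h8
  have hc := choose_le_exp hp.pos (moderateSize n)
  have hc2 : (n.choose (n - 4 * largeSize n) : ℝ) ≤
      Real.exp ((4 * largeSize n : ℕ) * Real.log n) := by
    rw [Nat.choose_symm (by omega)]
    exact choose_le_exp hp.pos _
  have h3 := one_sub_pow_le_exp hp1 (moderateSize n * (n - 4 * largeSize n))
  have h1p : 0 ≤ 1 - p := by linarith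
  calc _ ≤ Real.exp (moderateSize n * Real.log n) * Real.exp ((4 * largeSize n : ℕ) * Real.log n) *
        Real.exp (-(p * (moderateSize n * (n - 4 * largeSize n) : ℕ))) := by gcongr
    _ = Real.exp (moderateSize n * Real.log n + (4 * largeSize n : ℕ) * Real.log n -
        p * (moderateSize n * (n - 4 * largeSize n) : ℕ)) := by
      rw [← Real.exp_add, ← Real.exp_add]; rfl
    _ ≤ Real.exp (Real.log n * (-1)) := by
      rw [Real.exp_le_exp, Nat.cast_mul (moderateSize n), hsub]
      push_cast
      have hpu0 : 0 ≤ p * moderateSize n := mul_nonneg hp0 (Nat.cast_nonneg _)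
      have e1 : p * moderateSize n * (n / 2) ≤ p * (moderateSize n * (n - 4 * largeSize n)) := by
        rw [← mul_assoc]
        exact mul_le_mul_of_nonneg_left (by linarith) hpu0
      have e2 : 24 * Real.log n * (n : ℝ) ^ (7 / 10 : ℝ) ≤ p * moderateSize n * n :=
        (mul_le_mul_of_nonneg_right h2 (by positivity)).trans hpu
      have e3 : largeSize n * Real.log n ≤ 2 * (n : ℝ) ^ (7 / 10 : ℝ) * Real.log n :=
        mul_le_mul_of_nonneg_right hs2 hlog
      have e4 : moderateSize n * Real.log n ≤ largeSize n * Real.log n :=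
        mul_le_mul_of_nonneg_right hus hlog
      have e5 : 1 * Real.log n ≤ largeSize n * Real.log n :=
        mul_le_mul_of_nonneg_right hs1 hlog
      linarith
    _ = _ := by rw [Real.rpow_def_of_pos hn]

theorem eventually_common_bound {ε : ℝ} (hε : 0 < ε) : ∀ᶠ n : ℕ in atTop, ∀ p, CoverDensity n p →
    (n.choose (moderateSize n) : ℝ) * (n.choose (moderateSize n) : ℝ) *
      (n.choose (2 * largeSize n) : ℝ) *
      (1 - (1 - (1 - p) ^ moderateSize n) ^ 2) ^ (n - 2 * largeSize n) ≤ ε := by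
  filter_upwards [eventually_le_of_le_rpow 1 (a := 1) one_pos
      (f := fun n => (n : ℝ) ^ (-1 : ℝ)) (Eventually.of_forall fun n => by simp) hε,
    eventually_mul_log_le_rpow 80 (a := 13 / 150) (by norm_num),
    eventually_le_rpow 2 (a := 1 / 10) (by norm_num),
    eventually_mul_largeSize_le 4] with n h1 h2 h10 h8 p hp
  refine le_trans ?_ h1
  have hn : (0 : ℝ) < n := by exact_mod_cast hp.pos
  have hn1 : (1 : ℝ) ≤ n := by exact_mod_cast hp.pos
  have hlog := Real.log_nonneg hn1
  have hp1 : p ≤ 1 := hp.upper.trans (Real.rpow_le_one_of_one_le_of_nonpos hn1 (by norm_num))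
  have hp0 : 0 ≤ p := (by positivity : (0 : ℝ) ≤ _).trans hp.lower
  have hs : (n : ℝ) ^ (7 / 10 : ℝ) ≤ largeSize n := Nat.le_ceil _
  have hs1 : (1 : ℝ) ≤ largeSize n := (Real.one_le_rpow hn1 (by norm_num)).trans hs
  have hs2 : (largeSize n : ℝ) ≤ 2 * (n : ℝ) ^ (7 / 10 : ℝ) :=
    natCeil_rpow_le hp.pos (by norm_num)
  have hu : (n : ℝ) ^ (14 / 25 : ℝ) ≤ moderateSize n := Nat.le_ceil _
  have hu2 : (moderateSize n : ℝ) ≤ 2 * (n : ℝ) ^ (14 / 25 : ℝ) :=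
    natCeil_rpow_le hp.pos (by norm_num)
  have hus : (moderateSize n : ℝ) ≤ largeSize n := by
    exact_mod_cast moderateSize_le_largeSize hp.pos
  have hpu : (n : ℝ) ^ (13 / 150 : ℝ) * (n : ℝ) ^ (7 / 10 : ℝ) ≤ (p * moderateSize n) ^ 2 * n := by
    have : (n : ℝ) ^ (13 / 150 : ℝ) * (n : ℝ) ^ (7 / 10 : ℝ) =
        ((n : ℝ) ^ (-(2 / 3) : ℝ) * (n : ℝ) ^ (14 / 25 : ℝ)) ^ 2 * n := by
      rw [← Real.rpow_add hn, ← Real.rpow_add hn, ← Real.rpow_natCast _ 2, ← Real.rpow_mul hn.le,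
        ← Real.rpow_add_one hn.ne']; norm_num
    rw [this]
    exact mul_le_mul_of_nonneg_right
      (pow_le_pow_left₀ (by positivity) (mul_le_mul hp.lower hu (by positivity) hp0) 2) hn.le
  have hpu1 : p * moderateSize n ≤ 1 := by
    have e1 : p * moderateSize n ≤
        (n : ℝ) ^ (-(33 / 50) : ℝ) * (2 * (n : ℝ) ^ (14 / 25 : ℝ)) :=
      mul_le_mul hp.upper hu2 (Nat.cast_nonneg _) (by positivity)
    have e2 : (n : ℝ) ^ (-(33 / 50) : ℝ) * (2 * (n : ℝ) ^ (14 / 25 : ℝ)) =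
        2 / (n : ℝ) ^ (1 / 10 : ℝ) := by
      rw [mul_left_comm, ← Real.rpow_add hn, div_eq_mul_inv (2 : ℝ), ← Real.rpow_neg hn.le (1 / 10)]
      norm_num
    rw [e2] at e1
    exact e1.trans ((div_le_one (by positivity)).2 h10)
  have hpu0 : 0 ≤ p * moderateSize n := mul_nonneg hp0 (Nat.cast_nonneg _)
  -- `1 - exp (-x) ≥ x / 2` on the unit interval.
  have hq : p * moderateSize n / 2 ≤ 1 - (1 - p) ^ moderateSize n := by
    have e1 := one_sub_pow_le_exp hp1 (moderateSize n)
    have e2 : Real.exp (-(p * moderateSize n)) * (1 + p * moderateSize n) ≤ 1 := by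
      rw [Real.exp_neg, inv_mul_le_iff₀ (Real.exp_pos _), mul_one]
      linarith [Real.add_one_le_exp (p * moderateSize n)]
    have e3 := Real.exp_pos (-(p * moderateSize n))
    nlinarith
  set q := 1 - (1 - p) ^ moderateSize n with hqdef
  have h1p : 0 ≤ 1 - p := by linarith
  have hq1 : q ≤ 1 := by
    have : 0 ≤ (1 - p) ^ moderateSize n := pow_nonneg h1p _
    linarith
  have hq0 : 0 ≤ q := le_trans (by positivity) hq
  have hqsq : (p * moderateSize n) ^ 2 / 4 ≤ q ^ 2 := by
    have := pow_le_pow_left₀ (by positivity) hq 2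
    calc _ = (p * moderateSize n / 2) ^ 2 := by ring
      _ ≤ _ := this
  have hq2 : q ^ 2 ≤ 1 := pow_le_one₀ hq0 hq1
  have h1q : 0 ≤ 1 - q ^ 2 := by linarith
  have hsub : ((n - 2 * largeSize n : ℕ) : ℝ) = n - 2 * largeSize n := by
    rw [Nat.cast_sub (by omega)]; push_cast; ring
  have h8' : 4 * (largeSize n : ℝ) ≤ n := by exact_mod_cast h8
  have hc := choose_le_exp hp.pos (moderateSize n)
  have hc2 := choose_le_exp hp.pos (2 * largeSize n)
  have h3 := one_sub_pow_le_exp hq2 (n - 2 * largeSize n)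
  calc _ ≤ Real.exp (moderateSize n * Real.log n) * Real.exp (moderateSize n * Real.log n) *
        Real.exp ((2 * largeSize n : ℕ) * Real.log n) *
        Real.exp (-(q ^ 2 * (n - 2 * largeSize n : ℕ))) := by gcongr
    _ = Real.exp (moderateSize n * Real.log n + moderateSize n * Real.log n +
        (2 * largeSize n : ℕ) * Real.log n - q ^ 2 * (n - 2 * largeSize n : ℕ)) := by
      rw [← Real.exp_add, ← Real.exp_add, ← Real.exp_add]; rfl
    _ ≤ Real.exp (Real.log n * (-1)) := by
      rw [Real.exp_le_exp, hsub]
      push_cast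
      have e1 : (p * moderateSize n) ^ 2 / 4 * (n / 2) ≤ q ^ 2 * (n - 2 * largeSize n) :=
        mul_le_mul hqsq (by linarith) (by linarith) (by positivity)
      have e2 : 80 * Real.log n * (n : ℝ) ^ (7 / 10 : ℝ) ≤ (p * moderateSize n) ^ 2 * n :=
        (mul_le_mul_of_nonneg_right h2 (by positivity)).trans hpu
      have e3 : largeSize n * Real.log n ≤ 2 * (n : ℝ) ^ (7 / 10 : ℝ) * Real.log n :=
        mul_le_mul_of_nonneg_right hs2 hlog
      have e4 : moderateSize n * Real.log n ≤ largeSize n * Real.log n :=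
        mul_le_mul_of_nonneg_right hus hlog
      have e5 : 1 * Real.log n ≤ largeSize n * Real.log n :=
        mul_le_mul_of_nonneg_right hs1 hlog
      linarith
    _ = _ := by rw [Real.rpow_def_of_pos hn]

/-- Bound for the number of ways to choose `K * h` unordered pairs in a set of size `h`, where the
two elements of a pair may be equal. -/
theorem choose_pairs_le {h K : ℕ} (hh : 1 ≤ h) (hK : 3 ≤ K) :
    (((h + 1).choose 2).choose (K * h) : ℝ) ≤ (h : ℝ) ^ (K * h) := by
  have h1 : (h + 1).choose 2 ≤ h ^ 2 := by
    rw [Nat.choose_two_right, Nat.add_sub_cancel]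
    refine Nat.div_le_of_le_mul ?_
    nlinarith
  have h2 : (((h + 1).choose 2).choose (K * h) : ℝ) ≤
      ((h : ℝ) ^ 2) ^ (K * h) / (K * h).factorial := by
    refine (Nat.choose_le_pow_div (K * h) ((h + 1).choose 2) (α := ℝ)).trans ?_
    have : (((h + 1).choose 2 : ℕ) : ℝ) ≤ (h : ℝ) ^ 2 := by exact_mod_cast h1
    gcongr
  refine h2.trans ?_
  have h0 : (0 : ℝ) < h := by exact_mod_cast hh
  rw [div_le_iff₀ (by positivity), pow_right_comm, sq]
  refine mul_le_mul_of_nonneg_left ?_ (by positivity)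
  -- Compare with the term of index `K * h` of the series of `exp (K * h)`, using `exp 1 < 3`.
  have h3 := Real.pow_div_factorial_le_exp ((K * h : ℕ) : ℝ) (Nat.cast_nonneg _) (K * h)
  have h4 : Real.exp ((K * h : ℕ) : ℝ) ≤ (3 : ℝ) ^ (K * h) := by
    rw [← mul_one ((K * h : ℕ) : ℝ), Real.exp_nat_mul]
    exact pow_le_pow_left₀ (Real.exp_pos _).le (Real.exp_one_lt_three.le) _
  have h5 : (3 * (h : ℝ)) ^ (K * h) ≤ ((K * h : ℕ) : ℝ) ^ (K * h) := by
    refine pow_le_pow_left₀ (by positivity) ?_ _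
    push_cast
    have : (3 : ℝ) ≤ K := by exact_mod_cast hK
    gcongr
  rw [div_le_iff₀ (by positivity)] at h3
  rw [mul_pow] at h5
  have h6 : (3 : ℝ) ^ (K * h) * (h : ℝ) ^ (K * h) ≤ 3 ^ (K * h) * ((K * h).factorial : ℝ) :=
    h5.trans (h3.trans (mul_le_mul_of_nonneg_right h4 (by positivity)))
  exact le_of_mul_le_mul_left h6 (by positivity)

theorem eventually_sparse_bound {ε : ℝ} (hε : 0 < ε) : ∀ᶠ n : ℕ in atTop, ∀ p, CoverDensity n p →
    ∑ h ∈ Finset.Icc 1 (3 * moderateSize n), (n.choose h : ℝ) *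
      (((h + 1).choose 2).choose (20 * h) * p ^ (20 * h)) ≤ ε := by
  filter_upwards [eventually_le_of_le_rpow (6 * 6 ^ 20) (a := 11 / 25) (by norm_num)
      (f := fun n => 6 * 6 ^ 20 * (n : ℝ) ^ (-(11 / 25) : ℝ)) (Eventually.of_forall fun n => le_rfl)
      hε,
    eventually_le_rpow (6 ^ 20) (a := 1) (by norm_num)] with n h1 h2 p hp
  refine le_trans ?_ h1
  have hn : (0 : ℝ) < n := by exact_mod_cast hp.pos
  have hp0 : 0 ≤ p := (by positivity : (0 : ℝ) ≤ _).trans hp.lower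
  have hu2 : (moderateSize n : ℝ) ≤ 2 * (n : ℝ) ^ (14 / 25 : ℝ) :=
    natCeil_rpow_le hp.pos (by norm_num)
  set x := (n : ℝ) * (3 * moderateSize n * p) ^ 20 with hx
  have hx0 : 0 ≤ x := by positivity
  have hx1 : x ≤ 6 ^ 20 * (n : ℝ) ^ (-1 : ℝ) := by
    have e1 : 3 * moderateSize n * p ≤ 6 * (n : ℝ) ^ (-(1 / 10) : ℝ) := by
      calc 3 * moderateSize n * p ≤ 3 * (2 * (n : ℝ) ^ (14 / 25 : ℝ)) *
            (n : ℝ) ^ (-(33 / 50) : ℝ) :=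
            mul_le_mul (by linarith) hp.upper hp0 (by positivity)
        _ = 6 * ((n : ℝ) ^ (14 / 25 : ℝ) * (n : ℝ) ^ (-(33 / 50) : ℝ)) := by ring
        _ = _ := by rw [← Real.rpow_add hn]; norm_num
    calc x ≤ n * (6 * (n : ℝ) ^ (-(1 / 10) : ℝ)) ^ 20 := by rw [hx]; gcongr
      _ = 6 ^ 20 * ((n : ℝ) ^ (-(1 / 10) * (20 : ℕ) : ℝ) * n) := by
          rw [mul_pow, ← Real.rpow_natCast ((n : ℝ) ^ (-(1 / 10) : ℝ)) 20, ← Real.rpow_mul hn.le]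
          ring
      _ = _ := by rw [← Real.rpow_add_one hn.ne']; norm_num
  have hxle1 : x ≤ 1 := by
    refine hx1.trans ?_
    rw [Real.rpow_neg hn.le, ← div_eq_mul_inv, div_le_one (by positivity)]
    exact h2
  have hterm : ∀ h ∈ Finset.Icc 1 (3 * moderateSize n), (n.choose h : ℝ) *
      (((h + 1).choose 2).choose (20 * h) * p ^ (20 * h)) ≤ x := by
    intro h hh
    rw [Finset.mem_Icc] at hh
    have e1 : (n.choose h : ℝ) ≤ (n : ℝ) ^ h := by exact_mod_cast Nat.choose_le_pow n h
    have e2 := choose_pairs_le (K := 20) hh.1 (by norm_num)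
    have e3 : (h : ℝ) ≤ 3 * moderateSize n := by exact_mod_cast hh.2
    calc _ ≤ (n : ℝ) ^ h * ((h : ℝ) ^ (20 * h) * p ^ (20 * h)) := by gcongr
      _ = (n * (h * p) ^ 20) ^ h := by rw [mul_pow, ← pow_mul, mul_pow]
      _ ≤ x ^ h := by rw [hx]; gcongr
      _ ≤ x := pow_le_of_le_one hx0 hxle1 (by omega)
  refine (Finset.sum_le_card_nsmul _ _ _ hterm).trans ?_
  rw [Nat.card_Icc, nsmul_eq_mul, Nat.add_sub_cancel]
  push_cast
  calc 3 * (moderateSize n : ℝ) * x ≤ 3 * (2 * (n : ℝ) ^ (14 / 25 : ℝ)) *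
        (6 ^ 20 * (n : ℝ) ^ (-1 : ℝ)) := by gcongr
    _ = 6 * 6 ^ 20 * ((n : ℝ) ^ (14 / 25 : ℝ) * (n : ℝ) ^ (-1 : ℝ)) := by ring
    _ = _ := by rw [← Real.rpow_add hn]; norm_num

/-- The probability that a given pair has seven common neighbours. -/
theorem codegree_bound {n : ℕ} {p : ℝ} (hp : CoverDensity n p) :
    (n.choose (6 + 1) : ℝ) * p ^ (2 * (6 + 1)) ≤ (n : ℝ) ^ (-(56 / 25) : ℝ) := by
  have hn : (0 : ℝ) < n := by exact_mod_cast hp.pos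
  have hp0 : 0 ≤ p := (by positivity : (0 : ℝ) ≤ _).trans hp.lower
  have e1 : (n.choose (6 + 1) : ℝ) ≤ (n : ℝ) ^ 7 := by exact_mod_cast Nat.choose_le_pow n 7
  calc _ ≤ (n : ℝ) ^ 7 * ((n : ℝ) ^ (-(33 / 50) : ℝ)) ^ 14 := by
        have := hp.upper
        gcongr
    _ = (n : ℝ) ^ ((7 : ℕ) : ℝ) * (n : ℝ) ^ (-(33 / 50) * (14 : ℕ) : ℝ) := by
        rw [← Real.rpow_natCast ((n : ℝ) ^ (-(33 / 50) : ℝ)) 14, ← Real.rpow_mul hn.le,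
          Real.rpow_natCast]
    _ = _ := by rw [← Real.rpow_add hn]; norm_num

/-- The expected number of pairs with seven common neighbours is at most `n ^ 9 * p ^ 14 = o(1)`. -/
theorem eventually_codegree_bound {ε : ℝ} (hε : 0 < ε) :
    ∀ᶠ n : ℕ in atTop, ∀ p, CoverDensity n p →
    (n : ℝ) ^ 2 * (n.choose (6 + 1) * p ^ (2 * (6 + 1))) ≤ ε := by
  filter_upwards [eventually_le_of_le_rpow 1 (a := 6 / 25) (by norm_num)
      (f := fun n => (n : ℝ) ^ (-(6 / 25) : ℝ)) (Eventually.of_forall fun n => by simp) hε]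
    with n h1 p hp
  refine le_trans ?_ h1
  have hn : (0 : ℝ) < n := by exact_mod_cast hp.pos
  refine (mul_le_mul_of_nonneg_left (codegree_bound hp) (by positivity)).trans (le_of_eq ?_)
  rw [← Real.rpow_natCast, ← Real.rpow_add hn]
  norm_num

end

/-! ### Rarity of poor vertices and abundance of uncovered ones -/

section

theorem binomPairExp_le_exp {N : ℕ} {p z ε : ℝ} (hp0 : 0 ≤ p) (hp1 : p ≤ 1) (hz0 : 0 ≤ z)
    (hz1 : z ≤ 1) (hε0 : 0 < ε) (hε1 : ε ≤ 1) (h2 : 2 ≤ (1 - ε) * (p * N)) :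
    binomPairExp N p (1 - p + p * z) ≤ Real.exp (-(p * N * ε ^ 3 / 2)) +
      Real.exp (-(p * (1 - z) * (((1 - ε) * (p * N) - 2) ^ 2 / 2))) := by
  set a := (1 - ε) * (p * N) with ha
  have hy : 1 - p + p * z = 1 - p * (1 - z) := by ring
  have hy0 : 0 ≤ p * (1 - z) := mul_nonneg hp0 (by linarith)
  have hy1 : p * (1 - z) ≤ 1 := by nlinarith
  have hm := Nat.floor_le (a := a) (by linarith)
  have hm2 := Nat.lt_floor_add_one a
  rw [hy]
  refine (binomPairExp_le (m := ⌊a⌋₊) hp0 hp1 (by linarith) (by linarith) hε0 hε1 hm).trans ?_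
  refine add_le_add_right ((one_sub_pow_le_exp hy1 _).trans ?_) _
  rw [Real.exp_le_exp, neg_le_neg_iff]
  refine mul_le_mul_of_nonneg_left ?_ hy0
  rw [Nat.cast_choose_two]
  nlinarith

theorem exp_neg_mul_log {n : ℕ} (hn : 0 < n) (a : ℝ) :
    Real.exp (-(a * Real.log n)) = (n : ℝ) ^ (-a) := by
  have hn' : (0 : ℝ) < n := by exact_mod_cast hn
  rw [Real.rpow_def_of_pos hn']
  ring_nf

/-- The average degree tends to infinity. -/
theorem CoverDensity.rpow_le {n : ℕ} {p : ℝ} (hp : CoverDensity n p) :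
    (n : ℝ) ^ (1 / 3 : ℝ) ≤ p * n := by
  have hn : (0 : ℝ) < n := by exact_mod_cast hp.pos
  have h := mul_le_mul_of_nonneg_right hp.lower hn.le
  rw [← Real.rpow_add_one hn.ne'] at h
  norm_num at h ⊢
  exact h

/-- The bound for poor vertices. The exponent is `-37 / 40`, up to the loss from `z = 1 / 100` and
from the concentration of the degree. -/
theorem eventually_binomPairExp_le : ∀ᶠ n : ℕ in atTop, ∀ p, CoverDensity n p →
    binomPairExp (n - 3) p (1 - p + p * (1 / 100)) ≤ 2 * (n : ℝ) ^ (-(43 / 50) : ℝ) := by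
  filter_upwards [eventually_mul_log_le_rpow 4000000 (a := 1 / 3) (by norm_num),
    eventually_le_rpow 1000 (a := 1 / 3) (by norm_num), eventually_ge_atTop 30000]
    with n h1 h2 h3 p hp
  have hn : (0 : ℝ) < n := by exact_mod_cast hp.pos
  have hn1 : (1 : ℝ) ≤ n := by exact_mod_cast hp.pos
  have hlog := Real.log_nonneg hn1
  have hp1 : p ≤ 1 := hp.upper.trans (Real.rpow_le_one_of_one_le_of_nonpos hn1 (by norm_num))
  have hp0 : 0 ≤ p := (by positivity : (0 : ℝ) ≤ _).trans hp.lower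
  have hpn := hp.rpow_le
  have hsub : ((n - 3 : ℕ) : ℝ) = n - 3 := by rw [Nat.cast_sub (by omega)]; norm_num
  have h3' : (30000 : ℝ) ≤ n := by exact_mod_cast h3
  have hpN : 9999 / 10000 * (p * n) ≤ p * (n - 3 : ℕ) := by rw [hsub]; nlinarith
  have hge : 98 / 100 * (p * n) ≤ (1 - 1 / 100) * (p * (n - 3 : ℕ)) - 2 := by linarith
  have h := binomPairExp_le_exp (N := n - 3) (z := 1 / 100) (ε := 1 / 100) hp0 hp1 (by norm_num)
    (by norm_num) (by norm_num) (by norm_num) (by linarith)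
  refine h.trans ?_
  rw [← exp_neg_mul_log hp.pos, two_mul]
  refine add_le_add ?_ ?_
  · rw [Real.exp_le_exp]
    linarith
  · rw [Real.exp_le_exp, neg_le_neg_iff]
    have e1 : (98 / 100 * (p * n)) ^ 2 ≤ ((1 - 1 / 100) * (p * (n - 3 : ℕ)) - 2) ^ 2 :=
      pow_le_pow_left₀ (by positivity) hge 2
    have e2 : p * (1 - 1 / 100) * ((98 / 100 * (p * n)) ^ 2 / 2) =
        99 * 98 ^ 2 / 2000000 * (n ^ 2 * p ^ 3) := by ring
    have e3 : p * (1 - 1 / 100) * ((98 / 100 * (p * n)) ^ 2 / 2) ≤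
        p * (1 - 1 / 100) * (((1 - 1 / 100) * (p * (n - 3 : ℕ)) - 2) ^ 2 / 2) := by
      refine mul_le_mul_of_nonneg_left ?_ (by positivity)
      linarith
    rw [e2, hp.cube] at e3
    linarith

/-- The expected number of poor pairs with a common neighbour in the smaller graph or joined by an
edge of the larger one is `o(1)`. The powers of `100` are the price of `240` triangles and of the
edges within a common neighbourhood of size `6`. -/
theorem eventually_poor_bound {ε : ℝ} (hε : 0 < ε) :
    ∀ᶠ n : ℕ in atTop, ∀ p, CoverDensity n p →
    ((n : ℝ) ^ 3 * p ^ 2 + (n : ℝ) ^ 2 * (n : ℝ) ^ (-(1 / 2) : ℝ)) *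
      ((((1 / 100 : ℝ)) ^ (2 * (6 * (2 * 20))))⁻¹ * ((1 - p + p * (1 / 100)) ^ (6).choose 2)⁻¹ *
      binomPairExp (n - 3) p (1 - p + p * (1 / 100)) ^ 2) ≤ ε := by
  filter_upwards [eventually_le_of_le_rpow (8 * ((((1 / 100 : ℝ)) ^ (2 * (6 * (2 * 20))))⁻¹ *
      ((1 / 100) ^ (6).choose 2)⁻¹)) (a := 1 / 25) (by norm_num)
      (f := fun n => 8 * ((((1 / 100 : ℝ)) ^ (2 * (6 * (2 * 20))))⁻¹ *
      ((1 / 100) ^ (6).choose 2)⁻¹) * (n : ℝ) ^ (-(1 / 25) : ℝ))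
      (Eventually.of_forall fun n => le_rfl) hε,
    eventually_binomPairExp_le] with n h1 h2 p hp
  refine le_trans ?_ h1
  have hn : (0 : ℝ) < n := by exact_mod_cast hp.pos
  have hn1 : (1 : ℝ) ≤ n := by exact_mod_cast hp.pos
  have hp1 : p ≤ 1 := hp.upper.trans (Real.rpow_le_one_of_one_le_of_nonpos hn1 (by norm_num))
  have hp0 : 0 ≤ p := (by positivity : (0 : ℝ) ≤ _).trans hp.lower
  have hy : 1 / 100 ≤ 1 - p + p * (1 / 100) := by linarith
  have hb0 := binomPairExp_nonneg (n - 3) hp0 hp1 (show 0 ≤ 1 - p + p * (1 / 100) by linarith)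
  have hb := h2 p hp
  have e1 : (n : ℝ) ^ 3 * p ^ 2 ≤ (n : ℝ) ^ (42 / 25 : ℝ) := by
    calc (n : ℝ) ^ 3 * p ^ 2 ≤ (n : ℝ) ^ 3 * ((n : ℝ) ^ (-(33 / 50) : ℝ)) ^ 2 := by
          have := hp.upper
          gcongr
      _ = (n : ℝ) ^ ((3 : ℕ) : ℝ) * (n : ℝ) ^ (-(33 / 50) * (2 : ℕ) : ℝ) := by
          rw [← Real.rpow_natCast ((n : ℝ) ^ (-(33 / 50) : ℝ)) 2, ← Real.rpow_mul hn.le,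
            Real.rpow_natCast]
      _ = _ := by rw [← Real.rpow_add hn]; norm_num
  have e2 : (n : ℝ) ^ 2 * (n : ℝ) ^ (-(1 / 2) : ℝ) ≤ (n : ℝ) ^ (42 / 25 : ℝ) := by
    rw [← Real.rpow_natCast, ← Real.rpow_add hn]
    exact Real.rpow_le_rpow_of_exponent_le hn1 (by norm_num)
  have e3 : (((1 - p + p * (1 / 100)) ^ (6).choose 2))⁻¹ ≤ ((1 / 100 : ℝ) ^ (6).choose 2)⁻¹ :=
    inv_anti₀ (by positivity) (pow_le_pow_left₀ (by norm_num) hy _)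
  have e4 : binomPairExp (n - 3) p (1 - p + p * (1 / 100)) ^ 2 ≤
      4 * (n : ℝ) ^ (-(43 / 25) : ℝ) := by
    calc _ ≤ (2 * (n : ℝ) ^ (-(43 / 50) : ℝ)) ^ 2 := pow_le_pow_left₀ hb0 hb 2
      _ = 4 * (n : ℝ) ^ (-(43 / 50) * (2 : ℕ) : ℝ) := by
          rw [mul_pow, ← Real.rpow_natCast ((n : ℝ) ^ (-(43 / 50) : ℝ)) 2, ← Real.rpow_mul hn.le]
          norm_num
      _ = _ := by norm_num
  have hy0 : 0 < 1 - p + p * (1 / 100) := by linarith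
  generalize hz : ((1 / 100 : ℝ) ^ (2 * (6 * (2 * 20))))⁻¹ = Z
  have hZ : 0 ≤ Z := by rw [← hz]; positivity
  generalize hz2 : ((1 / 100 : ℝ) ^ (6).choose 2)⁻¹ = Z2 at e3 ⊢
  have hZ2 : 0 ≤ Z2 := by rw [← hz2]; positivity
  calc _ ≤ ((n : ℝ) ^ (42 / 25 : ℝ) + (n : ℝ) ^ (42 / 25 : ℝ)) *
        (Z * Z2 * (4 * (n : ℝ) ^ (-(43 / 25) : ℝ))) := by gcongr
    _ = 8 * (Z * Z2) * ((n : ℝ) ^ (42 / 25 : ℝ) * (n : ℝ) ^ (-(43 / 25) : ℝ)) := by ring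
    _ = _ := by rw [← Real.rpow_add hn]; norm_num

/-- The true exponent is `-37 / 40`; any exponent above `-1` makes the expected number of uncovered
vertices tend to infinity. -/
theorem eventually_le_binomPairExp : ∀ᶠ n : ℕ in atTop, ∀ p, CoverDensity n p →
    1 / 2 * (n : ℝ) ^ (-(199 / 200) : ℝ) ≤ binomPairExp (n - 2) p (1 - p) := by
  filter_upwards [eventually_le_rpow 20000 (a := 1 / 3) (by norm_num),
    eventually_le_rpow 200 (a := 33 / 50) (by norm_num), eventually_ge_atTop 4]
    with n h1 h2 h3 p hp
  have hn : (0 : ℝ) < n := by exact_mod_cast hp.pos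
  have hn1 : (1 : ℝ) ≤ n := by exact_mod_cast hp.pos
  have hlog := Real.log_nonneg hn1
  have hp0 : 0 ≤ p := (by positivity : (0 : ℝ) ≤ _).trans hp.lower
  have hp200 : p ≤ 1 / 200 := by
    refine hp.upper.trans ?_
    rw [Real.rpow_neg hn.le, one_div]
    exact inv_anti₀ (by norm_num) h2
  have hpn := hp.rpow_le
  have hsub : ((n - 2 : ℕ) : ℝ) = n - 2 := by rw [Nat.cast_sub (by omega)]; norm_num
  have h3' : (4 : ℝ) ≤ n := by exact_mod_cast h3
  have hpN : p * (n - 2 : ℕ) ≤ p * n := by rw [hsub]; nlinarith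
  have hpN2 : 1 / 2 * (p * n) ≤ p * (n - 2 : ℕ) := by rw [hsub]; nlinarith
  set b := (1 + 1 / 100 : ℝ) ^ 2 * (p * (n - 2 : ℕ)) with hb
  have hb0 : 0 ≤ b := by positivity
  have hM := Nat.le_ceil b
  have hM2 := (Nat.ceil_lt_add_one hb0).le
  set M := ⌈b⌉₊
  have h := le_binomPairExp (N := n - 2) (M := M) (p := p) (y := 1 - p) (ε := 1 / 100) hp0
    (by linarith) (by linarith) (by linarith) (by norm_num) (by linarith)
  refine le_trans ?_ h
  rw [mul_comm]
  have hMn : (M : ℝ) ≤ 103 / 100 * (p * n) := by rw [hb] at hM2; linarith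
  refine mul_le_mul ?_ ?_ (by norm_num) (pow_nonneg (by linarith) _)
  · have e1 : Real.exp (-(101 / 100 * p)) ≤ 1 - p := by
      rw [← Real.le_log_iff_exp_le (by linarith)]
      refine le_trans ?_ (Real.one_sub_inv_le_log_of_pos (by linarith))
      have : (1 - p)⁻¹ ≤ 1 + 101 / 100 * p := by
        rw [inv_le_iff_one_le_mul₀ (by linarith)]
        nlinarith
      linarith
    have e2 := pow_le_pow_left₀ (Real.exp_pos _).le e1 (M.choose 2)
    rw [← Real.exp_nat_mul] at e2
    refine le_trans ?_ e2
    rw [← exp_neg_mul_log hp.pos, Real.exp_le_exp]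
    have e3 : ((M.choose 2 : ℕ) : ℝ) ≤ (103 / 100 * (p * n)) ^ 2 / 2 := by
      rw [Nat.cast_choose_two]
      have := pow_le_pow_left₀ (Nat.cast_nonneg M) hMn 2
      have hM0 : (0 : ℝ) ≤ M := Nat.cast_nonneg M
      nlinarith
    have e4 : (M.choose 2 : ℕ) * (101 / 100 * p) ≤
        (103 / 100 * (p * n)) ^ 2 / 2 * (101 / 100 * p) :=
      mul_le_mul_of_nonneg_right e3 (by positivity)
    have e5 : (103 / 100 * (p * n)) ^ 2 / 2 * (101 / 100 * p) =
        103 ^ 2 * 101 / 2000000 * (n ^ 2 * p ^ 3) := by ring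
    rw [e5, hp.cube] at e4
    linarith
  · have e1 : Real.exp (-((1 / 100) ^ 2 * (p * (n - 2 : ℕ)))) ≤ Real.exp (-1) := by
      rw [Real.exp_le_exp]
      linarith
    have e2 : Real.exp (-1) ≤ 1 / 2 := by
      rw [Real.exp_neg, one_div]
      refine inv_anti₀ (by norm_num) ?_
      linarith [Real.add_one_le_exp (1 : ℝ)]
    linarith

theorem eventually_uncovered_bound {ε : ℝ} (hε : 0 < ε) :
    ∀ᶠ n : ℕ in atTop, ∀ p, CoverDensity n p → 0 < binomPairExp (n - 2) p (1 - p) ∧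
    ((n : ℝ) * ((1 - p) * binomPairExp (n - 2) p (1 - p)))⁻¹ +
      (((1 - p) ^ (6).choose 2)⁻¹ + n.choose (6 + 1) * p ^ (2 * (6 + 1)) /
        binomPairExp (n - 2) p (1 - p) ^ 2) / (1 - p) ^ 2 - 1 ≤ ε := by
  filter_upwards [eventually_le_of_le_rpow 54 (a := 1 / 200) (by norm_num)
      (f := fun n => 54 * (n : ℝ) ^ (-(1 / 200) : ℝ)) (Eventually.of_forall fun n => le_rfl) hε,
    eventually_le_binomPairExp, eventually_le_rpow 200 (a := 33 / 50) (by norm_num)]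
    with n h1 h2 h3 p hp
  have hn : (0 : ℝ) < n := by exact_mod_cast hp.pos
  have hn1 : (1 : ℝ) ≤ n := by exact_mod_cast hp.pos
  have hp0 : 0 ≤ p := (by positivity : (0 : ℝ) ≤ _).trans hp.lower
  have hp200 : p ≤ 1 / 200 := by
    refine hp.upper.trans ?_
    rw [Real.rpow_neg hn.le, one_div]
    exact inv_anti₀ (by norm_num) h3
  have hq := h2 p hp
  set q := binomPairExp (n - 2) p (1 - p)
  have hq0 : 0 < q := lt_of_lt_of_le (by positivity) hq
  refine ⟨hq0, le_trans ?_ h1⟩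
  have h1p : 1 / 2 ≤ 1 - p := by linarith
  have h1p0 : 0 < 1 - p := by linarith
  have t1 : ((n : ℝ) * ((1 - p) * q))⁻¹ ≤ 4 * (n : ℝ) ^ (-(1 / 200) : ℝ) := by
    have e1 : (n : ℝ) ^ (1 / 200 : ℝ) / 4 ≤ n * ((1 - p) * q) := by
      calc (n : ℝ) ^ (1 / 200 : ℝ) / 4 = n * (1 / 2 * (1 / 2 * (n : ℝ) ^ (-(199 / 200) : ℝ))) := by
            have : (n : ℝ) ^ (1 / 200 : ℝ) = (n : ℝ) ^ (-(199 / 200) : ℝ) * n := by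
              rw [← Real.rpow_add_one hn.ne']; norm_num
            rw [this]; ring
        _ ≤ _ := by gcongr
    calc _ ≤ ((n : ℝ) ^ (1 / 200 : ℝ) / 4)⁻¹ := inv_anti₀ (by positivity) e1
      _ = _ := by rw [inv_div, Real.rpow_neg hn.le, div_eq_mul_inv]
  have t2 : ((1 - p) ^ (6).choose 2)⁻¹ / (1 - p) ^ 2 ≤ 1 + 34 * (n : ℝ) ^ (-(1 / 200) : ℝ) := by
    have e0 : ((1 - p) ^ (6).choose 2)⁻¹ / (1 - p) ^ 2 = ((1 - p) ^ 17)⁻¹ := by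
      rw [show Nat.choose 6 2 = 15 by decide, div_eq_mul_inv, ← mul_inv, ← pow_add]
    have e1 : 1 - 17 * p ≤ (1 - p) ^ 17 := by
      have := one_add_mul_le_pow (a := -p) (by linarith) 17
      calc 1 - 17 * p = 1 + (17 : ℕ) * (-p) := by push_cast; ring
        _ ≤ _ := this
        _ = _ := by ring
    have e2 : ((1 - p) ^ 17)⁻¹ ≤ 1 + 34 * p := by
      rw [inv_le_iff_one_le_mul₀ (by positivity)]
      have : (1 + 34 * p) * (1 - 17 * p) ≤ (1 + 34 * p) * (1 - p) ^ 17 :=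
        mul_le_mul_of_nonneg_left e1 (by positivity)
      nlinarith
    have e3 : p ≤ (n : ℝ) ^ (-(1 / 200) : ℝ) :=
      hp.upper.trans (Real.rpow_le_rpow_of_exponent_le hn1 (by norm_num))
    rw [e0]
    linarith
  have t3 : n.choose (6 + 1) * p ^ (2 * (6 + 1)) / q ^ 2 / (1 - p) ^ 2 ≤
      16 * (n : ℝ) ^ (-(1 / 200) : ℝ) := by
    have e1 := codegree_bound hp
    have e2 : 1 / 4 * (n : ℝ) ^ (-(199 / 100) : ℝ) ≤ q ^ 2 := by
      have := pow_le_pow_left₀ (by positivity) hq 2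
      rw [mul_pow, ← Real.rpow_natCast ((n : ℝ) ^ (-(199 / 200) : ℝ)) 2, ← Real.rpow_mul hn.le]
        at this
      norm_num at this ⊢
      exact this
    have e3 : 1 / 4 ≤ (1 - p) ^ 2 := by nlinarith
    calc _ ≤ (n : ℝ) ^ (-(56 / 25) : ℝ) / (1 / 4 * (n : ℝ) ^ (-(199 / 100) : ℝ)) / (1 / 4) := by
          gcongr
      _ = 16 * ((n : ℝ) ^ (-(56 / 25) : ℝ) / (n : ℝ) ^ (-(199 / 100) : ℝ)) := by
          field_simp; norm_num
      _ = 16 * (n : ℝ) ^ (-(1 / 4) : ℝ) := by rw [← Real.rpow_sub hn]; norm_num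
      _ ≤ _ := by
          have := Real.rpow_le_rpow_of_exponent_le hn1 (show (-(1 / 4) : ℝ) ≤ -(1 / 200) by
            norm_num)
          linarith
  rw [add_div]
  linarith

theorem eventually_covered_bound {ε : ℝ} (hε : 0 < ε) : ∀ᶠ n : ℕ in atTop,
    (n : ℝ) * binomPairExp (n - 2) ((n : ℝ) ^ (-(1 / 2) : ℝ)) (1 - (n : ℝ) ^ (-(1 / 2) : ℝ)) ≤
      ε := by
  filter_upwards [eventually_le_of_le_rpow 2 (a := 1) (by norm_num)
      (f := fun n => 2 * (n : ℝ) ^ (-1 : ℝ)) (Eventually.of_forall fun n => le_rfl) hε,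
    eventually_mul_log_le_rpow 256 (a := 1 / 2) (by norm_num),
    eventually_le_rpow 16 (a := 1 / 2) (by norm_num), eventually_ge_atTop 4] with n h1 h2 h3 h4
  refine le_trans ?_ h1
  have hn0 : 0 < n := by omega
  have hn : (0 : ℝ) < n := by exact_mod_cast hn0
  have hn1 : (1 : ℝ) ≤ n := by exact_mod_cast hn0
  set p := (n : ℝ) ^ (-(1 / 2) : ℝ) with hp
  have hp0 : 0 ≤ p := by positivity
  have hp1 : p ≤ 1 := Real.rpow_le_one_of_one_le_of_nonpos hn1 (by norm_num)
  have hpn : p * n = (n : ℝ) ^ (1 / 2 : ℝ) := by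
    rw [hp, ← Real.rpow_add_one hn.ne']; norm_num
  have hsub : ((n - 2 : ℕ) : ℝ) = n - 2 := by rw [Nat.cast_sub (by omega)]; norm_num
  have h4' : (4 : ℝ) ≤ n := by exact_mod_cast h4
  have hpN2 : 1 / 2 * (n : ℝ) ^ (1 / 2 : ℝ) ≤ p * (n - 2 : ℕ) := by
    rw [hsub, ← hpn]; nlinarith
  have hge : 1 / 8 * (p * n) ≤ (1 - 1 / 2) * (p * (n - 2 : ℕ)) - 2 := by rw [hpn]; linarith
  have h := binomPairExp_le_exp (N := n - 2) (z := 0) (ε := 1 / 2) hp0 hp1 (by norm_num)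
    (by norm_num) (by norm_num) (by norm_num) (by linarith)
  rw [mul_zero, add_zero] at h
  have hq : binomPairExp (n - 2) p (1 - p) ≤ 2 * (n : ℝ) ^ (-2 : ℝ) := by
    refine h.trans ?_
    rw [← exp_neg_mul_log hn0, two_mul]
    refine add_le_add ?_ ?_
    · rw [Real.exp_le_exp]
      linarith
    · rw [Real.exp_le_exp, neg_le_neg_iff]
      have e1 : (1 / 8 * (p * n)) ^ 2 ≤ ((1 - 1 / 2) * (p * (n - 2 : ℕ)) - 2) ^ 2 :=
        pow_le_pow_left₀ (by positivity) hge 2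
      have e2 : p * (1 - 0) * ((1 / 8 * (p * n)) ^ 2 / 2) ≤
          p * (1 - 0) * (((1 - 1 / 2) * (p * (n - 2 : ℕ)) - 2) ^ 2 / 2) := by
        refine mul_le_mul_of_nonneg_left ?_ (by linarith)
        linarith
      have e3 : p * (1 - 0) * ((1 / 8 * (p * n)) ^ 2 / 2) = 1 / 128 * (n : ℝ) ^ (1 / 2 : ℝ) := by
        have : p * (n : ℝ) ^ (1 / 2 : ℝ) = 1 := by
          rw [hp, ← Real.rpow_add hn]; norm_num
        rw [hpn]
        linear_combination (1 / 128 * (n : ℝ) ^ (1 / 2 : ℝ)) * this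
      rw [e3] at e2
      linarith
  calc _ ≤ (n : ℝ) * (2 * (n : ℝ) ^ (-2 : ℝ)) := mul_le_mul_of_nonneg_left hq hn.le
    _ = 2 * ((n : ℝ) ^ (-2 : ℝ) * n) := by ring
    _ = _ := by rw [← Real.rpow_add_one hn.ne']; norm_num

end

/-! ### The hitting times -/

section

theorem EveryVertexInTriangle.mono {V : Type*} {G H : SimpleGraph V} (hGH : G ≤ H)
    (h : EveryVertexInTriangle G) : EveryVertexInTriangle H := fun v =>
  let ⟨x, y, hx, hy, hxy⟩ := h v
  ⟨x, y, hGH hx, hGH hy, hGH hxy⟩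

/-- If the triangle cover is completed between the times `s` and `t`, and the graphs at these
times form a good pair, then the graph that completes the cover is the first one that is connected
and has no NAC-colouring. -/
theorem GoodPair.hittingTime_eq {V : Type*} [Fintype V] {m : ℕ} {g : Fin (m + 1) → SimpleGraph V}
    (hg : Monotone g) {s t : Fin (m + 1)} {a b c D : ℕ} (hgood : GoodPair (g s) (g t) a b c D)
    (hV : 3 ≤ Fintype.card V) (ha : 6 * a ≤ Fintype.card V)
    (hs : ¬ EveryVertexInTriangle (g s)) (ht : EveryVertexInTriangle (g t)) :
    hittingTime ConnectedNoNAC g = hittingTime EveryVertexInTriangle g := by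
  have : Nontrivial V := Fintype.one_lt_card_iff_nontrivial.1 (by omega)
  refine le_antisymm (le_iInf₂ fun r hr => ?_)
    (le_iInf₂ fun r hr => iInf₂_le r (hr.everyVertexInTriangle hV))
  have hsr : s ≤ r := by
    by_contra hlt
    exact hs (hr.mono (hg (not_le.1 hlt).le))
  rcases le_total r t with hrt | htr
  · exact iInf₂_le r (hgood.connectedNoNAC (hg hsr) (hg hrt) ha hr)
  · refine (iInf₂_le t (hgood.connectedNoNAC (hg ?_) le_rfl ha ht)).trans
      (by exact_mod_cast htr)
    by_contra hlt
    exact hs (ht.mono (hg ((le_total s t).resolve_left fun h => hlt h)))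

/-- What can go wrong for a pair of nested graphs between which the triangle cover should be
completed. -/
def BadPair {V : Type*} [Fintype V] (a b c D : ℕ) (G₁ G₂ : SimpleGraph V) : Prop :=
  ¬ GoodPair G₁ G₂ a b c D ∨ EveryVertexInTriangle G₁ ∨ ¬ EveryVertexInTriangle G₂

theorem one_sub_le_hittingTime_eq {V : Type*} [Fintype V] {p p' : ℝ}
    (hw : IsWeight (nestedWeight p p')) {a b c D N : ℕ} (hV : 3 ≤ Fintype.card V)
    (hN : (Fintype.card V).choose 2 = N) (ha : 6 * a ≤ Fintype.card V) {ε : ℝ}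
    (hbad : labelProb (nestedWeight p p')
      (fun ω : Sym2 V → Fin 3 => BadPair a b c D (lowerGraph ω) (upperGraph ω)) ≤ ε) :
    1 - ENNReal.ofReal ε ≤ (randomGraphHistory V N).toOuterMeasure
      {g | hittingTime ConnectedNoNAC g = hittingTime EveryVertexInTriangle g} := by
  obtain ⟨s, t, hst, ht, h⟩ := exists_times_le_labelProb (V := V) hw (BadPair a b c D)
  subst hN
  set N := (Fintype.card V).choose 2
  set μ := randomGraphHistory V N
  have h1 : μ.toOuterMeasure
      {g | BadPair a b c D (g ⟨s, by omega⟩) (g ⟨t, by omega⟩)} ≤ ENNReal.ofReal ε :=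
    h.trans (ENNReal.ofReal_le_ofReal hbad)
  rw [tsub_le_iff_right]
  refine le_trans ?_ (add_le_add le_rfl h1)
  refine le_trans ?_ (MeasureTheory.measure_union_le _ _)
  refine ((PMF.toOuterMeasure_apply_eq_one_iff μ _).2 fun g hg => ?_).ge
  by_cases hb : BadPair a b c D (g ⟨s, by omega⟩) (g ⟨t, by omega⟩)
  · exact Or.inr hb
  · rw [BadPair, not_or, not_or, not_not, not_not] at hb
    exact Or.inl (hb.1.hittingTime_eq (monotone_of_mem_support_randomGraphHistory N g hg)
      hV ha hb.2.1 hb.2.2)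

theorem eventually_labelProb_badPair_le {ε : ℝ} (hε : 0 < ε) : ∀ᶠ n : ℕ in atTop,
    IsWeight (nestedWeight (coverDensity n) ((n : ℝ) ^ (-(1 / 2) : ℝ))) ∧
    labelProb (nestedWeight (coverDensity n) ((n : ℝ) ^ (-(1 / 2) : ℝ)))
      (fun ω : Sym2 (Fin n) → Fin 3 => BadPair (largeSize n) (moderateSize n) 6 (2 * 20)
        (lowerGraph ω) (upperGraph ω)) ≤ 8 * ε := by
  filter_upwards [eventually_coverDensity, eventually_mul_largeSize_le 4,
    eventually_joined_bound hε, eventually_expands_bound hε, eventually_common_bound hε,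
    eventually_sparse_bound hε, eventually_codegree_bound hε, eventually_poor_bound hε,
    eventually_uncovered_bound hε, eventually_covered_bound hε, eventually_ge_atTop 3,
    eventually_le_rpow 2 (a := 33 / 50) (by norm_num)]
    with n hp hs h1 h2 h3 h4 h5 h6 h7 h8 hn hn2
  have hn0 : (0 : ℝ) < n := by exact_mod_cast hp.pos
  have hn1 : (1 : ℝ) ≤ n := by exact_mod_cast hp.pos
  set p := coverDensity n
  set p' := (n : ℝ) ^ (-(1 / 2) : ℝ)
  have hp0 : 0 ≤ p := (by positivity : (0 : ℝ) ≤ _).trans hp.lower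
  have hpp' : p ≤ p' := hp.upper.trans (Real.rpow_le_rpow_of_exponent_le hn1 (by norm_num))
  have hp'1 : p' ≤ 1 := Real.rpow_le_one_of_one_le_of_nonpos hn1 (by norm_num)
  have hp1 : p < 1 := by
    refine hp.upper.trans_lt ?_
    rw [Real.rpow_neg hn0.le]
    exact inv_lt_one_of_one_lt₀ (by linarith)
  have hw := isWeight_nestedWeight hp0 hpp' hp'1
  refine ⟨hw, ?_⟩
  have : Nontrivial (Fin n) := Fin.nontrivial_iff_two_le.2 (by omega)
  have b1 := labelProb_not_goodPair_le (V := Fin n) hw (by simpa using hn) (largeSize n)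
    (moderateSize n) 6 20 (by simpa using hs) (z := 1 / 100) (by norm_num) (by norm_num) hp1
  have b2 := labelProb_everyVertexInTriangle_le (V := Fin n) (P := (· = 0)) hw 6
    (by rw [weightOf_nestedWeight_lower]; exact hp1)
    (by rw [weightOf_nestedWeight_lower, Fintype.card_fin]; exact (h7 p hp).1)
  have b3 := labelProb_not_everyVertexInTriangle_le (V := Fin n) (P := (· ≠ 2)) hw
  rw [weightOf_nestedWeight_lower] at b2
  rw [weightOf_nestedWeight_upper] at b3
  rw [Fintype.card_fin] at b1 b2 b3
  have c1 := (labelProb_or_le hw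
    (fun ω : Sym2 (Fin n) → Fin 3 => ¬ GoodPair (lowerGraph ω) (upperGraph ω) (largeSize n)
      (moderateSize n) 6 (2 * 20))
    (fun ω => EveryVertexInTriangle (lowerGraph ω) ∨ ¬ EveryVertexInTriangle (upperGraph ω)))
  have c2 := (labelProb_or_le hw
    (fun ω : Sym2 (Fin n) → Fin 3 => EveryVertexInTriangle (lowerGraph ω))
    (fun ω => ¬ EveryVertexInTriangle (upperGraph ω)))
  refine c1.trans ((add_le_add (b1.trans (add_le_add (h1 p hp) (add_le_add (h2 p hp) (add_le_add
    (h3 p hp) (add_le_add (h4 p hp) (add_le_add (h5 p hp) (h6 p hp))))))) (c2.trans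
    (add_le_add (b2.trans (h7 p hp).2) (b3.trans h8)))).trans_eq ?_)
  ring

theorem eventually_one_sub_le_randomGraphProcess {ε : ℝ} (hε : 0 < ε) : ∀ᶠ n : ℕ in atTop,
    1 - ENNReal.ofReal ε ≤ (randomGraphProcess n).toOuterMeasure
      {g | hittingTime ConnectedNoNAC g = hittingTime EveryVertexInTriangle g} := by
  filter_upwards [eventually_labelProb_badPair_le (ε := ε / 8) (by positivity),
    eventually_mul_largeSize_le 6, eventually_ge_atTop 3] with n h hs hn
  exact one_sub_le_hittingTime_eq h.1 (by simpa using hn) (by rw [Fintype.card_fin])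
    (by simpa using hs) (h.2.trans_eq (by ring))

end

theorem mainTheorem1 :
    Tendsto
      (fun n : ℕ => (randomGraphProcess n).toOuterMeasure
        {g | hittingTime ConnectedNoNAC g = hittingTime EveryVertexInTriangle g})
      atTop (𝓝 1) := by
  refine tendsto_order.2 ⟨fun a ha => ?_, fun a ha => Eventually.of_forall fun n => ?_⟩
  · obtain ⟨b, hab, hb1⟩ := exists_between ha
    have hb : b ≠ ⊤ := (hb1.trans ENNReal.one_lt_top).ne
    have hε : 0 < (1 - b).toReal :=
      ENNReal.toReal_pos (tsub_pos_of_lt hb1).ne' (ENNReal.sub_ne_top ENNReal.one_ne_top)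
    filter_upwards [eventually_one_sub_le_randomGraphProcess hε] with n hn
    rw [ENNReal.ofReal_toReal (ENNReal.sub_ne_top ENNReal.one_ne_top),
      ENNReal.sub_sub_cancel ENNReal.one_ne_top hb1.le] at hn
    exact hab.trans_le hn
  · refine lt_of_le_of_lt ?_ ha
    rw [← (PMF.toOuterMeasure_apply_eq_one_iff (randomGraphProcess n) Set.univ).2
      (Set.subset_univ _)]
    exact MeasureTheory.measure_mono (Set.subset_univ _)
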